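/- Let $M$ be a (Hausdorff) $C^\infty$ manifold of dimension $n$ and let $F\colon TM\to[0,\infty)$ be a Finsler norm: $F$ is continuous, positively $1$-homogeneous on the fibres, smooth on $TM\setminus 0$, and $g_{x,y}(u,v)=\frac12\,\partial_s\partial_t F^2(x,y+su+tv)|_{s=t=0}$ is positive definite for all $y\in T_xM\setminus\{0\}$. Let $\mathcal I_p=\{y\in T_pM: F(y)=1\}$ be the indicatrix at $p$ and $\mathcal IM=\bigcup_p\mathcal I_p\subset TM$ the indicatrix bundle; $\mathfrak X(\cdot)$ denotes the Lie algebra of smooth vector fields. In local coordinates $(x^i,y^i)$ of $TM$ put $4G^i=g^{il}\big(2\frac{\partial g_{jl}}{\partial x^k}-\frac{\partial g_{jk}}{\partial x^l}\big)y^jy^k$ and $G^i_j=\partial G^i/\partial y^j$. The horizontal lift is $(\partial/\partial x^i)^h=\partial/\partial x^i-G^k_i\,\partial/\partial y^k$, $h$ is the corresponding horizontal projector, and the curvature is $R=\frac12[h,h]$, the Nijenhuis torsion of $h$. A vector field $X$ along a curve $c$ is parallel if $\dot X^i+G^i_j(c,X)\dot c^j=0$. Fix $1\le r\le\infty$. The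 holonomy group $\mathrm{Hol}_p(M)\subset \mathrm{Diff}(\mathcal I_p)$ is the group generated by the parallel translations $\mathcal I_p\to\mathcal I_p$ along piecewise $C^r$ closed curves starting at $p$. A field $\xi\in\mathfrak X(\mathcal I_p)$ is tangent to a subgroup $\mathcal G\subset\mathrm{Diff}(\mathcal I_p)$ if there are $k\ge1$ and a $C^\infty$ curve $t\mapsto\varphi_t$ in $\mathrm{Diff}(\mathcal I_p)$, defined on an open interval around $0$ and with values in $\mathcal G$, such that $\varphi_0=\mathrm{id}$, $\partial_t^j\varphi_t|_{t=0}=0$ for $1\le j<k$, and $\partial_t^k\varphi_t|_{t=0}=\xi$. The holonomy algebra $\mathfrak{hol}_p(M)$ is the set of all $\xi\in\mathfrak X(\mathcal I_p)$ that are tangent to $\mathrm{Hol}_p(M)$. The curvature algebra $\mathfrak R_p$ is the Lie subalgebra of $\mathfrak X(\mathcal I_p)$ generated by the fields $R(a^h,b^h)|_{\mathcal I_p}$, $a,b\in T_pM$. The infinitesimal holonomy algebra $\mathfrak{hol}^*(M)$ is the smallest Lie subalgebra of $\mathfrak X(\mathcal IM)$ that contains all curvature fields $R(X^h,Y^h)$,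 $X,Y\in\mathfrak X(M)$, and that with $\xi$ contains the horizontal Berwald covariant derivatives $\nabla_X\xi=[X^h,\xi]$, $X\in\mathfrak X(M)$. Finally, $\mathfrak{hol}^*_p(M)=\{\xi|_{\mathcal I_p}:\xi\in\mathfrak{hol}^*(M)\}$. Proposition. For every $p\in M$, the elements of $\mathfrak{hol}^*_p(M)$ are tangent to the group $\mathrm{Hol}_p(M)$, and $\mathfrak{hol}^*_p(M)$ is a Lie subalgebra of $\mathfrak{hol}_p(M)$. Consequently there is the chain of Lie algebras $$\mathfrak R_p\subset\mathfrak{hol}^*_p(M)\subset\mathfrak{hol}_p(M)\subset\mathfrak X(\mathcal I_p),$$ in which each is a Lie subalgebra of the next. -/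

import Mathlib

open Set
open scoped Manifold ContDiff

noncomputable section

namespace FinslerHolonomy

/-- The model space `ℝⁿ`. -/
abbrev Coord (n : ℕ) : Type := EuclideanSpace ℝ (Fin n)

/-- The model with corners of a boundaryless real `n`-manifold. -/
abbrev Mdl (n : ℕ) : ModelWithCorners ℝ (Coord n) (Coord n) := 𝓘(ℝ, Coord n)

/-! ### Lie algebras of vector fields -/

section Lie

variable {V : Type*} [AddCommGroup V] [Module ℝ V]

/-- `L` is a real Lie subalgebra of `K` for the bracket `br`: it is contained in `K`, is a real
linear subspace and is closed under `br`. -/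
structure IsLieSubalgebraOf (br : V → V → V) (K L : Set V) : Prop where
  subset : L ⊆ K
  zero_mem : (0 : V) ∈ L
  add_mem : ∀ ξ ∈ L, ∀ η ∈ L, ξ + η ∈ L
  smul_mem : ∀ (a : ℝ), ∀ ξ ∈ L, a • ξ ∈ L
  lie_mem : ∀ ξ ∈ L, ∀ η ∈ L, br ξ η ∈ L

/-- The smallest Lie subalgebra of `K` that contains `S`. -/
def lieSpan (br : V → V → V) (K S : Set V) : Set V :=
  {ξ | ∀ L : Set V, IsLieSubalgebraOf br K L → S ⊆ L → ξ ∈ L}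

end Lie

variable {n : ℕ} {M : Type*} [TopologicalSpace M] [ChartedSpace (Coord n) M]
  [IsManifold (Mdl n) ∞ M]

/-! ### Finsler manifolds -/

/-- `g_{x,y}(u,v) = ½ ∂²F²(x, y + s u + t v) / ∂s ∂t` at `s = t = 0`. -/
def fundamentalForm (F : TangentBundle (Mdl n) M → ℝ) (x : M)
    (y u v : TangentSpace (Mdl n) x) : ℝ :=
  1 / 2 * deriv (fun s : ℝ => deriv (fun t : ℝ => F ⟨x, y + s • u + t • v⟩ ^ 2) 0) 0

/-- `F : TM → [0, ∞)` is a Finsler norm on the manifold `M`. -/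
structure IsFinsler (F : TangentBundle (Mdl n) M → ℝ) : Prop where
  nonneg : ∀ v, 0 ≤ F v
  continuous : Continuous F
  smooth : ContMDiffOn (Mdl n).tangent 𝓘(ℝ, ℝ) ∞ F {v | v.2 ≠ 0}
  homogeneous : ∀ (x : M) (y : TangentSpace (Mdl n) x) (a : ℝ), 0 < a →
    F ⟨x, a • y⟩ = a * F ⟨x, y⟩
  posDef : ∀ (x : M) (y u : TangentSpace (Mdl n) x), y ≠ 0 → u ≠ 0 →
    0 < fundamentalForm F x y u u

/-! ### Local coordinates: spray coefficients and horizontal distribution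

All coordinate expressions are taken in the chart `(xⁱ, yⁱ)` of `TM` that is induced by the
preferred chart of `M` at a point `o`. -/

/-- `∂φ/∂xᵏ` for a function `φ` of `(x, y) ∈ ℝⁿ × ℝⁿ`. -/
def dX (k : Fin n) (φ : Coord n × Coord n → ℝ) (z : Coord n × Coord n) : ℝ :=
  fderiv ℝ φ z (EuclideanSpace.single k 1, 0)

/-- `∂φ/∂yᵏ` for a function `φ` of `(x, y) ∈ ℝⁿ × ℝⁿ`. -/
def dY (k : Fin n) (φ : Coord n × Coord n → ℝ) (z : Coord n × Coord n) : ℝ :=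
  fderiv ℝ φ z (0, EuclideanSpace.single k 1)

/-- The square of the Finsler norm in the induced chart at `o`. -/
def normSqInChart (F : TangentBundle (Mdl n) M → ℝ) (o : M) (z : Coord n × Coord n) : ℝ :=
  F ((extChartAt (Mdl n).tangent (⟨o, 0⟩ : TangentBundle (Mdl n) M)).symm z) ^ 2

/-- `g_{ij}(x, y) = ½ ∂²F²/∂yⁱ∂yʲ`. -/
def metricCoeff (F : TangentBundle (Mdl n) M → ℝ) (o : M) (z : Coord n × Coord n) :
    Matrix (Fin n) (Fin n) ℝ :=
  Matrix.of fun i j => 1 / 2 * dY i (dY j (normSqInChart F o)) z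

/-- `Gⁱ(x, y)`, where `4 Gⁱ = g^{il} (2 ∂g_{jl}/∂xᵏ - ∂g_{jk}/∂xˡ) yʲ yᵏ`. -/
def sprayCoeff (F : TangentBundle (Mdl n) M → ℝ) (o : M) (i : Fin n)
    (z : Coord n × Coord n) : ℝ :=
  1 / 4 * ∑ j, ∑ k, ∑ l, (metricCoeff F o z)⁻¹ i l *
    (2 * dX k (fun w => metricCoeff F o w j l) z - dX l (fun w => metricCoeff F o w j k) z) *
    z.2 j * z.2 k

/-- The vector with `i`-th component `Gⁱ_j(x, y) aʲ`, where `Gⁱ_j = ∂Gⁱ/∂yʲ`. -/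
def connection (F : TangentBundle (Mdl n) M → ℝ) (o : M) (z : Coord n × Coord n)
    (a : Coord n) : Coord n :=
  WithLp.toLp 2 fun i => ∑ j, dY j (sprayCoeff F o i) z * a j

/-- The horizontal projector `h` in the chart: `(a, b) ↦ aⁱ (∂/∂xⁱ - Gᵏ_i ∂/∂yᵏ)`. -/
def horizontalProj (F : TangentBundle (Mdl n) M → ℝ) (o : M) (z : Coord n × Coord n)
    (A : Coord n × Coord n) : Coord n × Coord n :=
  (A.1, -connection F o z A.1)

/-- The horizontal lift `T_xM → T_{(x,y)}TM`. Here `T_v TM` is `ℝⁿ × ℝⁿ` by means of the chart of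
`TM` induced by the preferred chart of `M` at the base point of `v`. -/
def horizontalLift (F : TangentBundle (Mdl n) M → ℝ) (v : TangentBundle (Mdl n) M)
    (a : TangentSpace (Mdl n) v.1) : TangentSpace (Mdl n).tangent v :=
  horizontalProj F v.1 (extChartAt (Mdl n).tangent v v) ((a : Coord n), (0 : Coord n))

/-- The vertical lift `T_xM → T_{(x,y)}TM`, `bᵏ ∂/∂xᵏ ↦ bᵏ ∂/∂yᵏ`. -/
def verticalLift (v : TangentBundle (Mdl n) M)
    (b : TangentSpace (Mdl n) v.1) : TangentSpace (Mdl n).tangent v :=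
  ((0 : Coord n), (b : Coord n))

/-- The curvature tensor `R = ½ [h, h]`, the Nijenhuis torsion of `h`,
`R(A, B) = [hA, hB] - h[hA, B] - h[A, hB] + h[A, B]`, evaluated at tangent vectors `A`, `B` of `TM`
at `v` by extending them to fields with constant components in the chart (`h` is a projector, so
the last term `h²[A, B]` is `h[A, B]`). -/
def curvature (F : TangentBundle (Mdl n) M → ℝ) (v : TangentBundle (Mdl n) M)
    (A B : TangentSpace (Mdl n).tangent v) : TangentSpace (Mdl n).tangent v :=
  let h := horizontalProj F v.1
  let z := extChartAt (Mdl n).tangent v v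
  let A' : Coord n × Coord n → Coord n × Coord n := fun _ => A
  let B' : Coord n × Coord n → Coord n × Coord n := fun _ => B
  let hA : Coord n × Coord n → Coord n × Coord n := fun w => h w A
  let hB : Coord n × Coord n → Coord n × Coord n := fun w => h w B
  VectorField.lieBracket ℝ hA hB z - h z (VectorField.lieBracket ℝ hA B' z)
    - h z (VectorField.lieBracket ℝ A' hB z) + h z (VectorField.lieBracket ℝ A' B' z)

/-- The smooth vector fields on `M`. -/
def IsSmoothField (X : (x : M) → TangentSpace (Mdl n) x) : Prop :=
  ContMDiff (Mdl n) (Mdl n).tangent ∞ (fun x => (⟨x, X x⟩ : TangentBundle (Mdl n) M))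

/-! ### The indicatrix bundle and its vector fields -/

/-- The indicatrix bundle `{v ∈ TM | F v = 1}`. -/
def indicatrixBundle (F : TangentBundle (Mdl n) M → ℝ) : Set (TangentBundle (Mdl n) M) :=
  {v | F v = 1}

/-- Fields of vectors of `TM` along the indicatrix bundle. -/
abbrev BundleField (F : TangentBundle (Mdl n) M → ℝ) : Type _ :=
  (v : indicatrixBundle F) → TangentSpace (Mdl n).tangent (v : TangentBundle (Mdl n) M)

open Classical in
/-- Extension by zero of a field along the indicatrix bundle, a device to apply operators
"within the indicatrix bundle", which only see the values there. -/
def bundleExt (F : TangentBundle (Mdl n) M → ℝ) (ξ : BundleField F)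
    (v : TangentBundle (Mdl n) M) : TangentSpace (Mdl n).tangent v :=
  if hv : v ∈ indicatrixBundle F then ξ ⟨v, hv⟩ else 0

/-- The smooth vector fields on the indicatrix bundle, a hypersurface of `TM`: the smooth fields
along it that are tangent to it. -/
def bundleFields (F : TangentBundle (Mdl n) M → ℝ) : Set (BundleField F) :=
  {ξ | ContMDiffOn (Mdl n).tangent (Mdl n).tangent.tangent ∞
      (fun v => (⟨v, bundleExt F ξ v⟩ :
        TangentBundle (Mdl n).tangent (TangentBundle (Mdl n) M))) (indicatrixBundle F) ∧
    ∀ v : indicatrixBundle F,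
      mfderiv (Mdl n).tangent 𝓘(ℝ, ℝ) F (v : TangentBundle (Mdl n) M) (ξ v) = 0}

/-- The Lie bracket of vector fields on the indicatrix bundle. In a chart of `TM` this is
`Dη(ξ) - Dξ(η)` with derivatives taken within the hypersurface; these are applied to directions
tangent to it, where they are determined by the fields on the hypersurface. -/
def bundleBracket (F : TangentBundle (Mdl n) M → ℝ) (ξ η : BundleField F) : BundleField F :=
  fun v => VectorField.mlieBracketWithin (Mdl n).tangent (bundleExt F ξ) (bundleExt F η)
    (indicatrixBundle F) v

/-- A field along the indicatrix bundle is vertical if it is annihilated by `π_*`. -/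
def IsVertical (F : TangentBundle (Mdl n) M → ℝ) (ξ : BundleField F) : Prop :=
  ∀ v : indicatrixBundle F,
    mfderiv (Mdl n).tangent (Mdl n) (fun w : TangentBundle (Mdl n) M => w.1)
      (v : TangentBundle (Mdl n) M) (ξ v) = 0

/-- The curvature vector fields `ξ = R(Xʰ, Yʰ)`, `X, Y ∈ 𝔛(M)`. -/
def curvatureFields (F : TangentBundle (Mdl n) M → ℝ) : Set (BundleField F) :=
  {ξ | ∃ X Y : (x : M) → TangentSpace (Mdl n) x, IsSmoothField X ∧ IsSmoothField Y ∧
    ∀ v : indicatrixBundle F, ξ v = curvature F v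
      (horizontalLift F v (X (v : TangentBundle (Mdl n) M).1))
      (horizontalLift F v (Y (v : TangentBundle (Mdl n) M).1))}

/-- The horizontal Berwald covariant derivative `∇_X ξ = [Xʰ, ξ]` of a vertical field `ξ`. In
coordinates, it has the components `(∂ξⁱ/∂xʲ - Gᵏ_j ∂ξⁱ/∂yᵏ + (∂Gⁱ_j/∂yᵏ) ξᵏ) Xʲ`. -/
def berwald (F : TangentBundle (Mdl n) M → ℝ) (X : (x : M) → TangentSpace (Mdl n) x)
    (ξ : BundleField F) : BundleField F :=
  bundleBracket F (fun v => horizontalLift F v (X (v : TangentBundle (Mdl n) M).1)) ξ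

/-- The infinitesimal holonomy algebra `𝔥𝔬𝔩*(M)`: the smallest Lie algebra of vector fields on the
indicatrix bundle that contains the curvature vector fields and is closed under the horizontal
Berwald covariant derivatives. -/
def infHolonomyAlgebra (F : TangentBundle (Mdl n) M → ℝ) : Set (BundleField F) :=
  {ξ | ∀ L : Set (BundleField F), IsLieSubalgebraOf (bundleBracket F) (bundleFields F) L →
    curvatureFields F ⊆ L →
    (∀ η ∈ L, IsVertical F η → ∀ X : (x : M) → TangentSpace (Mdl n) x, IsSmoothField X →
      berwald F X η ∈ L) →
    ξ ∈ L}

/-! ### One indicatrix: vector fields and diffeomorphisms -/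

/-- The indicatrix `I_p ⊆ T_pM = ℝⁿ`. -/
def indicatrix (F : TangentBundle (Mdl n) M → ℝ) (p : M) : Set (Coord n) :=
  {y | F ⟨p, y⟩ = 1}

open Classical in
/-- Extension by zero of a vector-valued map on the indicatrix, a device to apply operators
"within the indicatrix", which only see the values there. -/
def indicatrixExt (F : TangentBundle (Mdl n) M → ℝ) (p : M) (f : indicatrix F p → Coord n)
    (y : Coord n) : Coord n :=
  if hy : y ∈ indicatrix F p then f ⟨y, hy⟩ else 0

/-- `𝔛(I_p)`, the smooth vector fields on the hypersurface `I_p` of `T_pM`: the smooth maps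
`I_p → T_pM` whose values are tangent to `I_p`. -/
def indicatrixFields (F : TangentBundle (Mdl n) M → ℝ) (p : M) :
    Set (indicatrix F p → Coord n) :=
  {ξ | ContDiffOn ℝ ∞ (indicatrixExt F p ξ) (indicatrix F p) ∧
    ∀ y : indicatrix F p, fderiv ℝ (fun w : Coord n => F ⟨p, w⟩) (y : Coord n) (ξ y) = 0}

/-- The Lie bracket `Dη(ξ) - Dξ(η)` of vector fields on the indicatrix, with derivatives taken
within the indicatrix (and applied to directions tangent to it). -/
def indicatrixBracket (F : TangentBundle (Mdl n) M → ℝ) (p : M)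
    (ξ η : indicatrix F p → Coord n) : indicatrix F p → Coord n :=
  fun y => VectorField.lieBracketWithin ℝ (indicatrixExt F p ξ) (indicatrixExt F p η)
    (indicatrix F p) y

/-- A bijection of the indicatrix as a map into the ambient vector space. -/
def permMap (F : TangentBundle (Mdl n) M → ℝ) (p : M) (σ : Equiv.Perm (indicatrix F p)) :
    Coord n → Coord n :=
  indicatrixExt F p fun y => (σ y : Coord n)

theorem permMap_of_mem (F : TangentBundle (Mdl n) M → ℝ) (p : M)
    (σ : Equiv.Perm (indicatrix F p)) (y : indicatrix F p) :
    permMap F p σ y = (σ y : Coord n) := by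
  unfold permMap indicatrixExt
  rw [dif_pos y.2]

theorem permMap_mul (F : TangentBundle (Mdl n) M → ℝ) (p : M)
    (σ τ : Equiv.Perm (indicatrix F p))
    (hσ : ContDiffOn ℝ ∞ (permMap F p σ) (indicatrix F p))
    (hτ : ContDiffOn ℝ ∞ (permMap F p τ) (indicatrix F p)) :
    ContDiffOn ℝ ∞ (permMap F p (σ * τ)) (indicatrix F p) := by
  have hmaps : MapsTo (permMap F p τ) (indicatrix F p) (indicatrix F p) := fun y hy => by
    rw [permMap_of_mem F p τ ⟨y, hy⟩]
    exact (τ ⟨y, hy⟩).2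
  refine (hσ.comp hτ hmaps).congr fun y hy => ?_
  rw [Function.comp_apply, permMap_of_mem F p τ ⟨y, hy⟩, permMap_of_mem F p σ,
    permMap_of_mem F p (σ * τ) ⟨y, hy⟩, Equiv.Perm.mul_apply]

theorem permMap_one (F : TangentBundle (Mdl n) M → ℝ) (p : M) :
    ContDiffOn ℝ ∞ (permMap F p 1) (indicatrix F p) :=
  contDiffOn_id.congr fun y hy => by
    rw [permMap_of_mem F p 1 ⟨y, hy⟩, Equiv.Perm.one_apply, id_eq]

/-- The group `Diff(I_p)` of smooth diffeomorphisms of the indicatrix. -/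
def diffGroup (F : TangentBundle (Mdl n) M → ℝ) (p : M) :
    Subgroup (Equiv.Perm (indicatrix F p)) where
  carrier := {σ | ContDiffOn ℝ ∞ (permMap F p σ) (indicatrix F p) ∧
    ContDiffOn ℝ ∞ (permMap F p σ⁻¹) (indicatrix F p)}
  mul_mem' := by
    rintro σ τ ⟨hσ, hσ'⟩ ⟨hτ, hτ'⟩
    refine ⟨permMap_mul F p σ τ hσ hτ, ?_⟩
    rw [mul_inv_rev]
    exact permMap_mul F p _ _ hτ' hσ'
  one_mem' := ⟨permMap_one F p, by rw [inv_one]; exact permMap_one F p⟩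
  inv_mem' := by
    rintro σ ⟨hσ, hσ'⟩
    exact ⟨hσ', by rwa [inv_inv]⟩

/-- `φ` is a smooth curve in `Diff(I_p)` on the parameter interval `(-ε, ε)`: the map
`(t, y) ↦ φ_t(y)` is smooth. -/
def IsSmoothCurve (F : TangentBundle (Mdl n) M → ℝ) (p : M) (ε : ℝ)
    (φ : ℝ → diffGroup F p) : Prop :=
  ContDiffOn ℝ ∞ (fun q : ℝ × Coord n => permMap F p (φ q.1) q.2)
    (Ioo (-ε) ε ×ˢ indicatrix F p)

/-- `φ` is an integral curve of order `k ≥ 1` of the field `ξ`: `φ_0 = id`, and for every `y` the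
derivatives of `t ↦ φ_t(y)` at `0` of the orders `1, …, k - 1` vanish and the one of order `k` is
`ξ(y)`. -/
def IsIntegralCurveOfOrder (F : TangentBundle (Mdl n) M → ℝ) (p : M) (k : ℕ)
    (φ : ℝ → diffGroup F p) (ξ : indicatrix F p → Coord n) : Prop :=
  1 ≤ k ∧ φ 0 = 1 ∧ ∀ y : indicatrix F p,
    (∀ j : ℕ, 1 ≤ j → j < k → iteratedDeriv j (fun t : ℝ => ((φ t).1 y : Coord n)) 0 = 0) ∧
    iteratedDeriv k (fun t : ℝ => ((φ t).1 y : Coord n)) 0 = ξ y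

/-- The set `𝒯₀G` of the vector fields on `I_p` that are tangent to the subgroup `G` of
`Diff(I_p)`: those that have an integral curve, of some order, in `G`. -/
def tangentFields (F : TangentBundle (Mdl n) M → ℝ) (p : M) (G : Subgroup (diffGroup F p)) :
    Set (indicatrix F p → Coord n) :=
  {ξ | ξ ∈ indicatrixFields F p ∧ ∃ (k : ℕ) (ε : ℝ) (φ : ℝ → diffGroup F p), 0 < ε ∧
    (∀ t ∈ Ioo (-ε) ε, φ t ∈ G) ∧ IsSmoothCurve F p ε φ ∧ IsIntegralCurveOfOrder F p k φ ξ}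

/-! ### Parallel translation and holonomy -/

/-- `c : [0, 1] → M` is of class `C^r` on each of the intervals `[τ_i, τ_{i+1}]` of the subdivision
`0 = τ_0 < ⋯ < τ_m = 1`. -/
def IsPiecewise (r : ℕ∞) (m : ℕ) (τ : ℕ → ℝ) (c : ℝ → M) : Prop :=
  τ 0 = 0 ∧ τ m = 1 ∧ ∀ i < m, τ i < τ (i + 1) ∧
    ContMDiffOn 𝓘(ℝ, ℝ) (Mdl n) r c (Icc (τ i) (τ (i + 1)))

/-- The vector field `X` along `c` is parallel: on each interval of the subdivision it is
differentiable with `dXⁱ/dt + Gⁱ_j(c, X) dcʲ/dt = 0`, that is, `t ↦ (c(t), X(t)) ∈ TM` has the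
velocity `(dc/dt)ʰ` (one-sided at the ends of the interval). -/
def IsParallel (F : TangentBundle (Mdl n) M → ℝ) (m : ℕ) (τ : ℕ → ℝ) (c : ℝ → M)
    (X : (t : ℝ) → TangentSpace (Mdl n) (c t)) : Prop :=
  ∀ i < m, ∀ t ∈ Icc (τ i) (τ (i + 1)),
    HasMFDerivWithinAt 𝓘(ℝ, ℝ) (Mdl n).tangent
      (fun s => (⟨c s, X s⟩ : TangentBundle (Mdl n) M)) (Icc (τ i) (τ (i + 1))) t
      (ContinuousLinearMap.toSpanSingleton ℝ (horizontalLift F ⟨c t, X t⟩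
        (mfderivWithin 𝓘(ℝ, ℝ) (Mdl n) c (Icc (τ i) (τ (i + 1))) t (1 : ℝ))))

/-- `σ` is the parallel translation `I_p → I_p` along a piecewise `C^r` closed curve that starts
at `p`. -/
def IsParallelTranslation (F : TangentBundle (Mdl n) M → ℝ) (r : ℕ∞) (p : M)
    (σ : Equiv.Perm (indicatrix F p)) : Prop :=
  ∃ (m : ℕ) (τ : ℕ → ℝ) (c : ℝ → M), IsPiecewise (n := n) r m τ c ∧ c 0 = p ∧ c 1 = p ∧
    ∀ y : indicatrix F p, ∃ X : (t : ℝ) → TangentSpace (Mdl n) (c t), IsParallel F m τ c X ∧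
      (⟨c 0, X 0⟩ : TangentBundle (Mdl n) M) = ⟨p, (y : Coord n)⟩ ∧
      (⟨c 1, X 1⟩ : TangentBundle (Mdl n) M) = ⟨p, (σ y : Coord n)⟩

/-- The holonomy group `Hol_p(M) ⊆ Diff(I_p)`, generated by the parallel translations along
piecewise `C^r` closed curves that start at `p`. -/
def holonomyGroup (F : TangentBundle (Mdl n) M → ℝ) (r : ℕ∞) (p : M) :
    Subgroup (diffGroup F p) :=
  Subgroup.closure {σ | IsParallelTranslation F r p σ.1}

/-- The holonomy algebra `𝔥𝔬𝔩_p(M) = 𝒯₀(Hol_p(M))`. -/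
def holonomyAlgebra (F : TangentBundle (Mdl n) M → ℝ) (r : ℕ∞) (p : M) :
    Set (indicatrix F p → Coord n) :=
  tangentFields F p (holonomyGroup F r p)

/-! ### Curvature algebra and infinitesimal holonomy algebra at a point -/

/-- The curvature vector fields `ξ_p = R(aʰ, bʰ)` at `p`, with `a, b ∈ T_pM`. A field on `I_p` is
regarded as a vertical field along `I_p ⊆ TM` through `T_y(T_pM) = V_{(p,y)}TM`. -/
def curvatureFieldsAt (F : TangentBundle (Mdl n) M → ℝ) (p : M) :
    Set (indicatrix F p → Coord n) :=
  {ξ | ∃ a b : TangentSpace (Mdl n) p, ∀ y : indicatrix F p,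
    verticalLift (⟨p, (y : Coord n)⟩ : TangentBundle (Mdl n) M) (ξ y) =
      curvature F ⟨p, (y : Coord n)⟩ (horizontalLift F ⟨p, (y : Coord n)⟩ a)
        (horizontalLift F ⟨p, (y : Coord n)⟩ b)}

/-- The curvature algebra `ℜ_p` at `p`. -/
def curvatureAlgebraAt (F : TangentBundle (Mdl n) M → ℝ) (p : M) :
    Set (indicatrix F p → Coord n) :=
  lieSpan (indicatrixBracket F p) (indicatrixFields F p) (curvatureFieldsAt F p)

/-- The infinitesimal holonomy algebra `𝔥𝔬𝔩*_p(M)` at `p`: the restrictions to `I_p` of the elements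
of the infinitesimal holonomy algebra. -/
def infHolonomyAlgebraAt (F : TangentBundle (Mdl n) M → ℝ) (p : M) :
    Set (indicatrix F p → Coord n) :=
  {ζ | ∃ ξ ∈ infHolonomyAlgebra F, ∀ y : indicatrix F p,
    ξ ⟨⟨p, (y : Coord n)⟩, y.2⟩ =
      verticalLift (⟨p, (y : Coord n)⟩ : TangentBundle (Mdl n) M) (ζ y)}

end FinslerHolonomy

end

/-! The Berwald derivative compares a field on neighbouring indicatrices, so tangency to the
holonomy group cannot be propagated inside one fibre: it has to be proved smoothly in the base
point. In a chart, a field ξ(x, y) on Ω × (ℝⁿ ∖ 0) is tangent in the sense of `IsTangentTo` when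
there are jointly smooth maps φ(t, x, ·) = id + tᵏ ρ(t, x, ·) with ρ(0, x, y) = ξ(x, y) that belong,
for every x, to the group of parallel translations along small closed polygons at x. The fields on
the indicatrix bundle represented in this way near every point form `holonomyTangentFields`. This
set is a Lie algebra, contains the curvature fields and is stable under ∇_X; by minimality it
contains `infHolonomyAlgebra`.

The closure properties come from explicit curves in the groups. The substitution t ↦ tᵐ brings two
curves to the same order; then products give sums, inverses give negatives, t ↦ c^{1/k} t gives
positive multiples, and commutators of curves of order k are id + t²ᵏ(bracket) + …
(`IsTangentTo.bracket`). Translation around the parallelogram with sides tX, tY is a curve of order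
2 with coefficient R(Xʰ, Yʰ) (`isTangentTo_localCurv`). If φ belongs to ξ and T_t translates from x
to x + tX(x), then T_t⁻¹ ∘ φ(t, x + tX, ·) ∘ T_t ∘ φ(t, x, ·)⁻¹ is a loop at x of the form id + tᵏ⁺¹
∇_X ξ + … (`IsTangentTo.covariantDerivative`). Hadamard's lemma (`contDiffOn_dslope`) keeps all
remainders smooth.

Two analytic facts are needed. Parallel transport along short coordinate segments is smooth in base
point, direction and vector (`exists_transportRadius`); this follows from the implicit function
theorem in C([0, 1], ℝⁿ), compactness of the sphere and homogeneity. It preserves F, because d(F²)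
annihilates horizontal vectors (`IsLocalFinsler.fderiv_localHor`); this follows from the
Euler–Lagrange equation, which characterises the spray and also yields the transformation laws that
make the coordinate computations intrinsic.

Coordinate polygons are piecewise smooth loops in M, so at p the restricted fields are tangent to
the holonomy group for every r. The fields tangent to any subgroup of Diff(I_p) form a Lie algebra
by the same calculus, applied to positively homogeneous extensions with a dummy parameter
(`isLieSubalgebraOf_tangentFields`). The curvature algebra lies in 𝔥𝔬𝔩*_p because tangent vectors at
p extend to global vector fields; here M is Hausdorff. -/

noncomputable section

namespace FinslerHolonomy

open Filter Topology

set_option linter.unusedSectionVars false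

/-! ### Smoothness of composition operators on spaces of continuous maps. -/

section Nemytskii

variable {K : Type*} [TopologicalSpace K] [CompactSpace K]
  {Z G : Type*} [NormedAddCommGroup Z] [NormedSpace ℝ Z] [NormedAddCommGroup G] [NormedSpace ℝ G]

/-- Pointwise application of a continuous family of linear maps, as a continuous bilinear map. -/
def pointwiseApply (K Z G : Type*) [TopologicalSpace K] [CompactSpace K]
    [NormedAddCommGroup Z] [NormedSpace ℝ Z] [NormedAddCommGroup G] [NormedSpace ℝ G] :
    C(K, Z →L[ℝ] G) →L[ℝ] C(K, Z) →L[ℝ] C(K, G) :=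
  LinearMap.mkContinuous₂
    (LinearMap.mk₂ ℝ (fun (A : C(K, Z →L[ℝ] G)) (h : C(K, Z)) =>
        (⟨fun t => A t (h t), A.continuous.clm_apply h.continuous⟩ : C(K, G)))
      (fun A B h => by ext t; simp) (fun c A h => by ext t; simp)
      (fun A h k => by ext t; simp) (fun c A h => by ext t; simp)) 1
    (fun A h => by
      rw [ContinuousMap.norm_le _ (by positivity)]
      intro t
      simp only [LinearMap.mk₂_apply, ContinuousMap.coe_mk, one_mul]
      exact ((A t).le_opNorm _).trans
        (mul_le_mul (A.norm_coe_le_norm t) (h.norm_coe_le_norm t) (norm_nonneg (h t))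
          (norm_nonneg A)))

@[simp] theorem pointwiseApply_apply (A : C(K, Z →L[ℝ] G)) (h : C(K, Z)) (t : K) :
    pointwiseApply K Z G A h t = A t (h t) := rfl

/-- Compactness of `K` makes the pointwise expansion uniform: postcomposition with W' is continuous
for the sup norm, so W' varies by at most ε on each segment from u(t) to u(t) + h(t) when h is
small, and the mean value inequality bounds the remainder by ε‖h‖. -/
theorem hasFDerivAt_comp_continuousMap (W : Z → G) (hW : ContDiff ℝ 1 W) (u : C(K, Z)) :
    HasFDerivAt (fun u : C(K, Z) => (⟨W, hW.continuous⟩ : C(Z, G)).comp u)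
      (pointwiseApply K Z G
        ((⟨fderiv ℝ W, hW.continuous_fderiv one_ne_zero⟩ : C(Z, Z →L[ℝ] G)).comp u)) u := by
  rw [hasFDerivAt_iff_isLittleO_nhds_zero, Asymptotics.isLittleO_iff]
  intro ε hε
  have hc := (ContinuousMap.continuous_postcomp (X := K)
    (⟨fderiv ℝ W, hW.continuous_fderiv one_ne_zero⟩ : C(Z, Z →L[ℝ] G)))
  obtain ⟨δ, hδ, hd⟩ :=
    (Metric.continuous_iff (α := C(K, Z)) (β := C(K, Z →L[ℝ] G))).1 (by exact hc) u ε hε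
  filter_upwards [Metric.ball_mem_nhds (0 : C(K, Z)) hδ] with h hh
  rw [ContinuousMap.norm_le _ (by positivity)]
  intro t
  have key : ∀ z ∈ segment ℝ (u t) (u t + h t),
      ‖fderiv ℝ W z - fderiv ℝ W (u t)‖ ≤ ε := by
    rintro z hz
    rw [segment_eq_image'] at hz
    obtain ⟨s, hs, rfl⟩ := hz
    have h1 : dist (u + s • h) u < δ := by
      rw [dist_eq_norm, add_sub_cancel_left, norm_smul, Real.norm_of_nonneg hs.1]
      have := mem_ball_zero_iff.1 hh
      nlinarith [hs.2, norm_nonneg h]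
    have h2 := (ContinuousMap.dist_apply_le_dist (f := _) (g := _) t).trans_lt (hd _ h1)
    simpa [dist_eq_norm] using h2.le
  have := (convex_segment (𝕜 := ℝ) (u t) (u t + h t)).norm_image_sub_le_of_norm_hasFDerivWithin_le'
    (f := W) (f' := fderiv ℝ W) (φ := fderiv ℝ W (u t))
    (fun z _ => ((hW.differentiable one_ne_zero) z).hasFDerivAt.hasFDerivWithinAt) key
    (left_mem_segment ℝ _ _) (right_mem_segment ℝ _ _)
  simp only [add_sub_cancel_left] at this
  simpa using this.trans (mul_le_mul_of_nonneg_left (h.norm_coe_le_norm t) hε.le)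

/-- Induction on `m`: the derivative is `pointwiseApply` after the composition operator of `fderiv ℝ
W`. That operator has another target space, hence `G` is quantified inside the induction. -/
theorem contDiff_comp_continuousMap_nat {K : Type*} [TopologicalSpace K] [CompactSpace K]
    {Z : Type} [NormedAddCommGroup Z] [NormedSpace ℝ Z] (m : ℕ) :
    ∀ {G : Type} [NormedAddCommGroup G] [NormedSpace ℝ G] (W : Z → G) (hW : ContDiff ℝ ∞ W),
      ContDiff ℝ m (fun u : C(K, Z) => (⟨W, hW.continuous⟩ : C(Z, G)).comp u) := by
  induction m with
  | zero =>
    intro G _ _ W hW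
    exact contDiff_zero.2 (ContinuousMap.continuous_postcomp _)
  | succ m ih =>
    intro G _ _ W hW
    have h1 : ContDiff ℝ 1 W := hW.of_le (by exact_mod_cast le_top)
    have hd : ContDiff ℝ ∞ (fderiv ℝ W) := hW.fderiv_right (by simp)
    push_cast
    rw [contDiff_succ_iff_hasFDerivAt]
    refine ⟨_, ?_, fun u => hasFDerivAt_comp_continuousMap W h1 u⟩
    exact (pointwiseApply K Z G).contDiff.comp (ih (fderiv ℝ W) hd)

theorem contDiff_comp_continuousMap {K : Type*} [TopologicalSpace K] [CompactSpace K]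
    {Z G : Type} [NormedAddCommGroup Z] [NormedSpace ℝ Z]
    [NormedAddCommGroup G] [NormedSpace ℝ G] (W : Z → G) (hW : ContDiff ℝ ∞ W) :
    ContDiff ℝ ∞ (fun u : C(K, Z) => (⟨W, hW.continuous⟩ : C(Z, G)).comp u) :=
  contDiff_infty.2 fun m => contDiff_comp_continuousMap_nat m W hW

end Nemytskii

/-! ### Hadamard's lemma. -/

section Hadamard

variable {Z G : Type} [NormedAddCommGroup Z] [NormedSpace ℝ Z]
  [NormedAddCommGroup G] [NormedSpace ℝ G]

/-- A map that is smooth near a point agrees near that point with a smooth map. -/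
theorem exists_contDiff_eventuallyEq [FiniteDimensional ℝ Z] {D : Set Z} (hD : IsOpen D)
    {g : Z → G} (hg : ContDiffOn ℝ ∞ g D) {z₀ : Z} (hz : z₀ ∈ D) :
    ∃ g' : Z → G, ContDiff ℝ ∞ g' ∧ g' =ᶠ[𝓝 z₀] g := by
  obtain ⟨r, hr, hrD⟩ := Metric.isOpen_iff.1 hD z₀ hz
  let χ : ContDiffBump z₀ := ⟨r / 3, r / 2, by positivity, by linarith⟩
  refine ⟨fun z => χ z • g z, ?_, ?_⟩
  · rw [contDiff_iff_contDiffAt]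
    intro z
    by_cases h : z ∈ D
    · exact χ.contDiffAt.smul (hg.contDiffAt (hD.mem_nhds h))
    · have hz' : z ∉ tsupport χ := by
        rw [χ.tsupport_eq]
        intro hzz
        exact h (hrD (Metric.closedBall_subset_ball (by simp only [χ]; linarith) hzz))
      have : (fun z => χ z • g z) =ᶠ[𝓝 z] fun _ => 0 := by
        filter_upwards [(isClosed_tsupport χ).isOpen_compl.mem_nhds hz'] with w hw
        rw [image_eq_zero_of_notMem_tsupport hw, zero_smul]
      exact contDiffAt_const.congr_of_eventuallyEq this
  · filter_upwards [χ.eventuallyEq_one] with z hz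
    simp [hz]

variable [CompleteSpace G]

/-- The primitive `u ↦ (t ↦ ∫₀ᵗ u)` as a continuous linear operator on `C([0, 1], G)`. -/
def volterra (G : Type) [NormedAddCommGroup G] [NormedSpace ℝ G] [CompleteSpace G] :
    C(Icc (0 : ℝ) 1, G) →L[ℝ] C(Icc (0 : ℝ) 1, G) :=
  LinearMap.mkContinuous
    { toFun := fun u => ⟨fun t => ∫ s in (0 : ℝ)..t, IccExtend zero_le_one u s, by
        have : Continuous fun t : ℝ => ∫ s in (0 : ℝ)..t, IccExtend zero_le_one u s :=
          intervalIntegral.continuous_primitive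
            (fun a b => (u.continuous.Icc_extend' (h := zero_le_one)).intervalIntegrable a b) 0
        exact this.comp continuous_subtype_val⟩
      map_add' := fun u v => by
        ext t
        have hu := (u.continuous.Icc_extend' (h := zero_le_one)).intervalIntegrable
          (μ := MeasureTheory.volume) 0 t
        have hv := (v.continuous.Icc_extend' (h := zero_le_one)).intervalIntegrable
          (μ := MeasureTheory.volume) 0 t
        simp only [ContinuousMap.coe_mk, ContinuousMap.add_apply]
        rw [← intervalIntegral.integral_add hu hv]
        rfl
      map_smul' := fun c u => by
        ext t
        simp only [ContinuousMap.coe_mk, ContinuousMap.smul_apply, RingHom.id_apply]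
        rw [← intervalIntegral.integral_smul]
        rfl } 1
    (fun u => by
      rw [ContinuousMap.norm_le _ (by positivity), one_mul]
      intro t
      have := intervalIntegral.norm_integral_le_of_norm_le_const (a := 0) (b := (t : ℝ))
        (C := ‖u‖) (f := IccExtend zero_le_one u) (fun s _ => u.norm_coe_le_norm _)
      refine this.trans ?_
      rw [sub_zero, abs_of_nonneg t.2.1]
      exact mul_le_of_le_one_right (norm_nonneg u) t.2.2)

theorem volterra_apply (u : C(Icc (0 : ℝ) 1, G)) (t : Icc (0 : ℝ) 1) :
    volterra G u t = ∫ s in (0 : ℝ)..t, IccExtend zero_le_one u s := rfl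

/-- `(t, z) ↦ (s ↦ (s t, z))` as a continuous linear map. -/
def scaledSegment (Z : Type) [NormedAddCommGroup Z] [NormedSpace ℝ Z] :
    ℝ × Z →L[ℝ] C(Icc (0 : ℝ) 1, ℝ × Z) :=
  LinearMap.mkContinuous
    { toFun := fun p => ⟨fun s => ((s : ℝ) * p.1, p.2), by fun_prop⟩
      map_add' := fun p q => by ext s <;> simp [mul_add]
      map_smul' := fun c p => by ext s <;> simp [mul_left_comm] } 1
    (fun p => by
      rw [ContinuousMap.norm_le _ (by positivity), one_mul]
      intro s
      simp only [LinearMap.coe_mk, AddHom.coe_mk, ContinuousMap.coe_mk, Prod.norm_def]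
      refine max_le_max ?_ le_rfl
      rw [norm_mul, Real.norm_of_nonneg s.2.1]
      exact mul_le_of_le_one_left (norm_nonneg _) s.2.2)

/-- The quotient is ∫₀¹ ∂ₜg(st, z) ds, also at t = 0. This is a linear operator after a composition
operator after the linear map (t, z) ↦ (s ↦ (st, z)), so no differentiation under the integral sign
is needed. -/
theorem contDiff_dslope {g : ℝ × Z → G} (hg : ContDiff ℝ ∞ g) :
    ContDiff ℝ ∞ (fun p : ℝ × Z => dslope (fun t => g (t, p.2)) 0 p.1) := by
  have hW : ContDiff ℝ ∞ (fun p : ℝ × Z => fderiv ℝ g p (1, 0)) :=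
    (hg.fderiv_right (m := ∞) (by simp)).clm_apply contDiff_const
  have hint : ContDiff ℝ ∞ (fun p : ℝ × Z => volterra G
      ((⟨_, hW.continuous⟩ : C(ℝ × Z, G)).comp (scaledSegment Z p)) ⟨1, by simp⟩) := by
    let ev : C(Icc (0 : ℝ) 1, G) →L[ℝ] G := ContinuousMap.evalCLM ℝ ⟨1, by simp⟩
    exact ev.contDiff.comp ((volterra G).contDiff.comp
        ((contDiff_comp_continuousMap _ hW).comp (scaledSegment Z).contDiff))
  convert hint using 1
  funext p
  obtain ⟨t, z⟩ := p
  have hd : ∀ s : ℝ, HasDerivAt (fun s => g (s, z)) (fderiv ℝ g (s, z) (1, 0)) s := fun s =>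
    ((hg.differentiable (by simp)) (s, z)).hasFDerivAt.comp_hasDerivAt s
      ((hasDerivAt_id s).prodMk (hasDerivAt_const s z))
  have heq : volterra G ((⟨_, hW.continuous⟩ : C(ℝ × Z, G)).comp (scaledSegment Z (t, z)))
      ⟨1, by simp⟩ = ∫ s in (0 : ℝ)..1, fderiv ℝ g (s * t, z) (1, 0) := by
    rw [volterra_apply]
    refine intervalIntegral.integral_congr fun s hs => ?_
    rw [uIcc_of_le zero_le_one] at hs
    rw [IccExtend_of_mem _ _ hs]
    rfl
  rw [heq]
  simp only
  rcases eq_or_ne t 0 with rfl | ht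
  · rw [dslope_same, (hd 0).deriv]
    simp
  · have hcont : Continuous fun s => fderiv ℝ g (s, z) (1, 0) := hW.continuous.comp (by fun_prop)
    have h1 := intervalIntegral.integral_eq_sub_of_hasDerivAt (a := 0) (b := t)
      (fun s _ => hd s) (hcont.intervalIntegrable _ _)
    have h2 := intervalIntegral.smul_integral_comp_mul_right
      (f := fun s => fderiv ℝ g (s, z) (1, 0)) (a := 0) (b := 1) t
    rw [zero_mul, one_mul, h1] at h2
    rw [dslope_of_ne _ ht, slope_def_module, sub_zero, ← h2, smul_smul, inv_mul_cancel₀ ht,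
      one_smul]

/-- **Hadamard's lemma**: the difference quotient `(g(t, z) - g(0, z)) / t` is smooth. -/
theorem contDiffOn_dslope [FiniteDimensional ℝ Z] {D : Set (ℝ × Z)} (hD : IsOpen D)
    (hD0 : ∀ t z, (t, z) ∈ D → ((0 : ℝ), z) ∈ D) {g : ℝ × Z → G} (hg : ContDiffOn ℝ ∞ g D) :
    ContDiffOn ℝ ∞ (fun p : ℝ × Z => dslope (fun t => g (t, p.2)) 0 p.1) D := by
  rintro ⟨t, z⟩ hp
  refine ContDiffAt.contDiffWithinAt ?_
  rcases eq_or_ne t 0 with rfl | ht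
  -- Only t = 0 is critical. There g is replaced by a globally smooth g' with the same germ; the
  -- quotients agree nearby since g = g' at `p` and around `(0, p.2)`.
  · obtain ⟨g', hg', he⟩ := exists_contDiff_eventuallyEq hD hg hp
    refine ((contDiff_dslope hg').contDiffAt (x := (0, z))).congr_of_eventuallyEq ?_
    have h1 : ∀ᶠ p : ℝ × Z in 𝓝 (0, z), g' =ᶠ[𝓝 (0, p.2)] g := by
      have : Tendsto (fun p : ℝ × Z => ((0 : ℝ), p.2)) (𝓝 (0, z)) (𝓝 (0, z)) :=
        Continuous.tendsto' (by fun_prop) _ _ rfl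
      exact this.eventually he.eventually_nhds
    filter_upwards [h1, he] with p hp1 hp2
    have h0 : (fun t => g (t, p.2)) =ᶠ[𝓝 0] fun t => g' (t, p.2) := by
      have : Tendsto (fun t : ℝ => (t, p.2)) (𝓝 0) (𝓝 (0, p.2)) :=
        Continuous.tendsto' (by fun_prop) _ _ rfl
      exact (this.eventually hp1).mono fun _ h => h.symm
    rcases eq_or_ne p.1 0 with h | h
    · rw [h, dslope_same, dslope_same, h0.deriv_eq]
    · rw [dslope_of_ne _ h, dslope_of_ne _ h, slope_def_module, slope_def_module]
      have h00 := h0.self_of_nhds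
      simp only at h00
      simp only [Prod.mk.eta, hp2, h00]
  · have h0 : ContDiffAt ℝ ∞ (fun p : ℝ × Z => g (0, p.2)) (t, z) :=
      (hg.contDiffAt (hD.mem_nhds (hD0 t z hp))).comp (t, z)
        (contDiffAt_const.prodMk contDiffAt_snd)
    have h1 : ContDiffAt ℝ ∞ (fun p : ℝ × Z => p.1⁻¹ • (g p - g (0, p.2))) (t, z) :=
      (contDiffAt_fst.inv ht).smul ((hg.contDiffAt (hD.mem_nhds hp)).sub h0)
    refine h1.congr_of_eventuallyEq ?_
    filter_upwards [(isOpen_ne.preimage continuous_fst).mem_nhds (show (t, z).1 ≠ 0 from ht)]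
      with p hp
    rw [dslope_of_ne _ hp, slope_def_module, sub_zero]

end Hadamard

/-! ### Division by higher powers of t, and smoothness of parametric inverses. -/

section PowerHadamard

variable {Z G : Type} [NormedAddCommGroup Z] [NormedSpace ℝ Z]
  [NormedAddCommGroup G] [NormedSpace ℝ G]

/-- In the Leibniz sum at 0, only a term with exactly k derivatives on tᵏ can survive. -/
theorem iteratedDeriv_pow_smul {k j : ℕ} (hj : j ≤ k) {h : ℝ → G} (hh : ContDiffAt ℝ j h 0) :
    iteratedDeriv j (fun t => t ^ k • h t) 0 = if j = k then (k.factorial : ℝ) • h 0 else 0 := by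
  have h1 := iteratedDerivWithin_smul (mem_univ (0 : ℝ)) uniqueDiffOn_univ
    (f := fun t : ℝ => t ^ k) (g := h) (n := j) (by fun_prop) hh
  rw [iteratedDerivWithin_univ] at h1
  have h2 : ∀ i, iteratedDerivWithin i (fun t : ℝ => t ^ k) univ 0 =
      (k.descFactorial i : ℝ) * 0 ^ (k - i) := fun i => by
    have := iteratedDerivWithin_pow (mem_univ (0 : ℝ)) uniqueDiffOn_univ k i
    exact this
  change iteratedDeriv j ((fun t : ℝ => t ^ k) • h) 0 = _
  rw [h1]
  split_ifs with hjk
  · subst hjk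
    rw [Finset.sum_eq_single j]
    · simp [h2, Nat.descFactorial_self]
    · intro i hi hne
      have : i < j := lt_of_le_of_ne (Nat.lt_succ_iff.1 (Finset.mem_range.1 hi)) hne
      rw [h2, zero_pow (by omega)]
      simp
    · simp
  · refine Finset.sum_eq_zero fun i hi => ?_
    have : i < k := by have := Finset.mem_range.1 hi; omega
    rw [h2, zero_pow (by omega)]
    simp

variable [CompleteSpace G] [FiniteDimensional ℝ Z]

/-- **Hadamard's lemma of order `k`**. -/
theorem exists_contDiffOn_eq_pow_smul {D : Set (ℝ × Z)} (hD : IsOpen D)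
    (hD0 : ∀ t z, (t, z) ∈ D → ((0 : ℝ), z) ∈ D) {g : ℝ × Z → G} (hg : ContDiffOn ℝ ∞ g D)
    (k : ℕ) (hk : ∀ z, ((0 : ℝ), z) ∈ D → ∀ j < k, iteratedDeriv j (fun t => g (t, z)) 0 = 0) :
    ∃ h : ℝ × Z → G, ContDiffOn ℝ ∞ h D ∧ (∀ p ∈ D, g p = p.1 ^ k • h p) ∧
      ∀ z, ((0 : ℝ), z) ∈ D →
        iteratedDeriv k (fun t => g (t, z)) 0 = (k.factorial : ℝ) • h (0, z) := by
  have conv : ∀ (k : ℕ) (h : ℝ × Z → G), ContDiffOn ℝ ∞ h D → (∀ p ∈ D, g p = p.1 ^ k • h p) →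
      ∀ z, ((0 : ℝ), z) ∈ D →
        iteratedDeriv k (fun t => g (t, z)) 0 = (k.factorial : ℝ) • h (0, z) := by
    intro k h hh hgh z hz
    have hc : ContDiffAt ℝ k (fun t => h (t, z)) 0 :=
      ((hh.contDiffAt (hD.mem_nhds hz)).comp (0 : ℝ)
        (contDiffAt_id.prodMk contDiffAt_const)).of_le (by exact_mod_cast le_top)
    have he : (fun t => g (t, z)) =ᶠ[𝓝 0] fun t => t ^ k • h (t, z) := by
      have : Tendsto (fun t : ℝ => (t, z)) (𝓝 0) (𝓝 (0, z)) :=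
        Continuous.tendsto' (by fun_prop) _ _ rfl
      filter_upwards [this.eventually (hD.mem_nhds hz)] with t ht
      exact hgh _ ht
    rw [he.iteratedDeriv_eq, iteratedDeriv_pow_smul le_rfl hc, if_pos rfl]
  induction k with
  | zero =>
    refine ⟨g, hg, fun p _ => by simp, fun z hz => by simp⟩
  | succ k ih =>
    obtain ⟨h, hh, hgh, hk'⟩ := ih fun z hz j hj => hk z hz j (by omega)
    -- The k-th derivative at 0 equals k! h(0, z); its vanishing permits one more division by t.
    have h0 : ∀ z, ((0 : ℝ), z) ∈ D → h (0, z) = 0 := fun z hz => by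
      have := hk' z hz
      rw [hk z hz k (by omega)] at this
      exact (smul_eq_zero.1 this.symm).resolve_left (by exact_mod_cast k.factorial_ne_zero)
    have h1 := contDiffOn_dslope hD hD0 hh
    have h2 : ∀ p ∈ D, g p = p.1 ^ (k + 1) • dslope (fun t => h (t, p.2)) 0 p.1 := by
      rintro ⟨t, z⟩ hp
      have := sub_smul_dslope (fun t => h (t, z)) 0 t
      rw [h0 z (hD0 t z hp), sub_zero, sub_zero] at this
      rw [hgh _ hp, pow_succ, mul_smul, this]
    exact ⟨_, h1, h2, conv (k + 1) _ h1 h2⟩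

end PowerHadamard

/-- If `φ(q, ·)` is bijective with differentiable inverse `ψ(q, ·)` and `φ` is jointly smooth, then
`ψ` is jointly smooth. -/
theorem contDiffOn_parametric_inverse {Q E : Type} [NormedAddCommGroup Q] [NormedSpace ℝ Q]
    [FiniteDimensional ℝ Q] [NormedAddCommGroup E] [NormedSpace ℝ E] [FiniteDimensional ℝ E]
    {D D' : Set (Q × E)} (hD : IsOpen D) {φ ψ : Q × E → E} (hφ : ContDiffOn ℝ ∞ φ D)
    (hl : ∀ q y, (q, y) ∈ D → (q, φ (q, y)) ∈ D' ∧ ψ (q, φ (q, y)) = y)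
    (hr : ∀ q w, (q, w) ∈ D' → (q, ψ (q, w)) ∈ D ∧ φ (q, ψ (q, w)) = w)
    (hd : ∀ q w, (q, w) ∈ D' → DifferentiableAt ℝ (fun w => ψ (q, w)) w) :
    ContDiffOn ℝ ∞ ψ D' := by
  rintro ⟨q, w⟩ hqw
  refine ContDiffAt.contDiffWithinAt ?_
  have : CompleteSpace (Q × E) := FiniteDimensional.complete ℝ _
  obtain ⟨hy, hyw⟩ := hr q w hqw
  set y := ψ (q, w) with hydef
  let Φ : Q × E → Q × E := fun p => (p.1, φ p)
  have hφc : ContDiffAt ℝ ∞ φ (q, y) := hφ.contDiffAt (hD.mem_nhds hy)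
  have hΦ : ContDiffAt ℝ ∞ Φ (q, y) := contDiffAt_fst.prodMk hφc
  have hφd : HasFDerivAt φ (fderiv ℝ φ (q, y)) (q, y) :=
    (hφc.differentiableAt (by simp)).hasFDerivAt
  have hΦd : HasFDerivAt Φ ((ContinuousLinearMap.fst ℝ Q E).prod (fderiv ℝ φ (q, y))) (q, y) :=
    hasFDerivAt_fst.prodMk hφd
  set B := fderiv ℝ (fun w => ψ (q, w)) w with hB
  have hBd : HasFDerivAt (fun w => ψ (q, w)) B w := (hd q w hqw).hasFDerivAt
  -- The chain rule in ψ ∘ φ = id shows that the fibre derivative of φ is injective. In finite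
  -- dimension this makes the derivative of Φ = (q, φ) invertible, and the inverse function theorem
  -- applies.
  have hinv : ∀ v, B (fderiv ℝ φ (q, y) (0, v)) = v := by
    have h1 : HasFDerivAt (fun y' => φ (q, y'))
        ((fderiv ℝ φ (q, y)).comp (ContinuousLinearMap.inr ℝ Q E)) y :=
      hφd.comp y (hasFDerivAt_prodMk_right q y)
    have h2 : HasFDerivAt (fun w => ψ (q, w)) B (φ (q, y)) := by rw [hyw]; exact hBd
    have h3 := h2.comp y h1
    have h4 : ((fun w => ψ (q, w)) ∘ fun y' => φ (q, y')) =ᶠ[𝓝 y] id := by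
      have : Tendsto (fun y' : E => (q, y')) (𝓝 y) (𝓝 (q, y)) :=
        Continuous.tendsto' (by fun_prop) _ _ rfl
      filter_upwards [this.eventually (hD.mem_nhds hy)] with y' hy'
      exact (hl q y' hy').2
    have h5 := h3.unique ((hasFDerivAt_id y).congr_of_eventuallyEq h4)
    intro v
    exact congrArg (fun A : E →L[ℝ] E => A v) h5
  have hinj : Function.Injective
      ((ContinuousLinearMap.fst ℝ Q E).prod (fderiv ℝ φ (q, y))).toLinearMap := by
    rw [← LinearMap.ker_eq_bot, LinearMap.ker_eq_bot']
    rintro ⟨a, b⟩ hab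
    have ha : a = 0 := congrArg Prod.fst hab
    have hb : fderiv ℝ φ (q, y) (a, b) = 0 := congrArg Prod.snd hab
    subst ha
    have := hinv b
    rw [hb, map_zero] at this
    rw [← this]; rfl
  let A : (Q × E) ≃L[ℝ] (Q × E) := (LinearEquiv.ofInjectiveEndo _ hinj).toContinuousLinearEquiv
  have hA : (A : Q × E →L[ℝ] Q × E) =
      (ContinuousLinearMap.fst ℝ Q E).prod (fderiv ℝ φ (q, y)) := by
    ext v <;> rfl
  rw [← hA] at hΦd
  have hli := hΦ.to_localInverse hΦd (by simp)
  have hval : Φ (q, y) = (q, w) := by simp [Φ, hyw]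
  have hself := hΦ.localInverse_apply_image hΦd (by simp)
  rw [hval] at hli hself
  refine (contDiffAt_snd.comp _ hli).congr_of_eventuallyEq ?_
  have hri := (hΦ.hasStrictFDerivAt' hΦd (by simp)).eventually_right_inverse
  rw [hval] at hri
  have hmem : ∀ᶠ p in 𝓝 (q, w), hΦ.localInverse hΦd (by simp) p ∈ D := by
    have := hli.continuousAt.tendsto
    rw [hself] at this
    exact this.eventually (hD.mem_nhds hy)
  filter_upwards [hri, hmem] with p hp1 hp2
  change Φ (hΦ.localInverse hΦd (by simp) p) = p at hp1
  -- On D the map Φ is injective with inverse given by ψ, so ψ coincides with the local inverse as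
  -- soon as the latter takes values in D.
  have key : ∀ p' ∈ D, Φ p' = p → ψ p = p'.2 := by
    rintro ⟨a, b⟩ h rfl
    exact (hl a b h).2
  exact key _ hp2 hp1

/-! ### Smooth dependence of solutions on parameters and initial values. -/

section ODE

variable {Q Y : Type} [NormedAddCommGroup Q] [NormedSpace ℝ Q] [CompleteSpace Q]
  [NormedAddCommGroup Y] [NormedSpace ℝ Y] [CompleteSpace Y]

/-- The linear part of `(q, y, u) ↦ (s ↦ (s, q, u s))`. -/
def graphLinear (Q Y : Type) [NormedAddCommGroup Q] [NormedSpace ℝ Q]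
    [NormedAddCommGroup Y] [NormedSpace ℝ Y] :
    (Q × Y) × C(Icc (0 : ℝ) 1, Y) →L[ℝ] C(Icc (0 : ℝ) 1, ℝ × Q × Y) :=
  LinearMap.mkContinuous
    { toFun := fun p => ⟨fun s => (0, p.1.1, p.2 s), by fun_prop⟩
      map_add' := fun p q => by ext s <;> simp
      map_smul' := fun c p => by ext s <;> simp } 1
    (fun p => by
      rw [ContinuousMap.norm_le _ (by positivity), one_mul]
      intro s
      simp only [LinearMap.coe_mk, AddHom.coe_mk, ContinuousMap.coe_mk, Prod.norm_def, norm_zero]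
      refine max_le (le_max_of_le_left (le_max_of_le_left (norm_nonneg _)))
        (max_le (le_max_of_le_left (le_max_left _ _))
          (le_max_of_le_right (p.2.norm_coe_le_norm s))))

/-- Smooth dependence on parameters and initial values of the solutions of `u' = w(s, q, u)` near
a parameter for which the equation is trivial. -/
theorem exists_smooth_solution (w : ℝ × Q × Y → Y) (hw : ContDiff ℝ ∞ w) (q₀ : Q) (y₀ : Y)
    (h0 : ∀ s y, w (s, q₀, y) = 0) :
    ∃ U : Q × Y → C(Icc (0 : ℝ) 1, Y), U (q₀, y₀) = ContinuousMap.const _ y₀ ∧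
      (∀ᶠ p in 𝓝 (q₀, y₀), ContDiffAt ℝ ∞ U p) ∧
      ∀ᶠ p in 𝓝 (q₀, y₀), ∀ t : Icc (0 : ℝ) 1, U p t = p.2 +
        ∫ s in (0 : ℝ)..t, IccExtend zero_le_one (fun s => w (s, p.1, U p s)) s := by
  let c₀ : C(Icc (0 : ℝ) 1, ℝ × Q × Y) := ⟨fun s => (s, 0, 0), by fun_prop⟩
  let cst : Y →L[ℝ] C(Icc (0 : ℝ) 1, Y) := ContinuousLinearMap.const ℝ _
  -- The zeros of Ψ are the solutions of the integral equation.
  let Ψ : (Q × Y) × C(Icc (0 : ℝ) 1, Y) → C(Icc (0 : ℝ) 1, Y) := fun p =>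
    p.2 - cst p.1.2 - volterra Y ((⟨w, hw.continuous⟩ : C(ℝ × Q × Y, Y)).comp
      (c₀ + graphLinear Q Y p))
  have hΨ : ContDiff ℝ ∞ Ψ := by
    refine (contDiff_snd.sub (cst.contDiff.comp (contDiff_snd.comp contDiff_fst))).sub ?_
    exact (volterra Y).contDiff.comp ((contDiff_comp_continuousMap w hw).comp
      (contDiff_const.add (graphLinear Q Y).contDiff))
  have hΨ_apply : ∀ p t, Ψ p t = p.2 t - p.1.2 -
      ∫ s in (0 : ℝ)..t, IccExtend zero_le_one (fun s => w (s, p.1.1, p.2 s)) s := by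
    intro p t
    simp only [Ψ, ContinuousMap.sub_apply, volterra_apply]
    refine congrArg₂ (· - ·) rfl (intervalIntegral.integral_congr fun s _ => ?_)
    simp [IccExtend, c₀, graphLinear]
  set u₀ : C(Icc (0 : ℝ) 1, Y) := ContinuousMap.const _ y₀ with hu₀
  set P₀ : (Q × Y) × C(Icc (0 : ℝ) 1, Y) := ((q₀, y₀), u₀) with hP₀
  -- At q₀ the integral term vanishes, so the partial derivative in u is the identity there and the
  -- implicit function theorem needs no study of the linearised equation.
  have hcst : ∀ u, Ψ ((q₀, y₀), u) = u - u₀ := by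
    intro u
    ext t
    rw [hΨ_apply]
    simp [h0, hu₀, IccExtend]
  have hΨ0 : Ψ P₀ = 0 := by rw [hP₀, hcst, sub_self]
  have hpart : fderiv ℝ Ψ P₀ ∘L ContinuousLinearMap.inr ℝ (Q × Y) C(Icc (0 : ℝ) 1, Y) =
      ContinuousLinearMap.id ℝ _ := by
    have h1 : HasFDerivAt (fun u => Ψ ((q₀, y₀), u))
        (fderiv ℝ Ψ P₀ ∘L ContinuousLinearMap.inr ℝ (Q × Y) C(Icc (0 : ℝ) 1, Y)) u₀ :=
      ((hΨ.differentiable (by simp)) P₀).hasFDerivAt.comp u₀ (hasFDerivAt_prodMk_right _ u₀)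
    have h2 : HasFDerivAt (fun u => Ψ ((q₀, y₀), u)) (ContinuousLinearMap.id ℝ _) u₀ := by
      simp only [hcst]
      exact (hasFDerivAt_id u₀).sub_const u₀
    exact h1.unique h2
  have hinv₀ : (fderiv ℝ Ψ P₀ ∘L ContinuousLinearMap.inr ℝ (Q × Y) C(Icc (0 : ℝ) 1, Y)).IsInvertible := by
    rw [hpart]
    exact ⟨ContinuousLinearEquiv.refl ℝ _, rfl⟩
  have hinv : ∀ᶠ v in 𝓝 P₀, (fderiv ℝ Ψ v ∘L ContinuousLinearMap.inr ℝ (Q × Y) C(Icc (0 : ℝ) 1, Y)).IsInvertible := by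
    have hc : Continuous fun v => fderiv ℝ Ψ v ∘L ContinuousLinearMap.inr ℝ (Q × Y) C(Icc (0 : ℝ) 1, Y) :=
      (hΨ.continuous_fderiv (by simp)).clm_comp continuous_const
    have ho : IsOpen (range ((↑) : (C(Icc (0 : ℝ) 1, Y) ≃L[ℝ] C(Icc (0 : ℝ) 1, Y)) →
        (C(Icc (0 : ℝ) 1, Y) →L[ℝ] C(Icc (0 : ℝ) 1, Y)))) := ContinuousLinearEquiv.isOpen
    exact hc.continuousAt.eventually (ho.mem_nhds hinv₀)
  have cd : ∀ v, ContDiffAt ℝ ∞ Ψ v := fun v => hΨ.contDiffAt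
  have hne : (∞ : WithTop ℕ∞) ≠ 0 := by simp
  let U := (cd P₀).implicitFunction hne hinv₀
  have hU₀ : U (q₀, y₀) = u₀ := (cd P₀).implicitFunction_apply_self hne hinv₀
  have hUc : ContDiffAt ℝ ∞ U (q₀, y₀) := (cd P₀).contDiffAt_implicitFunction hne hinv₀
  have hUs : ∀ᶠ p in 𝓝 (q₀, y₀), Ψ (p, U p) = 0 := by
    have := (cd P₀).eventually_apply_implicitFunction hne hinv₀
    rw [hΨ0] at this
    exact this
  have hgr : Tendsto (fun p => (p, U p)) (𝓝 (q₀, y₀)) (𝓝 P₀) := by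
    have := (continuousAt_id (x := (q₀, y₀))).prodMk hUc.continuousAt
    rwa [ContinuousAt, hU₀] at this
  refine ⟨U, hU₀, ?_, ?_⟩
  -- `ContDiffAt ℝ ∞` at one point does not spread to a neighbourhood. The implicit function theorem
  -- is applied again at each nearby (p, U p), and uniqueness identifies the new implicit function
  -- with U.
  · have hU1 : ∀ᶠ p in 𝓝 (q₀, y₀), ContDiffAt ℝ 1 U p :=
      (hUc.of_le (by exact_mod_cast le_top)).eventually (by simp)
    filter_upwards [hU1, hUs.eventually_nhds, hgr.eventually hinv] with p hp1 hp2 hp3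
    have he := (cd (p, U p)).eventually_apply_eq_iff_implicitFunction hne hp3
    have hg : Tendsto (fun p' => (p', U p')) (𝓝 p) (𝓝 (p, U p)) :=
      (continuousAt_id (x := p)).prodMk hp1.continuousAt
    refine ((cd (p, U p)).contDiffAt_implicitFunction hne hp3).congr_of_eventuallyEq ?_
    filter_upwards [hg.eventually he, hp2] with p' h1 h2
    rw [hp2.self_of_nhds] at h1
    exact (h1.1 h2).symm
  · filter_upwards [hUs] with p hp t
    have := hΨ_apply (p, U p) t
    rw [hp, ContinuousMap.zero_apply] at this
    rw [eq_comm, sub_sub, sub_eq_zero] at this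
    exact this

end ODE

/-! ### Calculus of tangent curves in families of diffeomorphism groups. -/

section TangentCurves

variable {Q E : Type} [NormedAddCommGroup Q] [NormedSpace ℝ Q]
  [NormedAddCommGroup E] [NormedSpace ℝ E]

/-- The domain of a curve of diffeomorphisms of `U` that depend on a parameter in `W`. -/
abbrev curveDomain (ε : ℝ) (W : Set Q) (U : Set E) : Set (ℝ × Q × E) := Ioo (-ε) ε ×ˢ W ×ˢ U

/-- A family of groups of diffeomorphisms of `U`. -/
structure IsDiffeoFamily (U : Set E) (W : Set Q) (𝒢 : Q → Set (E → E)) : Prop where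
  one_mem : ∀ x ∈ W, id ∈ 𝒢 x
  mul_mem : ∀ x ∈ W, ∀ σ ∈ 𝒢 x, ∀ τ ∈ 𝒢 x, σ ∘ τ ∈ 𝒢 x
  inv_mem : ∀ x ∈ W, ∀ σ ∈ 𝒢 x, ∃ τ ∈ 𝒢 x, (∀ y ∈ U, τ (σ y) = y) ∧ ∀ y ∈ U, σ (τ y) = y
  mapsTo : ∀ x ∈ W, ∀ σ ∈ 𝒢 x, MapsTo σ U U
  differentiableOn : ∀ x ∈ W, ∀ σ ∈ 𝒢 x, DifferentiableOn ℝ σ U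

/-- `φ` is a smooth family of curves in the groups `𝒢 x` of the form `φ = id + tᵏ ρ` where
`ρ = ξ` at `t = 0`. -/
structure IsTangentCurve (𝒢 : Q → Set (E → E)) (U : Set E) (W : Set Q) (k : ℕ) (ε : ℝ)
    (φ ρ : ℝ × Q × E → E) (ξ : Q × E → E) : Prop where
  order : 1 ≤ k
  pos : 0 < ε
  mem : ∀ t ∈ Ioo (-ε) ε, ∀ x ∈ W, (fun y => φ (t, x, y)) ∈ 𝒢 x
  smooth : ContDiffOn ℝ ∞ ρ (curveDomain ε W U)
  eq : ∀ p ∈ curveDomain ε W U, φ p = p.2.2 + p.1 ^ k • ρ p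
  zero : ∀ x ∈ W, ∀ y ∈ U, ρ (0, x, y) = ξ (x, y)

/-- `ξ` is tangent to the family of groups `𝒢`, smoothly in the parameter. -/
def IsTangentTo (𝒢 : Q → Set (E → E)) (U : Set E) (W : Set Q) (ξ : Q × E → E) : Prop :=
  ∃ k ε φ ρ, IsTangentCurve 𝒢 U W k ε φ ρ ξ

variable {𝒢 : Q → Set (E → E)} {U : Set E} {W : Set Q} {k l : ℕ} {ε δ : ℝ}
  {φ ρ ψ θ : ℝ × Q × E → E} {ξ η : Q × E → E}

theorem contDiffOn_comp_curveDomain {G : Type} [NormedAddCommGroup G] [NormedSpace ℝ G]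
    {a : ℝ × Q × E → G} (ha : ContDiffOn ℝ ∞ a (curveDomain ε W U))
    (hψ : ContDiffOn ℝ ∞ ψ (curveDomain ε W U)) (hm : ∀ p ∈ curveDomain ε W U, ψ p ∈ U) :
    ContDiffOn ℝ ∞ (fun p => a (p.1, p.2.1, ψ p)) (curveDomain ε W U) :=
  ha.comp (contDiffOn_fst.prodMk ((contDiff_fst.comp contDiff_snd).contDiffOn.prodMk hψ))
    fun p hp => ⟨hp.1, hp.2.1, hm p hp⟩

namespace IsTangentCurve

theorem smooth_map (h : IsTangentCurve 𝒢 U W k ε φ ρ ξ) :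
    ContDiffOn ℝ ∞ φ (curveDomain ε W U) := by
  refine ContDiffOn.congr ?_ h.eq
  exact (contDiff_snd.comp contDiff_snd).contDiffOn.add
    ((contDiff_fst.pow k).contDiffOn.smul h.smooth)

theorem map_mem (h : IsTangentCurve 𝒢 U W k ε φ ρ ξ) (hG : IsDiffeoFamily U W 𝒢) :
    ∀ p ∈ curveDomain ε W U, φ p ∈ U :=
  fun _ hp => hG.mapsTo _ hp.2.1 _ (h.mem _ hp.1 _ hp.2.1) hp.2.2

theorem zero_mem_Ioo (h : IsTangentCurve 𝒢 U W k ε φ ρ ξ) : (0 : ℝ) ∈ Ioo (-ε) ε :=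
  ⟨by linarith [h.pos], h.pos⟩

theorem map_zero (h : IsTangentCurve 𝒢 U W k ε φ ρ ξ) {x : Q} (hx : x ∈ W) {y : E} (hy : y ∈ U) :
    φ (0, x, y) = y := by
  rw [h.eq _ ⟨h.zero_mem_Ioo, hx, hy⟩, zero_pow (by have := h.order; omega), zero_smul, add_zero]

theorem mono (h : IsTangentCurve 𝒢 U W k ε φ ρ ξ) {V : Set Q} (hV : V ⊆ W) {δ : ℝ} (hδ : 0 < δ)
    (hδε : δ ≤ ε) : IsTangentCurve 𝒢 U V k δ φ ρ ξ := by
  have hI : Ioo (-δ) δ ⊆ Ioo (-ε) ε := Ioo_subset_Ioo (by linarith) hδε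
  have hs : curveDomain δ V U ⊆ curveDomain ε W U := prod_mono hI (prod_mono hV Subset.rfl)
  exact ⟨h.order, hδ, fun t ht x hx => h.mem t (hI ht) x (hV hx), h.smooth.mono hs,
    fun p hp => h.eq p (hs hp), fun x hx => h.zero x (hV hx)⟩

/-- The substitution t ↦ tᵐ multiplies the order by m and leaves ξ unchanged. For |t| < 1 one has
|tᵐ| ≤ |t|, hence `min ε 1`. -/
theorem comp_pow (h : IsTangentCurve 𝒢 U W k ε φ ρ ξ) {m : ℕ} (hm : 1 ≤ m) :
    IsTangentCurve 𝒢 U W (m * k) (min ε 1) (fun p => φ (p.1 ^ m, p.2)) (fun p => ρ (p.1 ^ m, p.2))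
      ξ := by
  have hI : ∀ t ∈ Ioo (-min ε 1) (min ε 1), t ^ m ∈ Ioo (-ε) ε := fun t ht => by
    have h1 := abs_lt.2 ht
    rw [mem_Ioo, ← abs_lt, abs_pow]
    exact (pow_le_of_le_one (abs_nonneg t) (h1.le.trans (min_le_right _ _)) (by omega)).trans_lt
      (h1.trans_le (min_le_left _ _))
  refine ⟨Nat.mul_pos hm h.order, lt_min h.pos one_pos, fun t ht x hx => h.mem _ (hI t ht) x hx,
    h.smooth.comp ((contDiff_fst.pow m).prodMk contDiff_snd).contDiffOn
      fun p hp => ⟨hI _ hp.1, hp.2⟩, fun p hp => ?_, fun x hx y hy => ?_⟩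
  · rw [h.eq (p.1 ^ m, p.2) ⟨hI _ hp.1, hp.2⟩, pow_mul]
  · simp only [zero_pow (show m ≠ 0 by omega), h.zero x hx y hy]

/-- Substitute t ↦ c^{1/k} t. -/
theorem smul_of_pos (h : IsTangentCurve 𝒢 U W k ε φ ρ ξ) {c : ℝ} (hc : 0 < c) :
    ∃ δ ψ θ, IsTangentCurve 𝒢 U W k δ ψ θ (fun p => c • ξ p) := by
  set r : ℝ := c ^ ((k : ℝ)⁻¹) with hr
  have hr0 : 0 < r := Real.rpow_pos_of_pos hc _
  have hrk : r ^ k = c := Real.rpow_inv_natCast_pow hc.le (by have := h.order; omega)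
  have hI : ∀ t ∈ Ioo (-(ε / r)) (ε / r), r * t ∈ Ioo (-ε) ε := fun t ht => by
    rw [mem_Ioo, ← abs_lt] at ht ⊢
    rw [abs_mul, abs_of_pos hr0, mul_comm]
    exact (lt_div_iff₀ hr0).1 ht
  refine ⟨ε / r, fun p => φ (r * p.1, p.2), fun p => c • ρ (r * p.1, p.2), h.order,
    div_pos h.pos hr0, fun t ht x hx => h.mem _ (hI t ht) x hx,
    (h.smooth.comp ((contDiff_const.mul contDiff_fst).prodMk contDiff_snd).contDiffOn
      fun p hp => ⟨hI _ hp.1, hp.2⟩).const_smul c, fun p hp => ?_, fun x hx y hy => ?_⟩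
  · rw [h.eq (r * p.1, p.2) ⟨hI _ hp.1, hp.2⟩, mul_pow, hrk, mul_comm c, mul_smul]
  · simp only [mul_zero, h.zero x hx y hy]

/-- The remainder θ + ρ ∘ ψ of the product is exact; at t = 0 it becomes η + ξ because ψ₀ = id. -/
theorem comp (h : IsTangentCurve 𝒢 U W k ε φ ρ ξ) (h' : IsTangentCurve 𝒢 U W k ε ψ θ η)
    (hG : IsDiffeoFamily U W 𝒢) :
    IsTangentCurve 𝒢 U W k ε (fun p => φ (p.1, p.2.1, ψ p))
      (fun p => θ p + ρ (p.1, p.2.1, ψ p)) (fun p => ξ p + η p) := by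
  refine ⟨h.order, h.pos, fun t ht x hx => hG.mul_mem x hx _ (h.mem t ht x hx) _ (h'.mem t ht x hx),
    h'.smooth.add (contDiffOn_comp_curveDomain h.smooth h'.smooth_map (h'.map_mem hG)),
    fun p hp => ?_, fun x hx y hy => ?_⟩
  · rw [h.eq (p.1, p.2.1, ψ p) ⟨hp.1, hp.2.1, h'.map_mem hG p hp⟩, h'.eq p hp, smul_add, add_assoc]
  · rw [h'.map_zero hx hy, h.zero x hx y hy, h'.zero x hx y hy, add_comm]

/-- The inverses are chosen for each (t, x) separately, without any continuity. Joint smoothness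
follows from `contDiffOn_parametric_inverse`, since every member of the groups is differentiable. -/
theorem exists_inverse [FiniteDimensional ℝ Q] [FiniteDimensional ℝ E]
    (h : IsTangentCurve 𝒢 U W k ε φ ρ ξ) (hG : IsDiffeoFamily U W 𝒢) (hU : IsOpen U)
    (hW : IsOpen W) :
    ∃ ψ : ℝ × Q × E → E, ContDiffOn ℝ ∞ ψ (curveDomain ε W U) ∧
      (∀ t ∈ Ioo (-ε) ε, ∀ x ∈ W, (fun y => ψ (t, x, y)) ∈ 𝒢 x) ∧
      (∀ p ∈ curveDomain ε W U, ψ p ∈ U) ∧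
      (∀ p ∈ curveDomain ε W U, ψ (p.1, p.2.1, φ p) = p.2.2) ∧
      ∀ p ∈ curveDomain ε W U, φ (p.1, p.2.1, ψ p) = p.2.2 := by
  classical
  choose! τ hτ hτl hτr using
    fun (t : ℝ) (ht : t ∈ Ioo (-ε) ε) (x : Q) (hx : x ∈ W) =>
      hG.inv_mem x hx _ (h.mem t ht x hx)
  have hmem : ∀ p ∈ curveDomain ε W U, τ p.1 p.2.1 p.2.2 ∈ U := fun p hp =>
    hG.mapsTo _ hp.2.1 _ (hτ p.1 hp.1 p.2.1 hp.2.1) hp.2.2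
  refine ⟨fun p => τ p.1 p.2.1 p.2.2, ?_, hτ, hmem,
    fun p hp => hτl p.1 hp.1 p.2.1 hp.2.1 _ hp.2.2,
    fun p hp => hτr p.1 hp.1 p.2.1 hp.2.1 _ hp.2.2⟩
  let as : (ℝ × Q) × E → ℝ × Q × E := fun p => (p.1.1, p.1.2, p.2)
  have has : ContDiff ℝ ∞ as := by fun_prop
  have key := contDiffOn_parametric_inverse (Q := ℝ × Q) (E := E)
    (D := as ⁻¹' curveDomain ε W U) (D' := as ⁻¹' curveDomain ε W U)
    (φ := fun p => φ (as p)) (ψ := fun p => τ p.1.1 p.1.2 p.2)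
    ((isOpen_Ioo.prod (hW.prod hU)).preimage has.continuous)
    (h.smooth_map.comp has.contDiffOn (mapsTo_preimage _ _))
    (fun q y hq => ⟨⟨hq.1, hq.2.1, h.map_mem hG _ hq⟩, hτl q.1 hq.1 q.2 hq.2.1 _ hq.2.2⟩)
    (fun q y hq => ⟨⟨hq.1, hq.2.1, hmem _ hq⟩, hτr q.1 hq.1 q.2 hq.2.1 _ hq.2.2⟩)
    (fun q y hq => (hG.differentiableOn q.2 hq.2.1 _ (hτ q.1 hq.1 q.2 hq.2.1)).differentiableAt
      (hU.mem_nhds hq.2.2))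
  have hsa : ContDiff ℝ ∞ fun p : ℝ × Q × E => ((p.1, p.2.1), p.2.2) := by fun_prop
  exact key.comp hsa.contDiffOn fun p hp => hp

end IsTangentCurve

namespace IsTangentTo

theorem mono (h : IsTangentTo 𝒢 U W ξ) {V : Set Q} (hV : V ⊆ W) : IsTangentTo 𝒢 U V ξ :=
  let ⟨k, ε, φ, ρ, h⟩ := h
  ⟨k, ε, φ, ρ, h.mono hV h.pos le_rfl⟩

theorem congr (h : IsTangentTo 𝒢 U W ξ) (he : ∀ x ∈ W, ∀ y ∈ U, η (x, y) = ξ (x, y)) :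
    IsTangentTo 𝒢 U W η :=
  let ⟨k, ε, φ, ρ, h⟩ := h
  ⟨k, ε, φ, ρ, h.order, h.pos, h.mem, h.smooth, h.eq, fun x hx y hy => by
    rw [he x hx y hy, h.zero x hx y hy]⟩

theorem zero (hG : IsDiffeoFamily U W 𝒢) : IsTangentTo 𝒢 U W (fun _ => 0) :=
  ⟨1, 1, fun p => p.2.2, fun _ => 0, le_rfl, one_pos, fun _ _ x hx => hG.one_mem x hx,
    contDiffOn_const, fun p _ => by simp, fun _ _ _ _ => rfl⟩

/-- Orders k and l are both raised to kl by `IsTangentCurve.comp_pow`. -/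
theorem exists_common (h : IsTangentTo 𝒢 U W ξ) (h' : IsTangentTo 𝒢 U W η) :
    ∃ k ε φ ρ ψ θ, IsTangentCurve 𝒢 U W k ε φ ρ ξ ∧ IsTangentCurve 𝒢 U W k ε ψ θ η := by
  obtain ⟨k, ε, φ, ρ, h⟩ := h
  obtain ⟨l, δ, ψ, θ, h'⟩ := h'
  have h1 := h.comp_pow h'.order
  have h2 := h'.comp_pow h.order
  rw [mul_comm] at h2
  have hp := lt_min h1.pos h2.pos
  exact ⟨_, _, _, _, _, _, h1.mono Subset.rfl hp (min_le_left _ _),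
    h2.mono Subset.rfl hp (min_le_right _ _)⟩

theorem add (h : IsTangentTo 𝒢 U W ξ) (h' : IsTangentTo 𝒢 U W η) (hG : IsDiffeoFamily U W 𝒢) :
    IsTangentTo 𝒢 U W (fun p => ξ p + η p) :=
  let ⟨_, _, _, _, _, _, h1, h2⟩ := h.exists_common h'
  ⟨_, _, _, _, h1.comp h2 hG⟩

theorem smul_of_pos (h : IsTangentTo 𝒢 U W ξ) {c : ℝ} (hc : 0 < c) :
    IsTangentTo 𝒢 U W (fun p => c • ξ p) :=
  let ⟨k, _, _, _, h⟩ := h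
  ⟨k, h.smul_of_pos hc⟩

theorem contDiffOn (h : IsTangentTo 𝒢 U W ξ) : ContDiffOn ℝ ∞ ξ (W ×ˢ U) := by
  obtain ⟨k, ε, φ, ρ, h⟩ := h
  have : ContDiffOn ℝ ∞ (fun q : Q × E => ρ (0, q)) (W ×ˢ U) :=
    h.smooth.comp (contDiff_const.prodMk contDiff_id).contDiffOn
      fun q hq => ⟨h.zero_mem_Ioo, hq⟩
  exact this.congr fun q hq => (h.zero q.1 hq.1 q.2 hq.2).symm

variable [FiniteDimensional ℝ Q] [FiniteDimensional ℝ E]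

/-- φ⁻¹ = id − tᵏ ρ ∘ φ⁻¹. Reversing the time would change the sign only for odd k. -/
theorem neg (h : IsTangentTo 𝒢 U W ξ) (hG : IsDiffeoFamily U W 𝒢) (hU : IsOpen U)
    (hW : IsOpen W) : IsTangentTo 𝒢 U W (fun p => -ξ p) := by
  obtain ⟨k, ε, φ, ρ, h⟩ := h
  obtain ⟨ψ, hψ, hψG, hψU, hl, hr⟩ := h.exists_inverse hG hU hW
  refine ⟨k, ε, ψ, fun p => -ρ (p.1, p.2.1, ψ p), h.order, h.pos, hψG,
    (contDiffOn_comp_curveDomain h.smooth hψ hψU).neg, fun p hp => ?_, fun x hx y hy => ?_⟩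
  · have := hr p hp
    rw [h.eq (p.1, p.2.1, ψ p) ⟨hp.1, hp.2.1, hψU p hp⟩] at this
    simp only at this
    rw [← this]
    simp
  · have hp : ((0 : ℝ), x, y) ∈ curveDomain ε W U := ⟨h.zero_mem_Ioo, hx, hy⟩
    have := hl _ hp
    rw [h.map_zero hx hy] at this
    simp only at this
    simp only [this, h.zero x hx y hy]

theorem smul (h : IsTangentTo 𝒢 U W ξ) (hG : IsDiffeoFamily U W 𝒢) (hU : IsOpen U)
    (hW : IsOpen W) (c : ℝ) : IsTangentTo 𝒢 U W (fun p => c • ξ p) := by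
  rcases lt_trichotomy c 0 with hc | rfl | hc
  · refine ((h.smul_of_pos (neg_pos.2 hc)).neg hG hU hW).congr fun x _ y _ => by simp
  · exact (zero hG).congr fun x _ y _ => by simp
  · exact h.smul_of_pos hc

/-- First order expansion of `ρ(t, x, y + τ θ(t, x, y))` in `τ`. -/
theorem exists_expansion (hU : IsOpen U) (hW : IsOpen W)
    (hρ : ContDiffOn ℝ ∞ ρ (curveDomain ε W U)) (hθ : ContDiffOn ℝ ∞ θ (curveDomain ε W U)) :
    ∃ (D : Set (ℝ × ℝ × Q × E)) (κ : ℝ × ℝ × Q × E → E),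
      (∀ τ, ∀ p ∈ curveDomain ε W U, p.2.2 + τ • θ p ∈ U → (τ, p) ∈ D) ∧ ContDiffOn ℝ ∞ κ D ∧
      (∀ τ, ∀ p ∈ curveDomain ε W U, p.2.2 + τ • θ p ∈ U →
        ρ (p.1, p.2.1, p.2.2 + τ • θ p) = ρ p + τ • κ (τ, p)) ∧
      ∀ p ∈ curveDomain ε W U,
        κ (0, p) = fderiv ℝ (fun y => ρ (p.1, p.2.1, y)) p.2.2 (θ p) := by
  have hdom : IsOpen (curveDomain ε W U) := isOpen_Ioo.prod (hW.prod hU)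
  let j : ℝ × ℝ × Q × E → ℝ × Q × E := fun q => (q.2.1, q.2.2.1, q.2.2.2 + q.1 • θ q.2)
  have hj : ContDiffOn ℝ ∞ j (Prod.snd ⁻¹' curveDomain ε W U) := by
    have h1 : ContDiffOn ℝ ∞ (fun q : ℝ × ℝ × Q × E => θ q.2) (Prod.snd ⁻¹' curveDomain ε W U) :=
      hθ.comp contDiffOn_snd (mapsTo_preimage _ _)
    have h2 : ContDiffOn ℝ ∞ (fun q : ℝ × ℝ × Q × E => q.2.2.2 + q.1 • θ q.2)
        (Prod.snd ⁻¹' curveDomain ε W U) :=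
      ContDiffOn.add (by fun_prop) (contDiffOn_fst.smul h1)
    exact ContDiffOn.prodMk (by fun_prop) (ContDiffOn.prodMk (by fun_prop) h2)
  -- The pairs (τ, p) for which p and the displaced point both lie in the domain of ρ. This set is
  -- open and contains (0, p) with each (τ, p), as Hadamard's lemma in τ requires.
  let D : Set (ℝ × ℝ × Q × E) := Prod.snd ⁻¹' curveDomain ε W U ∩ j ⁻¹' curveDomain ε W U
  have hD : IsOpen D :=
    hj.continuousOn.isOpen_inter_preimage (hdom.preimage continuous_snd) hdom
  have hmem : ∀ τ, ∀ p ∈ curveDomain ε W U, p.2.2 + τ • θ p ∈ U → (τ, p) ∈ D :=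
    fun τ p hp h => ⟨hp, hp.1, hp.2.1, h⟩
  have hD0 : ∀ τ p, (τ, p) ∈ D → ((0 : ℝ), p) ∈ D := fun τ p h =>
    hmem 0 p h.1 (by simpa using h.1.2.2)
  have hg : ContDiffOn ℝ ∞ (fun q => ρ (j q)) D :=
    hρ.comp (hj.mono inter_subset_left) fun q hq => hq.2
  refine ⟨D, _, hmem, contDiffOn_dslope hD hD0 hg, fun τ p hp h => ?_, fun p hp => ?_⟩
  · have := sub_smul_dslope (fun t => ρ (j (t, p))) 0 τ
    rw [sub_zero] at this
    simp only [j] at this ⊢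
    rw [this]
    simp
  · rw [dslope_same]
    have hd : DifferentiableAt ℝ (fun y => ρ (p.1, p.2.1, y)) p.2.2 := by
      have h1 := (hρ.contDiffAt (hdom.mem_nhds hp)).differentiableAt (by simp)
      have h2 : DifferentiableAt ℝ (fun y => (p.1, p.2.1, y)) p.2.2 := by fun_prop
      exact DifferentiableAt.comp p.2.2 (g := ρ) h1 h2
    have h3 : HasDerivAt (fun τ : ℝ => p.2.2 + τ • θ p) (θ p) 0 := by
      simpa using ((hasDerivAt_id (0 : ℝ)).smul_const (θ p)).const_add p.2.2
    have h4 := HasFDerivAt.comp_hasDerivAt_of_eq (0 : ℝ) hd.hasFDerivAt h3 (by simp)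
    exact h4.deriv

/-- For φ = id + tᵏρ and ψ = id + tᵏθ, expanding ρ ∘ ψ and θ ∘ φ to first order gives φψ = ψφ +
t²ᵏκ, with κ = Dρ(θ) − Dθ(ρ) at t = 0. Inserting φ⁻¹ψ⁻¹ gives the commutator φψφ⁻¹ψ⁻¹ = id + t²ᵏ κ ∘
φ⁻¹ψ⁻¹ in the group. With [V, W] = DW(V) − DV(W) the resulting field is [η, ξ]. -/
theorem bracket (h : IsTangentTo 𝒢 U W ξ) (h' : IsTangentTo 𝒢 U W η) (hG : IsDiffeoFamily U W 𝒢)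
    (hU : IsOpen U) (hW : IsOpen W) :
    IsTangentTo 𝒢 U W (fun p => fderiv ℝ (fun y => ξ (p.1, y)) p.2 (η p) -
      fderiv ℝ (fun y => η (p.1, y)) p.2 (ξ p)) := by
  obtain ⟨k, ε, φ, ρ, ψ, θ, h, h'⟩ := h.exists_common h'
  obtain ⟨φ', hφ', hφG, hφU, hφl, hφr⟩ := h.exists_inverse hG hU hW
  obtain ⟨ψ', hψ', hψG, hψU, hψl, hψr⟩ := h'.exists_inverse hG hU hW
  obtain ⟨D₁, κ₁, hD₁, hκ₁, hκe₁, hκz₁⟩ := exists_expansion hU hW h.smooth h'.smooth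
  obtain ⟨D₂, κ₂, hD₂, hκ₂, hκe₂, hκz₂⟩ := exists_expansion hU hW h'.smooth h.smooth
  have hk0 : k ≠ 0 := by have := h.order; omega
  have hm₁ : ∀ p ∈ curveDomain ε W U, p.2.2 + p.1 ^ k • θ p ∈ U := fun p hp => by
    rw [← h'.eq p hp]; exact h'.map_mem hG p hp
  have hm₂ : ∀ p ∈ curveDomain ε W U, p.2.2 + p.1 ^ k • ρ p ∈ U := fun p hp => by
    rw [← h.eq p hp]; exact h.map_mem hG p hp
  let κ : ℝ × Q × E → E := fun p => κ₁ (p.1 ^ k, p) - κ₂ (p.1 ^ k, p)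
  have hκ : ContDiffOn ℝ ∞ κ (curveDomain ε W U) := by
    have hj : ContDiff ℝ ∞ fun p : ℝ × Q × E => (p.1 ^ k, p) := by fun_prop
    exact (hκ₁.comp hj.contDiffOn fun p hp => hD₁ _ p hp (hm₁ p hp)).sub
      (hκ₂.comp hj.contDiffOn fun p hp => hD₂ _ p hp (hm₂ p hp))
  have hdiff : ∀ p ∈ curveDomain ε W U,
      φ (p.1, p.2.1, ψ p) = ψ (p.1, p.2.1, φ p) + p.1 ^ (k + k) • κ p := by
    intro p hp
    rw [h.eq (p.1, p.2.1, ψ p) ⟨hp.1, hp.2.1, h'.map_mem hG p hp⟩, h'.eq (p.1, p.2.1, φ p)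
      ⟨hp.1, hp.2.1, h.map_mem hG p hp⟩, h'.eq p hp, h.eq p hp, hκe₁ _ p hp (hm₁ p hp),
      hκe₂ _ p hp (hm₂ p hp), pow_add]
    simp only [κ, smul_add, smul_sub, mul_smul]
    abel
  have hφψ : ∀ p ∈ curveDomain ε W U, φ' (p.1, p.2.1, ψ' p) ∈ U := fun p hp =>
    hφU _ ⟨hp.1, hp.2.1, hψU p hp⟩
  refine ⟨k + k, ε, fun p => φ (p.1, p.2.1, ψ (p.1, p.2.1, φ' (p.1, p.2.1, ψ' p))),
    fun p => κ (p.1, p.2.1, φ' (p.1, p.2.1, ψ' p)), by omega, h.pos, fun t ht x hx => ?_,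
    contDiffOn_comp_curveDomain hκ (contDiffOn_comp_curveDomain hφ' hψ' hψU) hφψ,
    fun p hp => ?_, fun x hx y hy => ?_⟩
  · exact hG.mul_mem x hx _ (h.mem t ht x hx) _ (hG.mul_mem x hx _ (h'.mem t ht x hx) _
      (hG.mul_mem x hx _ (hφG t ht x hx) _ (hψG t ht x hx)))
  · have hp' : (p.1, p.2.1, φ' (p.1, p.2.1, ψ' p)) ∈ curveDomain ε W U :=
      ⟨hp.1, hp.2.1, hφψ p hp⟩
    have h1 := hdiff _ hp'
    simp only at h1
    rw [h1]
    congr 1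
    have h2 := hφr (p.1, p.2.1, ψ' p) ⟨hp.1, hp.2.1, hψU p hp⟩
    simp only at h2
    rw [h2]
    exact hψr p hp
  · have hp : ((0 : ℝ), x, y) ∈ curveDomain ε W U := ⟨h.zero_mem_Ioo, hx, hy⟩
    have h1 := hφl _ hp
    have h2 := hψl _ hp
    simp only [h.map_zero hx hy] at h1
    simp only [h'.map_zero hx hy] at h2
    simp only [h2, h1, κ, zero_pow hk0, hκz₁ _ hp, hκz₂ _ hp, h.zero x hx y hy, h'.zero x hx y hy]
    have e1 : (fun y => ρ (0, x, y)) =ᶠ[𝓝 y] fun y => ξ (x, y) := by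
      filter_upwards [hU.mem_nhds hy] with z hz using h.zero x hx z hz
    have e2 : (fun y => θ (0, x, y)) =ᶠ[𝓝 y] fun y => η (x, y) := by
      filter_upwards [hU.mem_nhds hy] with z hz using h'.zero x hx z hz
    rw [e1.fderiv_eq, e2.fderiv_eq]

end IsTangentTo

end TangentCurves

/-! ### Spray and connection of a Finsler norm in one chart. -/

section LocalFinsler

variable {n : ℕ}

/-- The slit domain `Ω × (ℝⁿ ∖ 0)`. -/
abbrev slit (Ω : Set (Coord n)) : Set (Coord n × Coord n) := Ω ×ˢ {y | y ≠ 0}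

/-- `g_{ij} = ½ ∂²L/∂yⁱ∂yʲ`. -/
def localMetric (L : Coord n × Coord n → ℝ) (z : Coord n × Coord n) : Matrix (Fin n) (Fin n) ℝ :=
  Matrix.of fun i j => 1 / 2 * dY i (dY j L) z

/-- The spray coefficients of `L = F²`. -/
def localSpray (L : Coord n × Coord n → ℝ) (i : Fin n) (z : Coord n × Coord n) : ℝ :=
  1 / 4 * ∑ j, ∑ k, ∑ l, (localMetric L z)⁻¹ i l *
    (2 * dX k (fun w => localMetric L w j l) z - dX l (fun w => localMetric L w j k) z) *
    z.2 j * z.2 k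

/-- The connection of `L = F²`. -/
def localConn (L : Coord n × Coord n → ℝ) (z : Coord n × Coord n) (a : Coord n) : Coord n :=
  WithLp.toLp 2 fun i => ∑ j, dY j (localSpray L i) z * a j

/-- The spray coefficients as a vector. -/
def sprayVector (L : Coord n × Coord n → ℝ) (z : Coord n × Coord n) : Coord n :=
  WithLp.toLp 2 fun i => localSpray L i z

/-- The horizontal lift `a ↦ (a, -N(z) a)`. -/
def localHor (L : Coord n × Coord n → ℝ) (z : Coord n × Coord n) (a : Coord n) :
    Coord n × Coord n := (a, -localConn L z a)

/-- The vertical component of the curvature `R(aʰ, bʰ)`. -/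
def localCurv (L : Coord n × Coord n → ℝ) (z : Coord n × Coord n) (a b : Coord n) : Coord n :=
  fderiv ℝ (fun w => localConn L w a) z (localHor L z b) -
    fderiv ℝ (fun w => localConn L w b) z (localHor L z a)

/-- `L` is the square of a Finsler norm on the open set `Ω` of `ℝⁿ`. -/
structure IsLocalFinsler (Ω : Set (Coord n)) (L : Coord n × Coord n → ℝ) : Prop where
  isOpen : IsOpen Ω
  smooth : ContDiffOn ℝ ∞ L (slit Ω)
  homogeneous : ∀ x ∈ Ω, ∀ y : Coord n, ∀ a : ℝ, 0 < a → L (x, a • y) = a ^ 2 * L (x, y)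
  pos : ∀ z ∈ slit Ω, ∀ u : Coord n, u ≠ 0 →
    0 < fderiv ℝ (fun w => fderiv ℝ L w (0, u)) z (0, u)

theorem clm_apply_eq_sum {G : Type*} [NormedAddCommGroup G] [NormedSpace ℝ G]
    (A : Coord n →L[ℝ] G) (y : Coord n) :
    A y = ∑ j, y j • A (EuclideanSpace.single j 1) := by
  conv_lhs => rw [← (EuclideanSpace.basisFun (Fin n) ℝ).sum_repr y]
  simp

theorem contDiffOn_matrix_det {Z : Type*} [NormedAddCommGroup Z] [NormedSpace ℝ Z] {S : Set Z}
    {A : Z → Matrix (Fin n) (Fin n) ℝ} (hA : ∀ i j, ContDiffOn ℝ ∞ (fun z => A z i j) S) :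
    ContDiffOn ℝ ∞ (fun z => (A z).det) S := by
  simp only [Matrix.det_apply']
  exact ContDiffOn.sum fun σ _ => contDiffOn_const.mul (contDiffOn_prod fun i _ => hA _ _)

/-- Cramer's rule: the entries of the adjugate are again determinants. -/
theorem contDiffOn_matrix_inv {Z : Type*} [NormedAddCommGroup Z] [NormedSpace ℝ Z] {S : Set Z}
    {A : Z → Matrix (Fin n) (Fin n) ℝ} (hA : ∀ i j, ContDiffOn ℝ ∞ (fun z => A z i j) S)
    (hdet : ∀ z ∈ S, (A z).det ≠ 0) (i j : Fin n) :
    ContDiffOn ℝ ∞ (fun z => (A z)⁻¹ i j) S := by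
  simp only [Matrix.inv_def, Matrix.smul_apply, Ring.inverse_eq_inv', smul_eq_mul]
  refine ((contDiffOn_matrix_det hA).inv hdet).mul ?_
  simp only [Matrix.adjugate_apply]
  refine contDiffOn_matrix_det fun k l => ?_
  simp only [Matrix.updateRow_apply]
  split_ifs
  · exact contDiffOn_const
  · exact hA _ _

namespace IsLocalFinsler

variable {Ω Ω' : Set (Coord n)} {L L' : Coord n × Coord n → ℝ}

theorem isOpen_slit (h : IsLocalFinsler Ω L) : IsOpen (slit Ω) := h.isOpen.prod isOpen_ne

theorem mem_nhds (h : IsLocalFinsler Ω L) {z : Coord n × Coord n} (hz : z ∈ slit Ω) :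
    slit Ω ∈ 𝓝 z := h.isOpen_slit.mem_nhds hz

theorem smooth_fderiv (h : IsLocalFinsler Ω L) : ContDiffOn ℝ ∞ (fderiv ℝ L) (slit Ω) :=
  h.smooth.fderiv_of_isOpen h.isOpen_slit (by simp)

theorem hasFDerivAt (h : IsLocalFinsler Ω L) {z : Coord n × Coord n} (hz : z ∈ slit Ω) :
    HasFDerivAt L (fderiv ℝ L z) z :=
  ((h.smooth.contDiffAt (h.mem_nhds hz)).differentiableAt (by simp)).hasFDerivAt

theorem hasFDerivAt_fderiv (h : IsLocalFinsler Ω L) {z : Coord n × Coord n} (hz : z ∈ slit Ω) :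
    HasFDerivAt (fderiv ℝ L) (fderiv ℝ (fderiv ℝ L) z) z :=
  ((h.smooth_fderiv.contDiffAt (h.mem_nhds hz)).differentiableAt (by simp)).hasFDerivAt

theorem hasFDerivAt_fderiv_apply (h : IsLocalFinsler Ω L) {z : Coord n × Coord n}
    (hz : z ∈ slit Ω) (B : Coord n × Coord n) :
    HasFDerivAt (fun w => fderiv ℝ L w B) ((fderiv ℝ (fderiv ℝ L) z).flip B) z := by
  have := (h.hasFDerivAt_fderiv hz).clm_apply (hasFDerivAt_const B z)
  rwa [ContinuousLinearMap.comp_zero, zero_add] at this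

theorem two_le_infty : minSmoothness ℝ 2 ≤ (∞ : WithTop ℕ∞) := by
  rw [minSmoothness_of_isRCLikeNormedField]
  exact WithTop.coe_le_coe.2 (le_top : (2 : ℕ∞) ≤ ⊤)

theorem symm (h : IsLocalFinsler Ω L) {z : Coord n × Coord n} (hz : z ∈ slit Ω)
    (A B : Coord n × Coord n) :
    fderiv ℝ (fderiv ℝ L) z A B = fderiv ℝ (fderiv ℝ L) z B A :=
  ((h.smooth.contDiffAt (h.mem_nhds hz)).isSymmSndFDerivAt two_le_infty) A B

theorem pos' (h : IsLocalFinsler Ω L) {z : Coord n × Coord n} (hz : z ∈ slit Ω) {u : Coord n}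
    (hu : u ≠ 0) : 0 < fderiv ℝ (fderiv ℝ L) z (0, u) (0, u) := by
  have := h.pos z hz u hu
  rwa [(h.hasFDerivAt_fderiv_apply hz (0, u)).fderiv] at this

theorem smul_mem {x y : Coord n} (hz : (x, y) ∈ slit Ω) {a : ℝ} (ha : 0 < a) :
    (x, a • y) ∈ slit Ω := ⟨hz.1, smul_ne_zero ha.ne' hz.2⟩

/-- Dilation of the fibres. -/
def fibreDilation (n : ℕ) (a : ℝ) : Coord n × Coord n →L[ℝ] Coord n × Coord n :=
  (ContinuousLinearMap.fst ℝ _ _).prod (a • ContinuousLinearMap.snd ℝ _ _)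

@[simp] theorem fibreDilation_apply (a : ℝ) (z : Coord n × Coord n) :
    fibreDilation n a z = (z.1, a • z.2) := rfl

/-- Chain rule in L(x, ay) = a²L(x, y); a dilation acts on tangent vectors by (u, v) ↦ (u, av). -/
theorem fderiv_smul (h : IsLocalFinsler Ω L) {x y : Coord n} (hz : (x, y) ∈ slit Ω) {a : ℝ}
    (ha : 0 < a) (u v : Coord n) :
    fderiv ℝ L (x, a • y) (u, a • v) = a ^ 2 * fderiv ℝ L (x, y) (u, v) := by
  have h1 : HasFDerivAt (fun z => L (fibreDilation n a z))
      ((fderiv ℝ L (x, a • y)).comp (fibreDilation n a)) (x, y) :=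
    HasFDerivAt.comp (x, y) (g := L) (h.hasFDerivAt (smul_mem hz ha)) (fibreDilation n a).hasFDerivAt
  have h2 : HasFDerivAt (fun z => a ^ 2 * L z) (a ^ 2 • fderiv ℝ L (x, y)) (x, y) :=
    (h.hasFDerivAt hz).const_mul (a ^ 2)
  have h3 : (fun z => L (fibreDilation n a z)) =ᶠ[𝓝 (x, y)] fun z => a ^ 2 * L z := by
    filter_upwards [h.mem_nhds hz] with z hz
    exact h.homogeneous z.1 hz.1 z.2 a ha
  have := h1.unique (h2.congr_of_eventuallyEq h3)
  exact congrArg (fun A : _ →L[ℝ] ℝ => A (u, v)) this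

theorem fderiv_fderiv_smul (h : IsLocalFinsler Ω L) {x y : Coord n} (hz : (x, y) ∈ slit Ω) {a : ℝ}
    (ha : 0 < a) (u v w : Coord n) :
    fderiv ℝ (fderiv ℝ L) (x, a • y) (u, a • v) (0, w) =
      a * fderiv ℝ (fderiv ℝ L) (x, y) (u, v) (0, w) := by
  have h1 : HasFDerivAt (fun z => fderiv ℝ L (fibreDilation n a z) (0, w))
      (((fderiv ℝ (fderiv ℝ L) (x, a • y)).flip (0, w)).comp (fibreDilation n a)) (x, y) :=
    HasFDerivAt.comp (x, y) (g := fun z => fderiv ℝ L z (0, w))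
      (h.hasFDerivAt_fderiv_apply (smul_mem hz ha) (0, w)) (fibreDilation n a).hasFDerivAt
  have h2 : HasFDerivAt (fun z => a * fderiv ℝ L z (0, w))
      (a • (fderiv ℝ (fderiv ℝ L) (x, y)).flip (0, w)) (x, y) :=
    (h.hasFDerivAt_fderiv_apply hz (0, w)).const_mul a
  have h3 : (fun z => fderiv ℝ L (fibreDilation n a z) (0, w)) =ᶠ[𝓝 (x, y)]
      fun z => a * fderiv ℝ L z (0, w) := by
    filter_upwards [h.mem_nhds hz] with z hz
    have := h.fderiv_smul (x := z.1) (y := z.2) hz ha 0 (a⁻¹ • w)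
    rw [smul_smul, mul_inv_cancel₀ ha.ne', one_smul] at this
    rw [fibreDilation_apply, this]
    have h4 : ((0 : Coord n), a⁻¹ • w) = a⁻¹ • ((0 : Coord n), w) := by simp
    rw [h4, map_smul, smul_eq_mul]
    field_simp
  have := h1.unique (h2.congr_of_eventuallyEq h3)
  exact congrArg (fun A : _ →L[ℝ] ℝ => A (u, v)) this

theorem euler (h : IsLocalFinsler Ω L) {z : Coord n × Coord n} (hz : z ∈ slit Ω) :
    fderiv ℝ L z (0, z.2) = 2 * L z := by
  obtain ⟨x, y⟩ := z
  have h1 : HasDerivAt (fun a : ℝ => (x, a • y)) (0, y) 1 := by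
    simpa using (hasDerivAt_const (1 : ℝ) x).prodMk ((hasDerivAt_id (1 : ℝ)).smul_const y)
  have h2 : HasDerivAt (fun a : ℝ => L (x, a • y)) (fderiv ℝ L (x, y) (0, y)) 1 :=
    HasFDerivAt.comp_hasDerivAt_of_eq (1 : ℝ) (h.hasFDerivAt hz) h1 (by simp)
  have h3 : HasDerivAt (fun a : ℝ => a ^ 2 * L (x, y)) (2 * L (x, y)) 1 := by
    simpa using (hasDerivAt_pow 2 (1 : ℝ)).mul_const (L (x, y))
  refine h2.unique (h3.congr_of_eventuallyEq ?_)
  filter_upwards [lt_mem_nhds (zero_lt_one' ℝ)] with a ha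
  exact h.homogeneous x hz.1 y a ha

/-- Derivative of `fderiv_smul` at a = 1. The term with (0, v) comes from the factor a in (u, av).
-/
theorem euler_fderiv (h : IsLocalFinsler Ω L) {z : Coord n × Coord n} (hz : z ∈ slit Ω)
    (u v : Coord n) :
    fderiv ℝ (fderiv ℝ L) z (0, z.2) (u, v) = 2 * fderiv ℝ L z (u, v) - fderiv ℝ L z (0, v) := by
  obtain ⟨x, y⟩ := z
  have h1 : HasDerivAt (fun a : ℝ => (x, a • y)) (0, y) 1 := by
    simpa using (hasDerivAt_const (1 : ℝ) x).prodMk ((hasDerivAt_id (1 : ℝ)).smul_const y)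
  have h1' : HasDerivAt (fun a : ℝ => (u, a • v)) (0, v) 1 := by
    simpa using (hasDerivAt_const (1 : ℝ) u).prodMk ((hasDerivAt_id (1 : ℝ)).smul_const v)
  have h2 : HasDerivAt (fun a : ℝ => fderiv ℝ L (x, a • y))
      (fderiv ℝ (fderiv ℝ L) (x, y) (0, y)) 1 :=
    HasFDerivAt.comp_hasDerivAt_of_eq (1 : ℝ) (h.hasFDerivAt_fderiv hz) h1 (by simp)
  have h2' := h2.clm_apply h1'
  have h3 : HasDerivAt (fun a : ℝ => a ^ 2 * fderiv ℝ L (x, y) (u, v))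
      (2 * fderiv ℝ L (x, y) (u, v)) 1 := by
    simpa using (hasDerivAt_pow 2 (1 : ℝ)).mul_const (fderiv ℝ L (x, y) (u, v))
  have h4 := h2'.unique (h3.congr_of_eventuallyEq (by
    filter_upwards [lt_mem_nhds (zero_lt_one' ℝ)] with a ha
    exact h.fderiv_smul hz ha u v))
  simp only [one_smul] at h4
  linarith

theorem localMetric_apply (h : IsLocalFinsler Ω L) {z : Coord n × Coord n} (hz : z ∈ slit Ω)
    (i j : Fin n) : localMetric L z i j = 1 / 2 * fderiv ℝ (fderiv ℝ L) z
      (0, EuclideanSpace.single i 1) (0, EuclideanSpace.single j 1) := by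
  have := (h.hasFDerivAt_fderiv_apply hz (0, EuclideanSpace.single j 1)).fderiv
  simp only [localMetric, Matrix.of_apply, dY]
  unfold dY
  rw [this, ContinuousLinearMap.flip_apply]

theorem smooth_localMetric (h : IsLocalFinsler Ω L) (i j : Fin n) :
    ContDiffOn ℝ ∞ (fun z => localMetric L z i j) (slit Ω) := by
  refine ContDiffOn.congr (f := fun z => 1 / 2 * fderiv ℝ (fderiv ℝ L) z
      (0, EuclideanSpace.single i 1) (0, EuclideanSpace.single j 1)) ?_
    fun z hz => h.localMetric_apply hz i j
  exact contDiffOn_const.mul (((h.smooth_fderiv.fderiv_of_isOpen h.isOpen_slit (by simp)).clm_apply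
    contDiffOn_const).clm_apply contDiffOn_const)

theorem sum_snd {G : Type*} [NormedAddCommGroup G] [NormedSpace ℝ G]
    (A : Coord n × Coord n →L[ℝ] G) (y : Coord n) :
    ∑ j, y j • A (0, EuclideanSpace.single j 1) = A (0, y) :=
  (clm_apply_eq_sum (A.comp (ContinuousLinearMap.inr ℝ _ _)) y).symm

theorem sum_fst {G : Type*} [NormedAddCommGroup G] [NormedSpace ℝ G]
    (A : Coord n × Coord n →L[ℝ] G) (y : Coord n) :
    ∑ j, y j • A (EuclideanSpace.single j 1, 0) = A (y, 0) :=
  (clm_apply_eq_sum (A.comp (ContinuousLinearMap.inl ℝ _ _)) y).symm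

theorem sum_localMetric (h : IsLocalFinsler Ω L) {z : Coord n × Coord n} (hz : z ∈ slit Ω)
    (j : Fin n) (v : Coord n) : ∑ i, localMetric L z j i * v i =
      1 / 2 * fderiv ℝ (fderiv ℝ L) z (0, EuclideanSpace.single j 1) (0, v) := by
  rw [← sum_snd _ v, Finset.mul_sum]
  refine Finset.sum_congr rfl fun i _ => ?_
  rw [h.localMetric_apply hz, smul_eq_mul]
  ring

theorem localMetric_symm (h : IsLocalFinsler Ω L) {z : Coord n × Coord n} (hz : z ∈ slit Ω)
    (i j : Fin n) : localMetric L z i j = localMetric L z j i := by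
  rw [h.localMetric_apply hz, h.localMetric_apply hz, h.symm hz]

/-- A null vector of the matrix would be isotropic for the positive definite form D²L on vertical
vectors. -/
theorem det_localMetric_ne_zero (h : IsLocalFinsler Ω L) {z : Coord n × Coord n}
    (hz : z ∈ slit Ω) : (localMetric L z).det ≠ 0 := by
  intro h0
  obtain ⟨v, hv, hv0⟩ := Matrix.exists_mulVec_eq_zero_iff.2 h0
  have hu : (WithLp.toLp 2 v : Coord n) ≠ 0 := fun h => hv (by
    have := congrArg (WithLp.ofLp) h
    simpa using this)
  have hpos := h.pos' hz hu
  have : ∀ j, fderiv ℝ (fderiv ℝ L) z (0, EuclideanSpace.single j 1) (0, WithLp.toLp 2 v) = 0 := by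
    intro j
    have h1 := h.sum_localMetric hz j (WithLp.toLp 2 v)
    have h2 : ∑ i, localMetric L z j i * v i = 0 := congrFun hv0 j
    simp only [h2] at h1
    linarith
  rw [h.symm hz, ← sum_snd] at hpos
  simp only [fun j => h.symm hz (0, WithLp.toLp 2 v) (0, EuclideanSpace.single j 1), this,
    smul_zero, Finset.sum_const_zero, lt_irrefl] at hpos

theorem smooth_localSpray (h : IsLocalFinsler Ω L) (i : Fin n) :
    ContDiffOn ℝ ∞ (localSpray L i) (slit Ω) := by
  have hdX : ∀ k j l, ContDiffOn ℝ ∞ (fun z => dX k (fun w => localMetric L w j l) z) (slit Ω) :=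
    fun k j l => ((h.smooth_localMetric j l).fderiv_of_isOpen h.isOpen_slit (by simp)).clm_apply
      contDiffOn_const
  have hco : ∀ j : Fin n, ContDiffOn ℝ ∞ (fun z : Coord n × Coord n => z.2 j) (slit Ω) :=
    fun j => by fun_prop
  unfold localSpray
  refine contDiffOn_const.mul (ContDiffOn.sum fun j _ => ContDiffOn.sum fun k _ =>
    ContDiffOn.sum fun l _ => ?_)
  exact (((contDiffOn_matrix_inv h.smooth_localMetric
    (fun z hz => h.det_localMetric_ne_zero hz) i l).mul
    ((contDiffOn_const.mul (hdX k j l)).sub (hdX l j k))).mul (hco j)).mul (hco k)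

theorem smooth_sprayVector (h : IsLocalFinsler Ω L) :
    ContDiffOn ℝ ∞ (sprayVector L) (slit Ω) := by
  rw [contDiffOn_euclidean]
  exact fun i => h.smooth_localSpray i

/-- By Euler's relation, g_{jl} yʲ = ½ ∂L/∂yˡ near z. Evaluating the derivative on (eₖ, 0) removes
the term in which yʲ is differentiated. -/
theorem dX_sum_localMetric (h : IsLocalFinsler Ω L) {z : Coord n × Coord n} (hz : z ∈ slit Ω)
    (k l : Fin n) : ∑ j, dX k (fun w => localMetric L w j l) z * z.2 j =
      1 / 2 * fderiv ℝ (fderiv ℝ L) z (EuclideanSpace.single k 1, 0)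
        (0, EuclideanSpace.single l 1) := by
  have hg : ∀ j, HasFDerivAt (fun w => localMetric L w j l)
      (fderiv ℝ (fun w => localMetric L w j l) z) z := fun j =>
    (((h.smooth_localMetric j l).contDiffAt (h.mem_nhds hz)).differentiableAt
      (by simp)).hasFDerivAt
  have hy : ∀ j, HasFDerivAt (fun w : Coord n × Coord n => w.2 j)
      ((EuclideanSpace.proj j).comp (ContinuousLinearMap.snd ℝ (Coord n) (Coord n))) z := fun j =>
    ((EuclideanSpace.proj j).comp (ContinuousLinearMap.snd ℝ (Coord n) (Coord n))).hasFDerivAt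
  have h1 := HasFDerivAt.fun_sum (u := Finset.univ) fun j _ => (hg j).mul (hy j)
  have h2 := (h.hasFDerivAt_fderiv_apply hz (0, EuclideanSpace.single l 1)).const_mul (1 / 2)
  have h3 : (fun w => ∑ j, localMetric L w j l * w.2 j) =ᶠ[𝓝 z]
      fun w => 1 / 2 * fderiv ℝ L w (0, EuclideanSpace.single l 1) := by
    filter_upwards [h.mem_nhds hz] with w hw
    have h4 := h.sum_localMetric hw l w.2
    rw [h.symm hw, h.euler_fderiv hw] at h4
    rw [Finset.sum_congr rfl fun j _ => by rw [h.localMetric_symm hw j l], h4]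
    ring
  have h5 := congrArg (fun A : _ →L[ℝ] ℝ => A (EuclideanSpace.single k 1, 0))
    (h1.unique (h2.congr_of_eventuallyEq h3))
  simp only [sum_apply, add_apply,
    smul_apply, ContinuousLinearMap.comp_apply, ContinuousLinearMap.coe_snd',
    map_zero, mul_zero, zero_add, smul_eq_mul, ContinuousLinearMap.flip_apply] at h5
  rw [← h5]
  exact Finset.sum_congr rfl fun j _ => mul_comm _ _

/-- A second contraction with y; by `euler_fderiv`, D²L((0, y), (e_l, 0)) = 2 ∂L/∂xˡ. -/
theorem dX_sum_sum_localMetric (h : IsLocalFinsler Ω L) {z : Coord n × Coord n} (hz : z ∈ slit Ω)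
    (l : Fin n) : ∑ j, ∑ k, dX l (fun w => localMetric L w j k) z * z.2 j * z.2 k =
      fderiv ℝ L z (EuclideanSpace.single l 1, 0) := by
  rw [Finset.sum_comm]
  simp only [← Finset.sum_mul, h.dX_sum_localMetric hz]
  have := sum_snd ((fderiv ℝ (fderiv ℝ L) z).flip (EuclideanSpace.single l 1, 0)) z.2
  simp only [ContinuousLinearMap.flip_apply, h.euler_fderiv hz, smul_eq_mul] at this
  have h0 : fderiv ℝ L z (0, 0) = 0 := map_zero _
  rw [h0, sub_zero] at this
  have e : ∀ k : Fin n, 1 / 2 * fderiv ℝ (fderiv ℝ L) z (EuclideanSpace.single l 1, 0)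
      (0, EuclideanSpace.single k 1) * z.2 k = 1 / 2 * (z.2 k *
        fderiv ℝ (fderiv ℝ L) z (0, EuclideanSpace.single k 1) (EuclideanSpace.single l 1, 0)) :=
    fun k => by rw [h.symm hz]; ring
  simp only [e, ← Finset.mul_sum, this]
  ring

/-- The Euler–Lagrange equation satisfied by the spray `(y, -2 G)`. -/
theorem euler_lagrange (h : IsLocalFinsler Ω L) {z : Coord n × Coord n} (hz : z ∈ slit Ω)
    (w : Coord n) :
    fderiv ℝ (fderiv ℝ L) z (z.2, -(2 : ℝ) • sprayVector L z) (0, w) = fderiv ℝ L z (w, 0) := by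
  have basis : ∀ l, fderiv ℝ (fderiv ℝ L) z (z.2, -(2 : ℝ) • sprayVector L z)
      (0, EuclideanSpace.single l 1) = fderiv ℝ L z (EuclideanSpace.single l 1, 0) := by
    intro l
    -- The covector 4 g_{li} Gⁱ. By the two contraction lemmas its l-th component is D²L((y, 0), (0,
    -- e_l)) − ∂L/∂xˡ.
    let c : Fin n → ℝ := fun l => ∑ j, ∑ k, (2 * dX k (fun w => localMetric L w j l) z -
      dX l (fun w => localMetric L w j k) z) * z.2 j * z.2 k
    have hc : c l = fderiv ℝ (fderiv ℝ L) z (z.2, 0) (0, EuclideanSpace.single l 1) -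
        fderiv ℝ L z (EuclideanSpace.single l 1, 0) := by
      have h1 : ∑ j, ∑ k, 2 * dX k (fun w => localMetric L w j l) z * z.2 j * z.2 k =
          fderiv ℝ (fderiv ℝ L) z (z.2, 0) (0, EuclideanSpace.single l 1) := by
        rw [Finset.sum_comm]
        have := sum_fst ((fderiv ℝ (fderiv ℝ L) z).flip (0, EuclideanSpace.single l 1)) z.2
        simp only [ContinuousLinearMap.flip_apply, smul_eq_mul] at this
        rw [← this]
        refine Finset.sum_congr rfl fun k _ => ?_
        have e : ∑ j, 2 * dX k (fun w => localMetric L w j l) z * z.2 j * z.2 k =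
            2 * (∑ j, dX k (fun w => localMetric L w j l) z * z.2 j) * z.2 k := by
          rw [Finset.mul_sum, Finset.sum_mul]
          exact Finset.sum_congr rfl fun j _ => by ring
        rw [e, h.dX_sum_localMetric hz]
        ring
      rw [← h1, ← h.dX_sum_sum_localMetric hz l]
      simp only [c, sub_mul, Finset.sum_sub_distrib]
    have hG : ∀ i, 4 * sprayVector L z i = ∑ l, (localMetric L z)⁻¹ i l * c l := by
      intro i
      have : ∀ l, (localMetric L z)⁻¹ i l * c l = ∑ j, ∑ k, (localMetric L z)⁻¹ i l *
          (2 * dX k (fun w => localMetric L w j l) z - dX l (fun w => localMetric L w j k) z) *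
          z.2 j * z.2 k := fun l => by
        simp only [c, Finset.mul_sum, mul_assoc]
      simp only [this]
      rw [Finset.sum_comm]
      simp only [sprayVector, localSpray]
      rw [← mul_assoc]
      norm_num
      refine Finset.sum_congr rfl fun j _ => ?_
      rw [Finset.sum_comm]
    have hgG : ∑ i, localMetric L z l i * (4 * sprayVector L z i) = c l := by
      have h1 : (localMetric L z).mulVec ((localMetric L z)⁻¹.mulVec c) = c := by
        rw [Matrix.mulVec_mulVec, Matrix.mul_nonsing_inv _
          (isUnit_iff_ne_zero.2 (h.det_localMetric_ne_zero hz)), Matrix.one_mulVec]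
      have h2 : (localMetric L z)⁻¹.mulVec c = fun i => 4 * sprayVector L z i :=
        funext fun i => (hG i).symm
      rw [h2] at h1
      exact congrFun h1 l
    have h3 := h.sum_localMetric hz l (sprayVector L z)
    have h4 : ∑ i, localMetric L z l i * (4 * sprayVector L z i) =
        4 * ∑ i, localMetric L z l i * sprayVector L z i := by
      rw [Finset.mul_sum]
      exact Finset.sum_congr rfl fun i _ => by ring
    rw [h4, h3, hc, h.symm hz] at hgG
    have h5 : ((z.2, -(2 : ℝ) • sprayVector L z) : Coord n × Coord n) =
        (z.2, 0) - (2 : ℝ) • (0, sprayVector L z) := by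
      ext <;> simp
    rw [h5, map_sub, map_smul, sub_apply, smul_apply,
      smul_eq_mul]
    linarith
  rw [← sum_snd, ← sum_fst]
  exact Finset.sum_congr rfl fun l _ => by rw [basis]

/-- Two solutions would differ by a vertical u with D²L(u, u) = 0. With this characterisation the
homogeneity and the transformation law of the spray follow without the coordinate formula. -/
theorem eq_sprayVector (h : IsLocalFinsler Ω L) {z : Coord n × Coord n} (hz : z ∈ slit Ω)
    {g : Coord n} (hg : ∀ w : Coord n, fderiv ℝ (fderiv ℝ L) z (z.2, -(2 : ℝ) • g) (0, w) =
      fderiv ℝ L z (w, 0)) : g = sprayVector L z := by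
  by_contra hne
  have hu : sprayVector L z - g ≠ 0 := fun h0 => hne (sub_eq_zero.1 h0).symm
  have h1 := hg (sprayVector L z - g)
  rw [← h.euler_lagrange hz, ← sub_eq_zero, ← sub_apply, ← map_sub] at h1
  have h2 : ((z.2, -(2 : ℝ) • g) - (z.2, -(2 : ℝ) • sprayVector L z) : Coord n × Coord n) =
      (2 : ℝ) • (0, sprayVector L z - g) := by
    ext i
    · simp
    · simp; ring
  rw [h2, map_smul, smul_apply, smul_eq_mul] at h1
  have := h.pos' hz hu
  linarith

theorem sprayVector_smul (h : IsLocalFinsler Ω L) {x y : Coord n} (hz : (x, y) ∈ slit Ω) {a : ℝ}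
    (ha : 0 < a) : sprayVector L (x, a • y) = a ^ 2 • sprayVector L (x, y) := by
  refine (h.eq_sprayVector (smul_mem hz ha) fun w => ?_).symm
  have h1 : -(2 : ℝ) • a ^ 2 • sprayVector L (x, y) =
      a • a • (-(2 : ℝ) • sprayVector L (x, y)) := by
    simp only [smul_smul]; congr 1; ring
  rw [h1, h.fderiv_fderiv_smul hz ha]
  have h2 : ((a • y, a • -(2 : ℝ) • sprayVector L (x, y)) : Coord n × Coord n) =
      a • (y, -(2 : ℝ) • sprayVector L (x, y)) := rfl
  have h3 := h.fderiv_smul hz ha w 0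
  rw [smul_zero] at h3
  rw [h2, map_smul, smul_apply, h.euler_lagrange hz w, h3, smul_eq_mul]
  ring

theorem hasFDerivAt_sprayVector (h : IsLocalFinsler Ω L) {z : Coord n × Coord n}
    (hz : z ∈ slit Ω) : HasFDerivAt (sprayVector L) (fderiv ℝ (sprayVector L) z) z :=
  ((h.smooth_sprayVector.contDiffAt (h.mem_nhds hz)).differentiableAt (by simp)).hasFDerivAt

/-- As a fibre derivative of the spray, the connection is visibly linear in `a` and smooth. -/
theorem localConn_eq (h : IsLocalFinsler Ω L) {z : Coord n × Coord n} (hz : z ∈ slit Ω)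
    (a : Coord n) : localConn L z a = fderiv ℝ (sprayVector L) z (0, a) := by
  ext i
  have h1 : HasFDerivAt (localSpray L i)
      ((EuclideanSpace.proj i).comp (fderiv ℝ (sprayVector L) z)) z :=
    (EuclideanSpace.proj i : Coord n →L[ℝ] ℝ).hasFDerivAt.comp z (h.hasFDerivAt_sprayVector hz)
  rw [← sum_snd]
  simp only [localConn, dY, h1.fderiv]
  simp [mul_comm]

theorem smooth_localConn (h : IsLocalFinsler Ω L) :
    ContDiffOn ℝ ∞ (fun p : (Coord n × Coord n) × Coord n => localConn L p.1 p.2)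
      (slit Ω ×ˢ univ) := by
  refine ContDiffOn.congr (f := fun p => fderiv ℝ (sprayVector L) p.1 (0, p.2)) ?_
    fun p hp => h.localConn_eq hp.1 p.2
  refine ContDiffOn.clm_apply ?_ (by fun_prop)
  exact (h.smooth_sprayVector.fderiv_of_isOpen h.isOpen_slit (by simp)).comp contDiffOn_fst
    fun p hp => hp.1

theorem smooth_localConn_const (h : IsLocalFinsler Ω L) (a : Coord n) :
    ContDiffOn ℝ ∞ (fun z => localConn L z a) (slit Ω) :=
  h.smooth_localConn.comp (contDiff_id.prodMk contDiff_const).contDiffOn fun _ hz => ⟨hz, mem_univ _⟩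

theorem localConn_smul (h : IsLocalFinsler Ω L) {z : Coord n × Coord n} (hz : z ∈ slit Ω)
    (c : ℝ) (a : Coord n) : localConn L z (c • a) = c • localConn L z a := by
  rw [h.localConn_eq hz, h.localConn_eq hz, ← map_smul]
  simp

theorem localConn_zero (z : Coord n × Coord n) : localConn L z 0 = 0 := by
  ext i
  simp [localConn]

theorem localConn_dilation (h : IsLocalFinsler Ω L) {x y : Coord n} (hz : (x, y) ∈ slit Ω) {a : ℝ}
    (ha : 0 < a) (b : Coord n) : localConn L (x, a • y) b = a • localConn L (x, y) b := by
  rw [h.localConn_eq hz, h.localConn_eq (smul_mem hz ha)]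
  have h1 : HasFDerivAt (fun z => sprayVector L (fibreDilation n a z))
      ((fderiv ℝ (sprayVector L) (x, a • y)).comp (fibreDilation n a)) (x, y) :=
    HasFDerivAt.comp (x, y) (g := sprayVector L) (h.hasFDerivAt_sprayVector (smul_mem hz ha))
      (fibreDilation n a).hasFDerivAt
  have h2 : HasFDerivAt (fun z => a ^ 2 • sprayVector L z) (a ^ 2 • fderiv ℝ (sprayVector L) (x, y))
      (x, y) := (h.hasFDerivAt_sprayVector hz).const_smul (a ^ 2)
  have h3 : (fun z => sprayVector L (fibreDilation n a z)) =ᶠ[𝓝 (x, y)]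
      fun z => a ^ 2 • sprayVector L z := by
    filter_upwards [h.mem_nhds hz] with z hz
    exact h.sprayVector_smul (x := z.1) (y := z.2) hz ha
  have h4 := congrArg (fun A : _ →L[ℝ] Coord n => A (0, a⁻¹ • b))
    (h1.unique (h2.congr_of_eventuallyEq h3))
  simp only [ContinuousLinearMap.comp_apply, fibreDilation_apply, smul_apply,
    smul_smul, mul_inv_cancel₀ ha.ne', one_smul] at h4
  have h5 : ((0 : Coord n), a⁻¹ • b) = a⁻¹ • ((0 : Coord n), b) := by simp
  rw [h4, h5, map_smul, smul_smul]
  congr 1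
  field_simp

/-- The norm is constant along horizontal directions. -/
theorem fderiv_localHor (h : IsLocalFinsler Ω L) {z : Coord n × Coord n} (hz : z ∈ slit Ω)
    (w : Coord n) : fderiv ℝ L z (localHor L z w) = 0 := by
  -- L is constant along the spray: take w = y in the Euler–Lagrange equation and use Euler's
  -- relations.
  have hS : ∀ z ∈ slit Ω, fderiv ℝ L z (z.2, -(2 : ℝ) • sprayVector L z) = 0 := by
    intro z hz
    have split : ∀ A : Coord n × Coord n →L[ℝ] ℝ, A (z.2, -(2 : ℝ) • sprayVector L z) =
        A (z.2, 0) - 2 * A (0, sprayVector L z) := fun A => by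
      have h5 : ((z.2, -(2 : ℝ) • sprayVector L z) : Coord n × Coord n) =
          (z.2, 0) - (2 : ℝ) • (0, sprayVector L z) := by
        ext <;> simp
      rw [h5, map_sub, map_smul, smul_eq_mul]
    have h1 := h.euler_lagrange hz z.2
    rw [h.symm hz, split, h.euler_fderiv hz, h.euler_fderiv hz] at h1
    have h0 : fderiv ℝ L z (0, 0) = 0 := map_zero _
    rw [split]
    linarith
  -- Differentiate dL(y, −2G) = 0 in the vertical direction w: D²L((0, w), (y, −2G)) + dL(w, −2Nw) =
  -- 0. The first term is dL(w, 0) by Euler–Lagrange, so the sum is 2 dL(w, −Nw).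
  have h1 : HasFDerivAt (fun z : Coord n × Coord n => (z.2, -(2 : ℝ) • sprayVector L z))
      ((ContinuousLinearMap.snd ℝ _ _).prod (-(2 : ℝ) • fderiv ℝ (sprayVector L) z)) z :=
    hasFDerivAt_snd.prodMk ((h.hasFDerivAt_sprayVector hz).fun_const_smul _)
  have h2 := (h.hasFDerivAt_fderiv hz).clm_apply h1
  have h3 := h2.unique ((hasFDerivAt_const (0 : ℝ) z).congr_of_eventuallyEq
    (by filter_upwards [h.mem_nhds hz] with z hz using hS z hz))
  have h4 := congrArg (fun A : _ →L[ℝ] ℝ => A (0, w)) h3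
  simp only [add_apply, ContinuousLinearMap.comp_apply,
    ContinuousLinearMap.flip_apply, ContinuousLinearMap.prod_apply, ContinuousLinearMap.coe_snd',
    smul_apply, zero_apply] at h4
  rw [h.symm hz (0, w), h.euler_lagrange hz, ← h.localConn_eq hz] at h4
  have h5 : fderiv ℝ L z (w, -(2 : ℝ) • localConn L z w) + fderiv ℝ L z (w, 0) =
      2 * fderiv ℝ L z (localHor L z w) := by
    rw [← map_add, ← smul_eq_mul, ← map_smul]
    congr 1
    ext i
    · simp [localHor]; ring
    · simp [localHor]
  linarith

end IsLocalFinsler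

end LocalFinsler

/-! ### Behaviour of spray, connection and curvature under changes of coordinates. -/

section Transformation

variable {n : ℕ} {Ω Ω' : Set (Coord n)} {L L' : Coord n × Coord n → ℝ}

/-- The map `(x, y) ↦ (φ x, φ'(x) y)`. -/
def tangentLift (φ : Coord n → Coord n) (z : Coord n × Coord n) : Coord n × Coord n :=
  (φ z.1, fderiv ℝ φ z.1 z.2)

/-- A smooth change of coordinates `φ : Ω → Ω'` that takes `L'` to `L`. -/
structure IsCoordChange (Ω Ω' : Set (Coord n)) (L L' : Coord n × Coord n → ℝ)
    (φ : Coord n → Coord n) : Prop where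
  smooth : ContDiffOn ℝ ∞ φ Ω
  mapsTo : MapsTo φ Ω Ω'
  injective : ∀ x ∈ Ω, Function.Injective (fderiv ℝ φ x)
  isometry : ∀ z ∈ slit Ω, L' (tangentLift φ z) = L z

namespace IsLocalFinsler

/-- Differentiating dL(aʰ) = 0 along bʰ gives D²L(bʰ, aʰ) = dL(0, D(Na)(bʰ)). The left side is
symmetric, so antisymmetrising in a, b leaves dL(0, R(aʰ, bʰ)) = 0. -/
theorem fderiv_localCurv (h : IsLocalFinsler Ω L) {z : Coord n × Coord n} (hz : z ∈ slit Ω)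
    (a b : Coord n) : fderiv ℝ L z (0, localCurv L z a b) = 0 := by
  have key : ∀ a b : Coord n, fderiv ℝ (fderiv ℝ L) z (localHor L z b) (localHor L z a) =
      fderiv ℝ L z (0, fderiv ℝ (fun w => localConn L w a) z (localHor L z b)) := by
    intro a b
    have hN : HasFDerivAt (fun w => localConn L w a) (fderiv ℝ (fun w => localConn L w a) z) z :=
      (((h.smooth_localConn_const a).contDiffAt (h.mem_nhds hz)).differentiableAt
        (by simp)).hasFDerivAt
    have h1 : HasFDerivAt (fun w => localHor L w a) _ z := (hasFDerivAt_const a z).prodMk hN.neg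
    have h2 := (h.hasFDerivAt_fderiv hz).clm_apply h1
    have h3 := h2.unique ((hasFDerivAt_const (0 : ℝ) z).congr_of_eventuallyEq
      (by filter_upwards [h.mem_nhds hz] with z hz using h.fderiv_localHor hz a))
    have h4 := congrArg (fun A : _ →L[ℝ] ℝ => A (localHor L z b)) h3
    simp only [add_apply, ContinuousLinearMap.comp_apply,
      ContinuousLinearMap.flip_apply, ContinuousLinearMap.prod_apply, zero_apply,
      neg_apply] at h4
    have h5 : ∀ v : Coord n, ((0 : Coord n), -v) = -((0 : Coord n), v) := fun v => by simp
    rw [h5, map_neg] at h4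
    linarith
  have h6 : ((0 : Coord n), localCurv L z a b) =
      (0, fderiv ℝ (fun w => localConn L w a) z (localHor L z b)) -
      (0, fderiv ℝ (fun w => localConn L w b) z (localHor L z a)) := by
    ext <;> simp [localCurv]
  rw [h6, map_sub, ← key, ← key, h.symm hz, sub_self]

end IsLocalFinsler

namespace IsCoordChange

variable {φ : Coord n → Coord n}

theorem mapsTo_slit (hφ : IsCoordChange Ω Ω' L L' φ) : MapsTo (tangentLift φ) (slit Ω) (slit Ω') :=
  fun z hz => ⟨hφ.mapsTo hz.1, fun h0 => hz.2 (hφ.injective z.1 hz.1 (by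
    simpa [tangentLift] using h0))⟩

theorem surjective (hφ : IsCoordChange Ω Ω' L L' φ) {x : Coord n} (hx : x ∈ Ω) :
    Function.Surjective (fderiv ℝ φ x) :=
  LinearMap.injective_iff_surjective.1 (hφ.injective x hx)

variable (hφ : IsCoordChange Ω Ω' L L' φ) (h : IsLocalFinsler Ω L) (h' : IsLocalFinsler Ω' L')
include hφ h

theorem hasFDerivAt_fderiv {x : Coord n} (hx : x ∈ Ω) :
    HasFDerivAt (fderiv ℝ φ) (fderiv ℝ (fderiv ℝ φ) x) x :=
  (((hφ.smooth.fderiv_of_isOpen (m := ∞) h.isOpen (by simp)).contDiffAt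
    (h.isOpen.mem_nhds hx)).differentiableAt (by simp)).hasFDerivAt

theorem hasFDerivAt_fderiv_fderiv {x : Coord n} (hx : x ∈ Ω) :
    HasFDerivAt (fderiv ℝ (fderiv ℝ φ)) (fderiv ℝ (fderiv ℝ (fderiv ℝ φ)) x) x :=
  ((((hφ.smooth.fderiv_of_isOpen (m := ∞) h.isOpen (by simp)).fderiv_of_isOpen (m := ∞) h.isOpen
    (by simp)).contDiffAt (h.isOpen.mem_nhds hx)).differentiableAt (by simp)).hasFDerivAt

theorem symm₂ {x : Coord n} (hx : x ∈ Ω) (a b : Coord n) :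
    fderiv ℝ (fderiv ℝ φ) x a b = fderiv ℝ (fderiv ℝ φ) x b a :=
  ((hφ.smooth.contDiffAt (h.isOpen.mem_nhds hx)).isSymmSndFDerivAt
    IsLocalFinsler.two_le_infty) a b

theorem symm₃ {x : Coord n} (hx : x ∈ Ω) (a b : Coord n) :
    fderiv ℝ (fderiv ℝ (fderiv ℝ φ)) x a b = fderiv ℝ (fderiv ℝ (fderiv ℝ φ)) x b a :=
  (((hφ.smooth.fderiv_of_isOpen (m := ∞) h.isOpen (by simp)).contDiffAt
    (h.isOpen.mem_nhds hx)).isSymmSndFDerivAt IsLocalFinsler.two_le_infty) a b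

theorem hasFDerivAt_tangentLift {z : Coord n × Coord n} (hz : z.1 ∈ Ω) :
    HasFDerivAt (tangentLift φ) (((fderiv ℝ φ z.1).comp (ContinuousLinearMap.fst ℝ (Coord n) (Coord n))).prod
      ((fderiv ℝ φ z.1).comp (ContinuousLinearMap.snd ℝ (Coord n) (Coord n)) +
        ((fderiv ℝ (fderiv ℝ φ) z.1).comp
          (ContinuousLinearMap.fst ℝ (Coord n) (Coord n))).flip z.2)) z := by
  have h1 : HasFDerivAt φ (fderiv ℝ φ z.1) z.1 :=
    ((hφ.smooth.contDiffAt (h.isOpen.mem_nhds hz)).differentiableAt (by simp)).hasFDerivAt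
  have h2 : HasFDerivAt (fun z : Coord n × Coord n => φ z.1) _ z :=
    HasFDerivAt.comp z (g := φ) h1 (hasFDerivAt_fst (𝕜 := ℝ) (E := Coord n) (F := Coord n))
  have h3 : HasFDerivAt (fun z : Coord n × Coord n => fderiv ℝ φ z.1) _ z :=
    HasFDerivAt.comp z (g := fderiv ℝ φ) (hφ.hasFDerivAt_fderiv h hz) (hasFDerivAt_fst (𝕜 := ℝ) (E := Coord n) (F := Coord n))
  exact h2.prodMk (h3.clm_apply hasFDerivAt_snd)

theorem fderiv_tangentLift {z : Coord n × Coord n} (hz : z.1 ∈ Ω) (A : Coord n × Coord n) :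
    fderiv ℝ (tangentLift φ) z A =
      (fderiv ℝ φ z.1 A.1, fderiv ℝ φ z.1 A.2 + fderiv ℝ (fderiv ℝ φ) z.1 A.1 z.2) := by
  rw [(hφ.hasFDerivAt_tangentLift h hz).fderiv]
  rfl

include h'

theorem fderiv_eq {z : Coord n × Coord n} (hz : z ∈ slit Ω) (A : Coord n × Coord n) :
    fderiv ℝ L z A = fderiv ℝ L' (tangentLift φ z) (fderiv ℝ (tangentLift φ) z A) := by
  have h1 := (h'.hasFDerivAt (hφ.mapsTo_slit hz)).comp z
    (hφ.hasFDerivAt_tangentLift h hz.1).differentiableAt.hasFDerivAt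
  have h2 : HasFDerivAt (L' ∘ tangentLift φ) (fderiv ℝ L z) z :=
    (h.hasFDerivAt hz).congr_of_eventuallyEq
      (by filter_upwards [h.mem_nhds hz] with z hz using hφ.isometry z hz)
  rw [h2.unique h1]
  rfl

/-- The transformation law of the spray. -/
theorem sprayVector_tangentLift {z : Coord n × Coord n} (hz : z ∈ slit Ω) :
    sprayVector L' (tangentLift φ z) = fderiv ℝ φ z.1 (sprayVector L z) -
      (1 / 2 : ℝ) • fderiv ℝ (fderiv ℝ φ) z.1 z.2 z.2 := by
  -- The right-hand side is tested in the Euler–Lagrange equation of L'; since φ'(x) is surjective,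
  -- test vectors φ'(x)w suffice.
  refine (h'.eq_sprayVector (hφ.mapsTo_slit hz) fun w' => ?_).symm
  obtain ⟨w, rfl⟩ := hφ.surjective hz.1 w'
  have hp : (fun z => fderiv ℝ L z (0, w)) =ᶠ[𝓝 z]
      fun z => fderiv ℝ L' (tangentLift φ z) (0, fderiv ℝ φ z.1 w) := by
    filter_upwards [h.mem_nhds hz] with z hz
    rw [hφ.fderiv_eq h h' hz, hφ.fderiv_tangentLift h hz.1]
    simp
  have h1 : HasFDerivAt (fun z => fderiv ℝ L' (tangentLift φ z)) _ z :=
    (h'.hasFDerivAt_fderiv (hφ.mapsTo_slit hz)).comp z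
      (hφ.hasFDerivAt_tangentLift h hz.1).differentiableAt.hasFDerivAt
  have h2 : HasFDerivAt (fun z : Coord n × Coord n => fderiv ℝ φ z.1 w) _ z :=
    (HasFDerivAt.comp z (g := fderiv ℝ φ) (hφ.hasFDerivAt_fderiv h hz.1)
      (hasFDerivAt_fst (𝕜 := ℝ) (E := Coord n) (F := Coord n))).clm_apply (hasFDerivAt_const w z)
  have h3 := h1.clm_apply ((hasFDerivAt_const (0 : Coord n) z).prodMk h2)
  have h4 := (h.hasFDerivAt_fderiv_apply hz (0, w)).unique (h3.congr_of_eventuallyEq hp)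
  have h5 := congrArg (fun A : _ →L[ℝ] ℝ => A (z.2, -(2 : ℝ) • sprayVector L z)) h4
  simp only [add_apply, ContinuousLinearMap.comp_apply, ContinuousLinearMap.flip_apply,
    ContinuousLinearMap.prod_apply, zero_apply, h.euler_lagrange hz,
    hφ.fderiv_eq h h' hz (w, 0), hφ.fderiv_tangentLift h hz.1, map_zero, zero_add,
    ContinuousLinearMap.coe_fst', hφ.symm₂ h hz.1 w] at h5
  have h6 : ((fderiv ℝ φ z.1 w, fderiv ℝ (fderiv ℝ φ) z.1 z.2 w) : Coord n × Coord n) =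
      (fderiv ℝ φ z.1 w, 0) + (0, fderiv ℝ (fderiv ℝ φ) z.1 z.2 w) := by simp
  rw [h6, map_add] at h5
  have h7 : ((tangentLift φ z).2, -(2 : ℝ) • (fderiv ℝ φ z.1 (sprayVector L z) -
      (1 / 2 : ℝ) • fderiv ℝ (fderiv ℝ φ) z.1 z.2 z.2)) =
      (fderiv ℝ φ z.1 z.2, fderiv ℝ φ z.1 (-(2 : ℝ) • sprayVector L z) +
        fderiv ℝ (fderiv ℝ φ) z.1 z.2 z.2) := by
    refine Prod.ext rfl ?_
    simp only [map_smul, smul_sub, smul_smul]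
    norm_num
  rw [h7]
  linarith

/-- The transformation law of the connection. -/
theorem localConn_tangentLift {z : Coord n × Coord n} (hz : z ∈ slit Ω) (b : Coord n) :
    localConn L' (tangentLift φ z) (fderiv ℝ φ z.1 b) =
      fderiv ℝ φ z.1 (localConn L z b) - fderiv ℝ (fderiv ℝ φ) z.1 b z.2 := by
  have h1 := (h'.hasFDerivAt_sprayVector (hφ.mapsTo_slit hz)).comp z
    (hφ.hasFDerivAt_tangentLift h hz.1).differentiableAt.hasFDerivAt
  have h2 : HasFDerivAt (fun z : Coord n × Coord n => fderiv ℝ φ z.1) _ z :=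
    HasFDerivAt.comp z (g := fderiv ℝ φ) (hφ.hasFDerivAt_fderiv h hz.1)
      (hasFDerivAt_fst (𝕜 := ℝ) (E := Coord n) (F := Coord n))
  have h2' : HasFDerivAt (fun z : Coord n × Coord n => fderiv ℝ (fderiv ℝ φ) z.1) _ z :=
    HasFDerivAt.comp z (g := fderiv ℝ (fderiv ℝ φ)) (hφ.hasFDerivAt_fderiv_fderiv h hz.1)
      (hasFDerivAt_fst (𝕜 := ℝ) (E := Coord n) (F := Coord n))
  have h3 := (h2.clm_apply (h.hasFDerivAt_sprayVector hz)).sub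
    (((h2'.clm_apply hasFDerivAt_snd).clm_apply hasFDerivAt_snd).fun_const_smul (1 / 2 : ℝ))
  have h4 := h1.unique (h3.congr_of_eventuallyEq (by
    filter_upwards [h.mem_nhds hz] with z hz using hφ.sprayVector_tangentLift h h' hz))
  -- The vertical derivative of the spray law; by symmetry of φ'' the term ½ φ''(y, y) contributes
  -- φ''(b, y).
  have h5 := congrArg (fun A : _ →L[ℝ] Coord n => A (0, b)) h4
  simp only [add_apply, sub_apply, smul_apply, ContinuousLinearMap.comp_apply,
    ContinuousLinearMap.flip_apply, hφ.fderiv_tangentLift h hz.1, map_zero, add_zero,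
    zero_apply, ContinuousLinearMap.coe_fst', ContinuousLinearMap.coe_snd',
    ← h.localConn_eq hz, ← h'.localConn_eq (hφ.mapsTo_slit hz)] at h5
  rw [h5, hφ.symm₂ h hz.1 z.2 b, ← two_smul ℝ, smul_smul]
  norm_num

theorem localHor_tangentLift {z : Coord n × Coord n} (hz : z ∈ slit Ω) (b : Coord n) :
    localHor L' (tangentLift φ z) (fderiv ℝ φ z.1 b) =
      fderiv ℝ (tangentLift φ) z (localHor L z b) := by
  rw [hφ.fderiv_tangentLift h hz.1, localHor, hφ.localConn_tangentLift h h' hz]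
  simp only [localHor, map_neg]
  congr 1
  abel

/-- The transformation law of the curvature. -/
theorem localCurv_tangentLift {z : Coord n × Coord n} (hz : z ∈ slit Ω) (a b : Coord n) :
    localCurv L' (tangentLift φ z) (fderiv ℝ φ z.1 a) (fderiv ℝ φ z.1 b) =
      fderiv ℝ φ z.1 (localCurv L z a b) := by
  have h2 : HasFDerivAt (fun z : Coord n × Coord n => fderiv ℝ φ z.1) _ z :=
    HasFDerivAt.comp z (g := fderiv ℝ φ) (hφ.hasFDerivAt_fderiv h hz.1)
      (hasFDerivAt_fst (𝕜 := ℝ) (E := Coord n) (F := Coord n))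
  have h2' : HasFDerivAt (fun z : Coord n × Coord n => fderiv ℝ (fderiv ℝ φ) z.1) _ z :=
    HasFDerivAt.comp z (g := fderiv ℝ (fderiv ℝ φ)) (hφ.hasFDerivAt_fderiv_fderiv h hz.1)
      (hasFDerivAt_fst (𝕜 := ℝ) (E := Coord n) (F := Coord n))
  have hz' := hφ.mapsTo_slit hz
  have hsplit : ∀ (v : Coord n) (A : Coord n × Coord n),
      fderiv ℝ (fun p : (Coord n × Coord n) × Coord n => localConn L' p.1 p.2)
        (tangentLift φ z, v) (A, 0) = fderiv ℝ (fun w => localConn L' w v) (tangentLift φ z) A := by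
    intro v A
    have e1 : HasFDerivAt (fun p : (Coord n × Coord n) × Coord n => localConn L' p.1 p.2)
        (fderiv ℝ (fun p : (Coord n × Coord n) × Coord n => localConn L' p.1 p.2)
          (tangentLift φ z, v)) (tangentLift φ z, v) :=
      ((h'.smooth_localConn.contDiffAt ((h'.isOpen_slit.prod isOpen_univ).mem_nhds
        ⟨hz', mem_univ _⟩)).differentiableAt (by simp)).hasFDerivAt
    have e2 : HasFDerivAt (fun w => localConn L' w v) _ (tangentLift φ z) :=
      HasFDerivAt.comp (tangentLift φ z)
        (g := fun p : (Coord n × Coord n) × Coord n => localConn L' p.1 p.2) e1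
        (hasFDerivAt_prodMk_left (𝕜 := ℝ) (tangentLift φ z) v)
    rw [e2.fderiv]
    rfl
  have hsplit' : ∀ (v c : Coord n),
      fderiv ℝ (fun p : (Coord n × Coord n) × Coord n => localConn L' p.1 p.2)
        (tangentLift φ z, v) (0, c) = localConn L' (tangentLift φ z) c := by
    intro v c
    have e1 : HasFDerivAt (fun p : (Coord n × Coord n) × Coord n => localConn L' p.1 p.2)
        (fderiv ℝ (fun p : (Coord n × Coord n) × Coord n => localConn L' p.1 p.2)
          (tangentLift φ z, v)) (tangentLift φ z, v) :=
      ((h'.smooth_localConn.contDiffAt ((h'.isOpen_slit.prod isOpen_univ).mem_nhds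
        ⟨hz', mem_univ _⟩)).differentiableAt (by simp)).hasFDerivAt
    have e2 := HasFDerivAt.comp v
        (g := fun p : (Coord n × Coord n) × Coord n => localConn L' p.1 p.2) e1
        (hasFDerivAt_prodMk_right (𝕜 := ℝ) (tangentLift φ z) v)
    have e3 : HasFDerivAt ((fun p : (Coord n × Coord n) × Coord n => localConn L' p.1 p.2) ∘
        fun y => (tangentLift φ z, y))
        ((fderiv ℝ (sprayVector L') (tangentLift φ z)).comp (ContinuousLinearMap.inr ℝ _ _)) v := by
      refine ((fderiv ℝ (sprayVector L') (tangentLift φ z)).comp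
        (ContinuousLinearMap.inr ℝ _ _)).hasFDerivAt.congr_of_eventuallyEq ?_
      filter_upwards with v
      exact h'.localConn_eq hz' v
    have e4 := congrArg (fun A : _ →L[ℝ] Coord n => A c) (e2.unique e3)
    rw [h'.localConn_eq hz' c]
    exact e4
  -- The connection law for a, differentiated along bʰ. The terms N'(φ''(b, a)), φ'''(b, a, y) and
  -- φ''(b, Na) + φ''(a, Nb) are symmetric in a and b, so they cancel in the curvature.
  have key : ∀ a b : Coord n,
      fderiv ℝ (fun w => localConn L' w (fderiv ℝ φ z.1 a)) (tangentLift φ z)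
        (localHor L' (tangentLift φ z) (fderiv ℝ φ z.1 b)) +
        localConn L' (tangentLift φ z) (fderiv ℝ (fderiv ℝ φ) z.1 b a) =
      fderiv ℝ φ z.1 (fderiv ℝ (fun w => localConn L w a) z (localHor L z b)) +
        fderiv ℝ (fderiv ℝ φ) z.1 b (localConn L z a) -
        (fderiv ℝ (fderiv ℝ (fderiv ℝ φ)) z.1 b a z.2 -
          fderiv ℝ (fderiv ℝ φ) z.1 a (localConn L z b)) := by
    intro a b
    have hN : HasFDerivAt (fun w => localConn L w a) (fderiv ℝ (fun w => localConn L w a) z) z :=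
      (((h.smooth_localConn_const a).contDiffAt (h.mem_nhds hz)).differentiableAt
        (by simp)).hasFDerivAt
    have e1 : HasFDerivAt (fun p : (Coord n × Coord n) × Coord n => localConn L' p.1 p.2)
        (fderiv ℝ (fun p : (Coord n × Coord n) × Coord n => localConn L' p.1 p.2)
          (tangentLift φ z, fderiv ℝ φ z.1 a)) (tangentLift φ z, fderiv ℝ φ z.1 a) :=
      ((h'.smooth_localConn.contDiffAt ((h'.isOpen_slit.prod isOpen_univ).mem_nhds
        ⟨hz', mem_univ _⟩)).differentiableAt (by simp)).hasFDerivAt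
    have l1 := HasFDerivAt.comp z
        (g := fun p : (Coord n × Coord n) × Coord n => localConn L' p.1 p.2)
        (f := fun z => (tangentLift φ z, fderiv ℝ φ z.1 a)) e1
        ((hφ.hasFDerivAt_tangentLift h hz.1).differentiableAt.hasFDerivAt.prodMk
          (h2.clm_apply (hasFDerivAt_const a z)))
    have l2 := (h2.clm_apply hN).sub
      ((h2'.clm_apply (hasFDerivAt_const a z)).clm_apply hasFDerivAt_snd)
    have l3 := l1.unique (l2.congr_of_eventuallyEq (by
      filter_upwards [h.mem_nhds hz] with z hz using hφ.localConn_tangentLift h h' hz a))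
    have l4 := congrArg (fun A : _ →L[ℝ] Coord n => A (localHor L z b)) l3
    simp only [add_apply, sub_apply, ContinuousLinearMap.comp_apply,
      ContinuousLinearMap.flip_apply, ContinuousLinearMap.prod_apply, map_zero, zero_add,
      zero_apply, ContinuousLinearMap.coe_fst', ContinuousLinearMap.coe_snd',
      ← hφ.localHor_tangentLift h h' hz] at l4
    have hs : ∀ (A : Coord n × Coord n) (c : Coord n), (A, c) = (A, 0) + (0, c) :=
      fun A c => by simp
    rw [hs (localHor L' _ _), map_add, hsplit, hsplit'] at l4
    rw [show (localHor L z b).1 = b from rfl, show (localHor L z b).2 = -localConn L z b from rfl,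
      map_neg] at l4
    rw [l4]
    abel
  have k1 := key a b
  have k2 := key b a
  rw [hφ.symm₂ h hz.1 a b, hφ.symm₃ h hz.1 a b] at k2
  rw [localCurv, localCurv, map_sub]
  rw [← eq_sub_iff_add_eq] at k1 k2
  rw [k1, k2]
  abel

end IsCoordChange

end Transformation

/-! ### Parallel fields along coordinate segments. -/

section HorizontalSegments

variable {n : ℕ} {Ω : Set (Coord n)} {L : Coord n × Coord n → ℝ}

/-- `u` is a nonvanishing parallel field along the segment `s ↦ x + s a`, `0 ≤ s ≤ 1`. -/
structure IsHorizontalSegment (Ω : Set (Coord n)) (L : Coord n × Coord n → ℝ) (x a : Coord n)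
    (u : ℝ → Coord n) : Prop where
  mem : ∀ s ∈ Icc (0 : ℝ) 1, (x + s • a, u s) ∈ slit Ω
  hasDerivWithinAt : ∀ s ∈ Icc (0 : ℝ) 1,
    HasDerivWithinAt u (-localConn L (x + s • a, u s) a) (Icc 0 1) s

theorem exists_lipschitzOnWith_of_compact_of_contDiffOn {A B : Type*} [NormedAddCommGroup A]
    [NormedSpace ℝ A] [NormedAddCommGroup B] [NormedSpace ℝ B] {f : A → B} {O K : Set A}
    (hO : IsOpen O) (hf : ContDiffOn ℝ ∞ f O) (hK : IsCompact K) (hKO : K ⊆ O) :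
    ∃ C, LipschitzOnWith C f K := by
  refine LocallyLipschitzOn.exists_lipschitzOnWith_of_compact hK fun x hx => ?_
  obtain ⟨C, t, ht, hC⟩ := ((hf.contDiffAt (hO.mem_nhds (hKO hx))).of_le
    (by exact_mod_cast le_top)).exists_lipschitzOnWith (𝕂 := ℝ)
  exact ⟨C, t, mem_nhdsWithin_of_mem_nhds ht, hC⟩

namespace IsHorizontalSegment

variable {x a : Coord n} {u v : ℝ → Coord n}

theorem continuousOn (hu : IsHorizontalSegment Ω L x a u) : ContinuousOn u (Icc 0 1) :=
  fun s hs => (hu.hasDerivWithinAt s hs).continuousWithinAt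

/-- The two graphs form a compact subset of the domain, on which the right-hand side is Lipschitz.
ODE uniqueness is applied with the two-point sets {u s, v s} as state domains, so no tube around the
solutions is needed. -/
theorem eqOn (h : IsLocalFinsler Ω L) (hu : IsHorizontalSegment Ω L x a u)
    (hv : IsHorizontalSegment Ω L x a v) (h0 : u 0 = v 0) : EqOn u v (Icc 0 1) := by
  let j : ℝ × Coord n → Coord n × Coord n := fun q => (x + q.1 • a, q.2)
  have hj : ContDiff ℝ ∞ j := by fun_prop
  let O : Set (ℝ × Coord n) := j ⁻¹' slit Ω
  have hf : ContDiffOn ℝ ∞ (fun q => -localConn L (j q) a) O :=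
    ((h.smooth_localConn_const a).comp hj.contDiffOn (mapsTo_preimage _ _)).neg
  let K : Set (ℝ × Coord n) := (fun s => (s, u s)) '' Icc 0 1 ∪ (fun s => (s, v s)) '' Icc 0 1
  have hK : IsCompact K :=
    (isCompact_Icc.image_of_continuousOn (continuousOn_id.prodMk hu.continuousOn)).union
      (isCompact_Icc.image_of_continuousOn (continuousOn_id.prodMk hv.continuousOn))
  have hKO : K ⊆ O := by
    rintro _ (⟨s, hs, rfl⟩ | ⟨s, hs, rfl⟩)
    · exact hu.mem s hs
    · exact hv.mem s hs
  obtain ⟨C, hC⟩ := exists_lipschitzOnWith_of_compact_of_contDiffOn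
    (h.isOpen_slit.preimage hj.continuous) hf hK hKO
  have hIci : ∀ {w : ℝ → Coord n}, IsHorizontalSegment Ω L x a w → ∀ s ∈ Ico (0 : ℝ) 1,
      HasDerivWithinAt w (-localConn L (x + s • a, w s) a) (Ici s) s := fun hw s hs =>
    (hw.hasDerivWithinAt s (Ico_subset_Icc_self hs)).mono_of_mem_nhdsWithin
      (mem_of_superset (Icc_mem_nhdsGE hs.2) (Icc_subset_Icc_left hs.1))
  refine ODE_solution_unique_of_mem_Icc_right (v := fun s y => -localConn L (x + s • a, y) a)
    (s := fun s => {u s, v s}) (K := C) (fun s hs => ?_) hu.continuousOn (hIci hu)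
    (fun s _ => mem_insert _ _) hv.continuousOn (hIci hv) (fun s _ => mem_insert_of_mem _ rfl) h0
  have hs' := Ico_subset_Icc_self hs
  have hm : ∀ y ∈ ({u s, v s} : Set (Coord n)), (s, y) ∈ K := by
    rintro y (rfl | rfl)
    · exact Or.inl ⟨s, hs', rfl⟩
    · exact Or.inr ⟨s, hs', rfl⟩
  intro y hy z hz
  have := hC (hm y hy) (hm z hz)
  simp only [Prod.edist_eq, edist_self, max_eq_right, zero_le] at this
  exact this

theorem smul (h : IsLocalFinsler Ω L) (hu : IsHorizontalSegment Ω L x a u) {c : ℝ} (hc : 0 < c) :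
    IsHorizontalSegment Ω L x a fun s => c • u s := by
  refine ⟨fun s hs => IsLocalFinsler.smul_mem (hu.mem s hs) hc, fun s hs => ?_⟩
  rw [h.localConn_dilation (hu.mem s hs) hc, ← smul_neg]
  exact (hu.hasDerivWithinAt s hs).const_smul c

/-- The graph is a horizontal curve and dL annihilates horizontal vectors. -/
theorem norm_sq_eq (h : IsLocalFinsler Ω L) (hu : IsHorizontalSegment Ω L x a u) :
    L (x + a, u 1) = L (x, u 0) := by
  have hd : ∀ s ∈ Icc (0 : ℝ) 1, HasDerivWithinAt (fun s => L (x + s • a, u s)) 0 (Icc 0 1) s := by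
    intro s hs
    have h1 : HasDerivWithinAt (fun s : ℝ => x + s • a) a (Icc 0 1) s := by
      simpa using ((hasDerivAt_id s).smul_const a).const_add x |>.hasDerivWithinAt (s := Icc 0 1)
    have h2 := HasFDerivAt.comp_hasDerivWithinAt s (h.hasFDerivAt (hu.mem s hs))
      (h1.prodMk (hu.hasDerivWithinAt s hs))
    rw [show (a, -localConn L (x + s • a, u s) a) = localHor L (x + s • a, u s) a from rfl,
      h.fderiv_localHor (hu.mem s hs)] at h2
    exact h2
  have := constant_of_derivWithin_zero (f := fun s => L (x + s • a, u s)) (a := 0) (b := 1)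
    (fun s hs => (hd s hs).differentiableWithinAt)
    (fun s hs => (hd s (Ico_subset_Icc_self hs)).derivWithin
      (uniqueDiffOn_Icc zero_lt_one s (Ico_subset_Icc_self hs))) 1 (right_mem_Icc.2 zero_le_one)
  simpa using this

theorem reverse (h : IsLocalFinsler Ω L) (hu : IsHorizontalSegment Ω L x a u) :
    IsHorizontalSegment Ω L (x + a) (-a) fun s => u (1 - s) := by
  have e : ∀ s : ℝ, x + a + s • -a = x + (1 - s) • a := fun s => by
    rw [sub_smul, one_smul, smul_neg]; abel
  have hm : ∀ s ∈ Icc (0 : ℝ) 1, 1 - s ∈ Icc (0 : ℝ) 1 := fun s hs =>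
    ⟨by linarith [hs.2], by linarith [hs.1]⟩
  refine ⟨fun s hs => by rw [e]; exact hu.mem _ (hm s hs), fun s hs => ?_⟩
  have h1 : HasDerivWithinAt (fun s : ℝ => 1 - s) (-1) (Icc 0 1) s :=
    ((hasDerivAt_id s).const_sub 1).hasDerivWithinAt
  have h2 := HasDerivWithinAt.scomp s (hu.hasDerivWithinAt _ (hm s hs)) h1 hm
  rw [e, show -a = (-1 : ℝ) • a by simp, h.localConn_smul (hu.mem _ (hm s hs)), ← smul_neg]
  exact h2

/-- The initial part of a segment. -/
theorem initial (h : IsLocalFinsler Ω L) (hu : IsHorizontalSegment Ω L x a u) {c : ℝ}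
    (hc : c ∈ Icc (0 : ℝ) 1) : IsHorizontalSegment Ω L x (c • a) fun s => u (s * c) := by
  have hm : ∀ s ∈ Icc (0 : ℝ) 1, s * c ∈ Icc (0 : ℝ) 1 := fun s hs =>
    ⟨mul_nonneg hs.1 hc.1, mul_le_one₀ hs.2 hc.1 hc.2⟩
  refine ⟨fun s hs => by rw [smul_smul]; exact hu.mem _ (hm s hs), fun s hs => ?_⟩
  have h1 : HasDerivWithinAt (fun s : ℝ => s * c) c (Icc 0 1) s := by
    simpa using ((hasDerivAt_id s).mul_const c).hasDerivWithinAt (s := Icc 0 1)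
  have h2 := HasDerivWithinAt.scomp s (hu.hasDerivWithinAt _ (hm s hs)) h1 hm
  rw [smul_smul, h.localConn_smul (hu.mem _ (hm s hs)), ← smul_neg]
  exact h2

theorem constant (L : Coord n × Coord n → ℝ) {y : Coord n} (hz : (x, y) ∈ slit Ω) :
    IsHorizontalSegment Ω L x 0 fun _ => y := by
  refine ⟨fun s _ => by simpa using hz, fun s _ => ?_⟩
  rw [IsLocalFinsler.localConn_zero, neg_zero]
  exact hasDerivWithinAt_const s _ y

end IsHorizontalSegment

open Classical in
/-- Parallel transport along the segment from `x` to `x + a`. -/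
def segmentTransport (Ω : Set (Coord n)) (L : Coord n × Coord n → ℝ)
    (p : Coord n × Coord n × Coord n) : Coord n :=
  if h : ∃ u, IsHorizontalSegment Ω L p.1 p.2.1 u ∧ u 0 = p.2.2 then h.choose 1 else 0

theorem IsHorizontalSegment.segmentTransport_eq {x a : Coord n} {u : ℝ → Coord n}
    (h : IsLocalFinsler Ω L) (hu : IsHorizontalSegment Ω L x a u) :
    segmentTransport Ω L (x, a, u 0) = u 1 := by
  have hex : ∃ v, IsHorizontalSegment Ω L x a v ∧ v 0 = u 0 := ⟨u, hu, rfl⟩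
  rw [segmentTransport, dif_pos hex]
  exact hex.choose_spec.1.eqOn h hu hex.choose_spec.2 (right_mem_Icc.2 zero_le_one)

/-- A segment starting at cy exists exactly if one starting at y does, so both sides take the
default value 0 together. -/
theorem segmentTransport_smul (h : IsLocalFinsler Ω L) (x a y : Coord n) {c : ℝ} (hc : 0 < c) :
    segmentTransport Ω L (x, a, c • y) = c • segmentTransport Ω L (x, a, y) := by
  by_cases hex : ∃ u, IsHorizontalSegment Ω L x a u ∧ u 0 = y
  · obtain ⟨u, hu, rfl⟩ := hex
    rw [hu.segmentTransport_eq h]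
    exact (hu.smul h hc).segmentTransport_eq h
  · have hex' : ¬ ∃ u, IsHorizontalSegment Ω L x a u ∧ u 0 = c • y := by
      rintro ⟨u, hu, h0⟩
      refine hex ⟨_, hu.smul h (inv_pos.2 hc), ?_⟩
      simp only [h0, smul_smul, inv_mul_cancel₀ hc.ne', one_smul]
    rw [segmentTransport, dif_neg hex', segmentTransport, dif_neg hex, smul_zero]

/-- The connection at `z` as a continuous linear map. -/
def connMap (L : Coord n × Coord n → ℝ) (z : Coord n × Coord n) : Coord n →L[ℝ] Coord n :=
  (fderiv ℝ (sprayVector L) z).comp (ContinuousLinearMap.inr ℝ (Coord n) (Coord n))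

theorem IsLocalFinsler.connMap_apply (h : IsLocalFinsler Ω L) {z : Coord n × Coord n}
    (hz : z ∈ slit Ω) (a : Coord n) : connMap L z a = localConn L z a :=
  (h.localConn_eq hz a).symm

theorem IsLocalFinsler.smooth_connMap (h : IsLocalFinsler Ω L) :
    ContDiffOn ℝ ∞ (connMap L) (slit Ω) :=
  (h.smooth_sprayVector.fderiv_of_isOpen h.isOpen_slit (by simp)).clm_comp contDiffOn_const

/-- With (x, a) as parameter the equation u' = −N(x + sa, u)a is trivial at a = 0, which is what
`exists_smooth_solution` asks. N is replaced by a globally smooth extension G of its germ; for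
parameters near (x₀, 0) and initial values near y₀ the solution stays where G = N. -/
theorem exists_local_horizontalSegment (h : IsLocalFinsler Ω L) {x₀ y₀ : Coord n}
    (hz : (x₀, y₀) ∈ slit Ω) :
    ∃ P : (Coord n × Coord n) × Coord n → Coord n, ∀ᶠ p in 𝓝 (((x₀, 0), y₀) : (Coord n × Coord n) × Coord n),
      ContDiffAt ℝ ∞ P p ∧ ∃ u, IsHorizontalSegment Ω L p.1.1 p.1.2 u ∧ u 0 = p.2 ∧ u 1 = P p := by
  obtain ⟨G, hG, hGe⟩ := exists_contDiff_eventuallyEq h.isOpen_slit h.smooth_connMap hz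
  let w : ℝ × (Coord n × Coord n) × Coord n → Coord n := fun q =>
    -G (q.2.1.1 + q.1 • q.2.1.2, q.2.2) q.2.1.2
  have hw : ContDiff ℝ ∞ w := by
    refine ContDiff.neg (ContDiff.clm_apply (hG.comp ?_) ?_) <;> fun_prop
  obtain ⟨U, hU0, hUs, hUe⟩ := exists_smooth_solution w hw (x₀, 0) y₀ fun s y => by simp [w]
  refine ⟨fun p => U p ⟨1, right_mem_Icc.2 zero_le_one⟩, ?_⟩
  have hgood : ∀ᶠ z in 𝓝 (x₀, y₀), z ∈ slit Ω ∧ G z = connMap L z :=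
    Filter.Eventually.and (h.mem_nhds hz) hGe
  obtain ⟨δ, hδ, hball⟩ := Metric.eventually_nhds_iff.1 hgood
  have hUc : ContinuousAt U ((x₀, 0), y₀) := hUs.self_of_nhds.continuousAt
  have hU1 : ∀ᶠ p in 𝓝 ((x₀, (0 : Coord n)), y₀), dist (U p) (ContinuousMap.const _ y₀) < δ := by
    have := Metric.tendsto_nhds.1 hUc δ hδ
    rwa [hU0] at this
  have hx1 : ∀ᶠ p : (Coord n × Coord n) × Coord n in 𝓝 ((x₀, (0 : Coord n)), y₀),
      dist p.1.1 x₀ + ‖p.1.2‖ < δ := by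
    have : Continuous fun p : (Coord n × Coord n) × Coord n => dist p.1.1 x₀ + ‖p.1.2‖ := by
      fun_prop
    exact this.tendsto' _ 0 (by simp) |>.eventually (gt_mem_nhds hδ)
  filter_upwards [hUs, hUe, hU1, hx1] with p hps hpe hp1 hpx
  refine ⟨?_, ?_⟩
  · exact (ContinuousMap.evalCLM ℝ (⟨1, right_mem_Icc.2 zero_le_one⟩ : Icc (0 : ℝ) 1)
      : C(Icc (0 : ℝ) 1, Coord n) →L[ℝ] Coord n).contDiff.contDiffAt.comp p hps
  · have hclose : ∀ s (hs : s ∈ Icc (0 : ℝ) 1),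
        (p.1.1 + s • p.1.2, U p ⟨s, hs⟩) ∈ slit Ω ∧
          G (p.1.1 + s • p.1.2, U p ⟨s, hs⟩) = connMap L (p.1.1 + s • p.1.2, U p ⟨s, hs⟩) := by
      intro s hs
      refine hball ?_
      rw [Prod.dist_eq]
      refine max_lt ?_ ?_
      · refine lt_of_le_of_lt ?_ hpx
        calc dist (p.1.1 + s • p.1.2) x₀ ≤ dist (p.1.1 + s • p.1.2) p.1.1 + dist p.1.1 x₀ :=
              dist_triangle _ _ _
          _ = ‖s • p.1.2‖ + dist p.1.1 x₀ := by simp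
          _ ≤ dist p.1.1 x₀ + ‖p.1.2‖ := by
            rw [norm_smul, Real.norm_of_nonneg hs.1, add_comm]
            gcongr
            exact mul_le_of_le_one_left (norm_nonneg _) hs.2
      · exact lt_of_le_of_lt (ContinuousMap.dist_apply_le_dist (f := U p)
          (g := ContinuousMap.const _ y₀) ⟨s, hs⟩) hp1
    have hcont : Continuous fun s : Icc (0 : ℝ) 1 => w (s, p.1, U p s) :=
      hw.continuous.comp (by fun_prop)
    have hext : Continuous (IccExtend (zero_le_one (α := ℝ)) fun s : Icc (0 : ℝ) 1 =>
      w (s, p.1, U p s)) := hcont.Icc_extend'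
    let u : ℝ → Coord n := fun t => p.2 + ∫ s in (0 : ℝ)..t,
      IccExtend (zero_le_one (α := ℝ)) (fun s : Icc (0 : ℝ) 1 => w (s, p.1, U p s)) s
    have hu : ∀ s (hs : s ∈ Icc (0 : ℝ) 1), u s = U p ⟨s, hs⟩ := fun s hs => (hpe ⟨s, hs⟩).symm
    refine ⟨u, ⟨fun s hs => by rw [hu s hs]; exact (hclose s hs).1, fun s hs => ?_⟩, by simp [u],
      hu 1 _⟩
    have h1 : HasDerivAt u (IccExtend (zero_le_one (α := ℝ))
        (fun s : Icc (0 : ℝ) 1 => w (s, p.1, U p s)) s) s :=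
      (hext.integral_hasStrictDerivAt 0 s).hasDerivAt.const_add p.2
    rw [IccExtend_of_mem _ _ hs] at h1
    simp only [w] at h1
    rw [(hclose s hs).2, h.connMap_apply (hclose s hs).1, ← hu s hs] at h1
    exact h1.hasDerivWithinAt

end HorizontalSegments

/-! ### Parallel transport along short segments and polygons. -/

section SegmentTransport

variable {n : ℕ} {Ω : Set (Coord n)} {L : Coord n × Coord n → ℝ}

/-- Parallel transport is defined and smooth along the segments from `x` to `x + a` with
`‖x - x₀‖ < δ` and `‖a‖ < δ`. -/
structure IsTransportRadius (Ω : Set (Coord n)) (L : Coord n × Coord n → ℝ) (x₀ : Coord n)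
    (δ : ℝ) : Prop where
  pos : 0 < δ
  contDiffAt : ∀ x ∈ Metric.ball x₀ δ, ∀ a ∈ Metric.ball (0 : Coord n) δ, ∀ y ≠ 0,
    ContDiffAt ℝ ∞ (segmentTransport Ω L) (x, a, y)
  exists_segment : ∀ x ∈ Metric.ball x₀ δ, ∀ a ∈ Metric.ball (0 : Coord n) δ, ∀ y ≠ 0,
    ∃ u, IsHorizontalSegment Ω L x a u ∧ u 0 = y

/-- Solutions exist locally around each unit vector; compactness of the unit sphere gives one δ for
all of them, and homogeneity extends the result to every y ≠ 0. -/
theorem exists_transportRadius (h : IsLocalFinsler Ω L) {x₀ : Coord n} (hx₀ : x₀ ∈ Ω) :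
    ∃ δ, IsTransportRadius Ω L x₀ δ := by
  have hloc : ∀ y ∈ Metric.sphere (0 : Coord n) 1, ∀ᶠ p in 𝓝 ((x₀, (0 : Coord n)), y),
      ContDiffAt ℝ ∞ (fun p : (Coord n × Coord n) × Coord n =>
        segmentTransport Ω L (p.1.1, p.1.2, p.2)) p ∧
      ∃ u, IsHorizontalSegment Ω L p.1.1 p.1.2 u ∧ u 0 = p.2 := by
    intro y hy
    have hy0 : y ≠ 0 := by
      rintro rfl
      simp at hy
    obtain ⟨P, hP⟩ := exists_local_horizontalSegment h (show (x₀, y) ∈ slit Ω from ⟨hx₀, hy0⟩)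
    filter_upwards [hP.eventually_nhds] with p hp
    obtain ⟨hps, u, hu, hu0, hu1⟩ := hp.self_of_nhds
    refine ⟨hps.congr_of_eventuallyEq ?_, u, hu, hu0⟩
    filter_upwards [hp] with q hq
    obtain ⟨_, v, hv, hv0, hv1⟩ := hq
    rw [← hv0, hv.segmentTransport_eq h, hv1]
  have hall := (isCompact_sphere (0 : Coord n) 1).eventually_forall_of_forall_eventually
    (P := fun q y => ContDiffAt ℝ ∞ (fun p : (Coord n × Coord n) × Coord n =>
        segmentTransport Ω L (p.1.1, p.1.2, p.2)) (q, y) ∧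
      ∃ u, IsHorizontalSegment Ω L q.1 q.2 u ∧ u 0 = y) (x₀ := (x₀, (0 : Coord n))) hloc
  obtain ⟨δ, hδ, hball⟩ := Metric.eventually_nhds_iff.1 hall
  have hgood : ∀ x ∈ Metric.ball x₀ δ, ∀ a ∈ Metric.ball (0 : Coord n) δ, ∀ y ≠ 0,
      ContDiffAt ℝ ∞ (fun p : (Coord n × Coord n) × Coord n =>
        segmentTransport Ω L (p.1.1, p.1.2, p.2)) ((x, a), ‖y‖⁻¹ • y) ∧
      ∃ u, IsHorizontalSegment Ω L x a u ∧ u 0 = ‖y‖⁻¹ • y := fun x hx a ha y hy => by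
    refine hball (y := (x, a)) ?_ _ ?_
    · rw [Prod.dist_eq]
      exact max_lt hx ha
    · rw [mem_sphere_zero_iff_norm, norm_smul, norm_inv, norm_norm,
        inv_mul_cancel₀ (norm_ne_zero_iff.2 hy)]
  refine ⟨δ, hδ, fun x hx a ha y hy => ?_, fun x hx a ha y hy => ?_⟩
  · have h1 := (hgood x hx a ha y hy).1
    let j : Coord n × Coord n × Coord n → (Coord n × Coord n) × Coord n := fun p =>
      ((p.1, p.2.1), ‖p.2.2‖⁻¹ • p.2.2)
    have hn : ContDiffAt ℝ ∞ (fun p : Coord n × Coord n × Coord n => ‖p.2.2‖) (x, a, y) :=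
      ContDiffAt.norm ℝ (by fun_prop) hy
    have hj : ContDiffAt ℝ ∞ j (x, a, y) :=
      ContDiffAt.prodMk (by fun_prop) ((hn.inv (norm_ne_zero_iff.2 hy)).smul (by fun_prop))
    have h2 := hn.smul (ContDiffAt.comp (x, a, y) (f := j) h1 hj)
    refine h2.congr_of_eventuallyEq ?_
    have hy' : ∀ᶠ p : Coord n × Coord n × Coord n in 𝓝 (x, a, y), p.2.2 ≠ 0 :=
      (continuous_snd.comp continuous_snd).continuousAt.eventually_ne hy
    filter_upwards [hy'] with p hp
    have := segmentTransport_smul h p.1 p.2.1 (‖p.2.2‖⁻¹ • p.2.2) (norm_pos_iff.2 hp)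
    rwa [smul_smul, mul_inv_cancel₀ (norm_ne_zero_iff.2 hp), one_smul] at this
  · obtain ⟨_, u, hu, hu0⟩ := hgood x hx a ha y hy
    refine ⟨_, hu.smul h (norm_pos_iff.2 hy), ?_⟩
    simp only [hu0, smul_smul, mul_inv_cancel₀ (norm_ne_zero_iff.2 hy), one_smul]

namespace IsTransportRadius

variable {x₀ : Coord n} {δ : ℝ} {x a y : Coord n}

theorem mem_of_mem_ball (hδ : IsTransportRadius Ω L x₀ δ) (hx : x ∈ Metric.ball x₀ δ) {y : Coord n}
    (hy : y ≠ 0) : (x, y) ∈ slit Ω := by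
  obtain ⟨u, hu, rfl⟩ := hδ.exists_segment x hx 0 (Metric.mem_ball_self hδ.pos) y hy
  simpa using hu.mem 0 (left_mem_Icc.2 zero_le_one)

theorem contDiffOn (hδ : IsTransportRadius Ω L x₀ δ) : ContDiffOn ℝ ∞ (segmentTransport Ω L)
    (Metric.ball x₀ δ ×ˢ Metric.ball 0 δ ×ˢ {y | y ≠ 0}) :=
  fun _ hp => (hδ.contDiffAt _ hp.1 _ hp.2.1 _ hp.2.2).contDiffWithinAt

variable (hδ : IsTransportRadius Ω L x₀ δ) (h : IsLocalFinsler Ω L) (hx : x ∈ Metric.ball x₀ δ)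
  (ha : a ∈ Metric.ball 0 δ) (hy : y ≠ 0)
include hδ h hx hy

theorem transport_zero : segmentTransport Ω L (x, 0, y) = y :=
  (IsHorizontalSegment.constant L (hδ.mem_of_mem_ball hx hy)).segmentTransport_eq h

include ha

theorem transport_ne_zero : segmentTransport Ω L (x, a, y) ≠ 0 := by
  obtain ⟨u, hu, rfl⟩ := hδ.exists_segment x hx a ha y hy
  rw [hu.segmentTransport_eq h]
  exact (hu.mem 1 (right_mem_Icc.2 zero_le_one)).2

theorem norm_sq_transport : L (x + a, segmentTransport Ω L (x, a, y)) = L (x, y) := by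
  obtain ⟨u, hu, rfl⟩ := hδ.exists_segment x hx a ha y hy
  rw [hu.segmentTransport_eq h, hu.norm_sq_eq h]

theorem transport_neg :
    segmentTransport Ω L (x + a, -a, segmentTransport Ω L (x, a, y)) = y := by
  obtain ⟨u, hu, rfl⟩ := hδ.exists_segment x hx a ha y hy
  rw [hu.segmentTransport_eq h]
  simpa using (hu.reverse h).segmentTransport_eq h

theorem hasDerivWithinAt_transport : HasDerivWithinAt (fun s : ℝ => segmentTransport Ω L (x, s • a, y))
    (-localConn L (x, y) a) (Icc 0 1) 0 := by
  obtain ⟨u, hu, hu0⟩ := hδ.exists_segment x hx a ha y hy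
  have h1 := hu.hasDerivWithinAt 0 (left_mem_Icc.2 zero_le_one)
  simp only [zero_smul, add_zero, hu0] at h1
  refine h1.congr_of_mem (fun s hs => ?_) (left_mem_Icc.2 zero_le_one)
  simpa [hu0] using (hu.initial h hs).segmentTransport_eq h

end IsTransportRadius

/-- The derivative of the parallel transport along short segments. -/
theorem IsTransportRadius.hasDerivAt_transport {x₀ x y : Coord n} {δ : ℝ}
    (hδ : IsTransportRadius Ω L x₀ δ) (h : IsLocalFinsler Ω L) (hx : x ∈ Metric.ball x₀ δ)
    (a : Coord n) (hy : y ≠ 0) :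
    HasDerivAt (fun s : ℝ => segmentTransport Ω L (x, s • a, y)) (-localConn L (x, y) a) 0 := by
  have hz := hδ.mem_of_mem_ball hx hy
  -- Since transport is differentiable in a, its derivative along rays is linear in a and is
  -- determined by the one-sided derivatives for small vectors; the factor c reduces an arbitrary a
  -- to a small one.
  have hd : DifferentiableAt ℝ (fun a => segmentTransport Ω L (x, a, y)) 0 := by
    have h1 := (hδ.contDiffAt x hx 0 (Metric.mem_ball_self hδ.pos) y hy).differentiableAt (by simp)
    exact DifferentiableAt.comp (0 : Coord n) (g := segmentTransport Ω L) h1 (by fun_prop)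
  have hray : ∀ a : Coord n, HasDerivAt (fun s : ℝ => segmentTransport Ω L (x, s • a, y))
      (fderiv ℝ (fun a => segmentTransport Ω L (x, a, y)) 0 a) 0 := fun a => by
    have h1 : HasDerivAt (fun s : ℝ => s • a) a 0 := by
      simpa using (hasDerivAt_id (0 : ℝ)).smul_const a
    exact HasFDerivAt.comp_hasDerivAt_of_eq (0 : ℝ) hd.hasFDerivAt h1 (by simp)
  have key : ∀ b ∈ Metric.ball (0 : Coord n) δ,
      fderiv ℝ (fun a => segmentTransport Ω L (x, a, y)) 0 b = -localConn L (x, y) b := by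
    intro b hb
    exact (uniqueDiffOn_Icc zero_lt_one 0 (left_mem_Icc.2 zero_le_one)).eq_deriv _
      (hray b).hasDerivWithinAt (hδ.hasDerivWithinAt_transport h hx hb hy)
  obtain ⟨c, hc, hcb⟩ : ∃ c : ℝ, 0 < c ∧ c • a ∈ Metric.ball (0 : Coord n) δ := by
    refine ⟨δ / (‖a‖ + 1), div_pos hδ.pos (by positivity), ?_⟩
    rw [mem_ball_zero_iff, norm_smul, Real.norm_of_nonneg (by have := hδ.pos; positivity),
      div_mul_eq_mul_div, div_lt_iff₀ (by positivity)]
    nlinarith [hδ.pos, norm_nonneg a]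
  have h2 := key _ hcb
  rw [map_smul, h.localConn_smul hz, ← smul_neg] at h2
  have h3 := smul_right_injective _ hc.ne' h2
  rw [← h3]
  exact hray a

/-- Parallel transport along polygons in the ball `B(x₀, δ)`. -/
inductive IsPolygonTransport (Ω : Set (Coord n)) (L : Coord n × Coord n → ℝ) (x₀ : Coord n)
    (δ : ℝ) : Coord n → Coord n → (Coord n → Coord n) → Prop
  | nil (x : Coord n) : IsPolygonTransport Ω L x₀ δ x x id
  | cons {x x' x'' a : Coord n} {σ : Coord n → Coord n} (hσ : IsPolygonTransport Ω L x₀ δ x x' σ)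
      (hx' : x' ∈ Metric.ball x₀ δ) (ha : a ∈ Metric.ball 0 δ) (hx'' : x'' ∈ Metric.ball x₀ δ)
      (he : x'' = x' + a) :
      IsPolygonTransport Ω L x₀ δ x x'' ((fun y => segmentTransport Ω L (x', a, y)) ∘ σ)

namespace IsPolygonTransport

variable {x₀ x x' x'' a : Coord n} {δ : ℝ} {σ τ : Coord n → Coord n}

theorem segment (hx : x ∈ Metric.ball x₀ δ) (ha : a ∈ Metric.ball 0 δ)
    (hx' : x' ∈ Metric.ball x₀ δ) (he : x' = x + a) :
    IsPolygonTransport Ω L x₀ δ x x' fun y => segmentTransport Ω L (x, a, y) :=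
  cons (nil x) hx ha hx' he

theorem trans (hσ : IsPolygonTransport Ω L x₀ δ x x' σ) (hτ : IsPolygonTransport Ω L x₀ δ x' x'' τ) :
    IsPolygonTransport Ω L x₀ δ x x'' (τ ∘ σ) := by
  induction hτ with
  | nil => exact hσ
  | cons _ hx' ha hx'' he ih => exact cons ih hx' ha hx'' he

theorem mapsTo (hσ : IsPolygonTransport Ω L x₀ δ x x' σ) (hδ : IsTransportRadius Ω L x₀ δ)
    (h : IsLocalFinsler Ω L) : MapsTo σ {y | y ≠ 0} {y | y ≠ 0} := by
  induction hσ with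
  | nil => exact mapsTo_id _
  | cons _ hx' ha _ _ ih => exact fun y hy => hδ.transport_ne_zero h hx' ha (ih hy)

theorem norm_sq (hσ : IsPolygonTransport Ω L x₀ δ x x' σ) (hδ : IsTransportRadius Ω L x₀ δ)
    (h : IsLocalFinsler Ω L) {y : Coord n} (hy : y ≠ 0) : L (x', σ y) = L (x, y) := by
  induction hσ with
  | nil => rfl
  | cons hσ hx' ha _ he ih =>
    rw [he, Function.comp_apply, hδ.norm_sq_transport h hx' ha (hσ.mapsTo hδ h hy), ih]

theorem contDiffOn (hσ : IsPolygonTransport Ω L x₀ δ x x' σ) (hδ : IsTransportRadius Ω L x₀ δ)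
    (h : IsLocalFinsler Ω L) : ContDiffOn ℝ ∞ σ {y | y ≠ 0} := by
  induction hσ with
  | nil => exact contDiffOn_id
  | cons hσ hx' ha _ _ ih =>
    exact hδ.contDiffOn.comp (contDiffOn_const.prodMk (contDiffOn_const.prodMk ih))
      fun y hy => ⟨hx', ha, hσ.mapsTo hδ h hy⟩

theorem exists_inverse (hσ : IsPolygonTransport Ω L x₀ δ x x' σ) (hδ : IsTransportRadius Ω L x₀ δ)
    (h : IsLocalFinsler Ω L) : ∃ τ, IsPolygonTransport Ω L x₀ δ x' x τ ∧
      (∀ y ≠ 0, τ (σ y) = y) ∧ ∀ y ≠ 0, σ (τ y) = y := by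
  induction hσ with
  | nil => exact ⟨id, nil _, fun _ _ => rfl, fun _ _ => rfl⟩
  | @cons x' x'' a σ hσ hx' ha hx'' he ih =>
    obtain ⟨τ, hτ, hl, hr⟩ := ih
    have ha' : -a ∈ Metric.ball (0 : Coord n) δ := by simpa using ha
    have hs : IsPolygonTransport Ω L x₀ δ x'' x' fun y => segmentTransport Ω L (x'', -a, y) :=
      segment hx'' ha' hx' (by rw [he]; abel)
    refine ⟨_, hs.trans hτ, fun y hy => ?_, fun y hy => ?_⟩
    · simp only [Function.comp_apply]
      rw [he, hδ.transport_neg h hx' ha (hσ.mapsTo hδ h hy), hl y hy]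
    · have h1 := hδ.transport_neg h hx'' ha' hy
      simp only [Function.comp_apply]
      rw [hr _ (hs.mapsTo hδ h hy)]
      rw [neg_neg, show x'' + -a = x' by rw [he]; abel] at h1
      exact h1

end IsPolygonTransport

/-- The group of the parallel transports along closed polygons. -/
def polygonLoops (Ω : Set (Coord n)) (L : Coord n × Coord n → ℝ) (x₀ : Coord n) (δ : ℝ)
    (x : Coord n) : Set (Coord n → Coord n) :=
  {σ | IsPolygonTransport Ω L x₀ δ x x σ}

theorem isDiffeoFamily_polygonLoops {x₀ : Coord n} {δ : ℝ} (hδ : IsTransportRadius Ω L x₀ δ)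
    (h : IsLocalFinsler Ω L) (W : Set (Coord n)) :
    IsDiffeoFamily {y | y ≠ 0} W (polygonLoops Ω L x₀ δ) where
  one_mem x _ := .nil x
  mul_mem _ _ _ hσ _ hτ := IsPolygonTransport.trans hτ hσ
  inv_mem _ _ _ hσ := IsPolygonTransport.exists_inverse hσ hδ h
  mapsTo _ _ _ hσ := IsPolygonTransport.mapsTo hσ hδ h
  differentiableOn _ _ _ hσ := (IsPolygonTransport.contDiffOn hσ hδ h).differentiableOn (by simp)

end SegmentTransport

/-! ### Curvature and covariant derivatives as tangents to groups of polygon loops. -/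

section TangentLoops

variable {n : ℕ} {Ω : Set (Coord n)} {L : Coord n × Coord n → ℝ} {x₀ : Coord n} {δ : ℝ}

theorem smul_mem_ball_of_bounded {X : Coord n → Coord n} (hX : ContinuousAt X x₀) {η : ℝ}
    (hη : 0 < η) : ∃ r > 0, ∃ ε : ℝ, 0 < ε ∧
      ∀ x ∈ Metric.ball x₀ r, ∀ s ∈ Ioo (-ε) ε, ‖s • X x‖ < η := by
  have h1 : ∀ᶠ x in 𝓝 x₀, ‖X x‖ < ‖X x₀‖ + 1 :=
    hX.norm.eventually (gt_mem_nhds (lt_add_one ‖X x₀‖))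
  obtain ⟨r, hr, hball⟩ := Metric.eventually_nhds_iff.1 h1
  refine ⟨r, hr, η / (‖X x₀‖ + 1), by positivity, fun x hx s hs => ?_⟩
  have hs' : |s| < η / (‖X x₀‖ + 1) := abs_lt.2 hs
  rw [norm_smul, Real.norm_eq_abs]
  have hpos : 0 < ‖X x₀‖ + 1 := by positivity
  calc |s| * ‖X x‖ ≤ |s| * (‖X x₀‖ + 1) := by
        gcongr
        exact (hball hx).le
    _ < η := (lt_div_iff₀ hpos).1 hs'

/-- `W` and `ε` are so small that the segments from `x ∈ W` to `x + s X(x)`, `|s| < ε`, stay in the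
domain of the parallel transport and end in `W'`. -/
structure IsSmallField (x₀ : Coord n) (δ : ℝ) (W W' : Set (Coord n)) (ε : ℝ)
    (X : Coord n → Coord n) : Prop where
  isOpen : IsOpen W
  subset_ball : W ⊆ Metric.ball x₀ δ
  smooth : ContDiffOn ℝ ∞ X W
  smul_mem : ∀ x ∈ W, ∀ s ∈ Ioo (-ε) ε, s • X x ∈ Metric.ball (0 : Coord n) δ
  add_mem : ∀ x ∈ W, ∀ s ∈ Ioo (-ε) ε, x + s • X x ∈ W'

/-- The bounds hold for all smaller r' and ε', so two fields can be given a common domain. -/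
theorem exists_isSmallField (hδ : 0 < δ) {W : Set (Coord n)} (hW : IsOpen W) (hx₀ : x₀ ∈ W)
    {X : Coord n → Coord n} (hX : ContDiffOn ℝ ∞ X W) :
    ∃ r > 0, ∃ ε > 0, Metric.ball x₀ r ⊆ W ∧ ∀ r' ≤ r, ∀ ε' ≤ ε,
      IsSmallField x₀ δ (Metric.ball x₀ r') W ε' X := by
  obtain ⟨R, hR, hRW⟩ := Metric.isOpen_iff.1 hW x₀ hx₀
  obtain ⟨r, hr, ε, hε, hs⟩ := smul_mem_ball_of_bounded
    ((hX.contDiffAt (hW.mem_nhds hx₀)).continuousAt) (lt_min hδ (half_pos hR))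
  refine ⟨min r (min δ (R / 2)), lt_min hr (lt_min hδ (half_pos hR)), ε, hε, ?_,
    fun r' hr' ε' hε' => ?_⟩
  · exact (Metric.ball_subset_ball ((min_le_right _ _).trans ((min_le_right _ _).trans
      (half_le_self hR.le)))).trans hRW
  · have h1 : Metric.ball x₀ r' ⊆ Metric.ball x₀ r :=
      Metric.ball_subset_ball (hr'.trans (min_le_left _ _))
    have h2 : Metric.ball x₀ r' ⊆ Metric.ball x₀ (R / 2) :=
      Metric.ball_subset_ball (hr'.trans ((min_le_right _ _).trans (min_le_right _ _)))
    have h3 : ∀ x ∈ Metric.ball x₀ r', ∀ s ∈ Ioo (-ε') ε', ‖s • X x‖ < min δ (R / 2) :=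
      fun x hx s hs' => hs x (h1 hx) s ⟨by linarith [hs'.1], hs'.2.trans_le hε'⟩
    refine ⟨Metric.isOpen_ball, Metric.ball_subset_ball (hr'.trans ((min_le_right _ _).trans
      (min_le_left _ _))), hX.mono ?_, fun x hx s hs' => ?_, fun x hx s hs' => hRW ?_⟩
    · exact (h2.trans (Metric.ball_subset_ball (half_le_self hR.le))).trans hRW
    · rw [mem_ball_zero_iff]
      exact (h3 x hx s hs').trans_le (min_le_left _ _)
    · rw [mem_ball_iff_norm]
      calc ‖x + s • X x - x₀‖ = ‖(x - x₀) + s • X x‖ := by congr 1; abel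
        _ ≤ ‖x - x₀‖ + ‖s • X x‖ := norm_add_le _ _
        _ < R / 2 + R / 2 := add_lt_add (mem_ball_iff_norm.1 (h2 hx))
            ((h3 x hx s hs').trans_le (min_le_right _ _))
        _ = R := add_halves R

variable {W W' : Set (Coord n)} {ε : ℝ} {X Y : Coord n → Coord n}

theorem dslope_decomp {G : Type*} [NormedAddCommGroup G] [NormedSpace ℝ G] (f : ℝ → G) (t : ℝ) :
    f t = f 0 + t • dslope f 0 t := by
  have := sub_smul_dslope f 0 t
  rw [sub_zero] at this
  rw [this]
  abel

/-- Subtracting its values on the axes makes the translation along sX(x) followed by tY(x) divisible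
by t and by s: Hadamard's lemma twice. At the origin c is the mixed derivative: ∂ₜ at t = 0 is −N(x
+ sX, P_s y)Y, and (x + sX, P_s y) has velocity Xʰ at s = 0. Both vectors are frozen at x, so that
the parallelogram closes. -/
theorem exists_corner_expansion (hδ : IsTransportRadius Ω L x₀ δ) (h : IsLocalFinsler Ω L)
    (hε : 0 < ε) (hX : IsSmallField x₀ δ W (Metric.ball x₀ δ) ε X)
    (hY : IsSmallField x₀ δ W (Metric.ball x₀ δ) ε Y) :
    ∃ c : ℝ × ℝ × Coord n × Coord n → Coord n,
      ContDiffOn ℝ ∞ c (Ioo (-ε) ε ×ˢ Ioo (-ε) ε ×ˢ W ×ˢ {y | y ≠ 0}) ∧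
      (∀ s ∈ Ioo (-ε) ε, ∀ t ∈ Ioo (-ε) ε, ∀ x ∈ W, ∀ y ≠ 0,
        segmentTransport Ω L (x + s • X x, t • Y x, segmentTransport Ω L (x, s • X x, y)) =
          segmentTransport Ω L (x, s • X x, y) + (segmentTransport Ω L (x, t • Y x, y) - y) +
            (t * s) • c (s, t, x, y)) ∧
      ∀ x ∈ W, ∀ y ≠ 0, c (0, 0, x, y) =
        -fderiv ℝ (fun w => localConn L w (Y x)) (x, y) (localHor L (x, y) (X x)) := by
  have h0 : (0 : ℝ) ∈ Ioo (-ε) ε := ⟨by linarith, hε⟩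
  have hU : IsOpen {y : Coord n | y ≠ 0} := isOpen_ne
  let D : Set (ℝ × ℝ × Coord n × Coord n) := Ioo (-ε) ε ×ˢ Ioo (-ε) ε ×ˢ W ×ˢ {y | y ≠ 0}
  have hD : IsOpen D := isOpen_Ioo.prod (isOpen_Ioo.prod (hX.isOpen.prod hU))
  have hsx : ContDiffOn ℝ ∞ (fun p : ℝ × ℝ × Coord n × Coord n => X p.2.2.1) D :=
    hX.smooth.comp (by fun_prop) fun p hp => hp.2.2.1
  have hsy : ContDiffOn ℝ ∞ (fun p : ℝ × ℝ × Coord n × Coord n => Y p.2.2.1) D :=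
    hY.smooth.comp (by fun_prop) fun p hp => hp.2.2.1
  have hs₁ : ContDiffOn ℝ ∞ (fun p : ℝ × ℝ × Coord n × Coord n => p.2.1) D := by fun_prop
  have ht₁ : ContDiffOn ℝ ∞ (fun p : ℝ × ℝ × Coord n × Coord n => p.1) D := by fun_prop
  have hx₁ : ContDiffOn ℝ ∞ (fun p : ℝ × ℝ × Coord n × Coord n => p.2.2.1) D := by fun_prop
  have hy₁ : ContDiffOn ℝ ∞ (fun p : ℝ × ℝ × Coord n × Coord n => p.2.2.2) D := by fun_prop
  let g : ℝ × ℝ × Coord n × Coord n → Coord n := fun p =>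
    segmentTransport Ω L (p.2.2.1 + p.2.1 • X p.2.2.1, p.1 • Y p.2.2.1,
      segmentTransport Ω L (p.2.2.1, p.2.1 • X p.2.2.1, p.2.2.2))
  have hg : ContDiffOn ℝ ∞ g D := by
    have h1 : ContDiffOn ℝ ∞ (fun p : ℝ × ℝ × Coord n × Coord n =>
        segmentTransport Ω L (p.2.2.1, p.2.1 • X p.2.2.1, p.2.2.2)) D := by
      refine hδ.contDiffOn.comp (hx₁.prodMk ((hs₁.smul hsx).prodMk hy₁)) fun p hp => ?_
      exact ⟨hX.subset_ball hp.2.2.1, hX.smul_mem _ hp.2.2.1 _ hp.2.1, hp.2.2.2⟩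
    refine hδ.contDiffOn.comp ((hx₁.add (hs₁.smul hsx)).prodMk ((ht₁.smul hsy).prodMk h1))
      fun p hp => ?_
    exact ⟨hX.add_mem _ hp.2.2.1 _ hp.2.1, hY.smul_mem _ hp.2.2.1 _ hp.1,
      hδ.transport_ne_zero h (hX.subset_ball hp.2.2.1) (hX.smul_mem _ hp.2.2.1 _ hp.2.1) hp.2.2.2⟩
  let c₁ : ℝ × ℝ × Coord n × Coord n → Coord n := fun p => dslope (fun t => g (t, p.2)) 0 p.1
  have hc₁ : ContDiffOn ℝ ∞ c₁ D := contDiffOn_dslope hD (fun t z hz => ⟨h0, hz.2⟩) hg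
  have hsw : ContDiff ℝ ∞ fun p : ℝ × ℝ × Coord n × Coord n => (p.2.1, p.1, p.2.2) := by fun_prop
  let g₂ : ℝ × ℝ × Coord n × Coord n → Coord n := fun p => c₁ (p.2.1, p.1, p.2.2)
  have hg₂ : ContDiffOn ℝ ∞ g₂ D := hc₁.comp hsw.contDiffOn fun p hp => ⟨hp.2.1, hp.1, hp.2.2⟩
  refine ⟨fun p => dslope (fun s => g₂ (s, p.2)) 0 p.1,
    contDiffOn_dslope hD (fun t z hz => ⟨h0, hz.2⟩) hg₂, fun s hs t ht x hx y hy => ?_,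
    fun x hx y hy => ?_⟩
  · have hxb := hX.subset_ball hx
    have hP0 := hδ.transport_zero h hxb hy
    have e1 : g (t, s, x, y) = g (0, s, x, y) + t • g₂ (s, t, x, y) :=
      dslope_decomp (fun t => g (t, s, x, y)) t
    have e2 : g (t, 0, x, y) = g (0, 0, x, y) + t • g₂ (0, t, x, y) :=
      dslope_decomp (fun t => g (t, 0, x, y)) t
    have e3 : g₂ (s, t, x, y) = g₂ (0, t, x, y) + s • dslope (fun s => g₂ (s, t, x, y)) 0 s :=
      dslope_decomp (fun s => g₂ (s, t, x, y)) s
    have e4 : g (0, s, x, y) = segmentTransport Ω L (x, s • X x, y) := by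
      simp only [g, zero_smul]
      exact hδ.transport_zero h (hX.add_mem x hx s hs)
        (hδ.transport_ne_zero h hxb (hX.smul_mem x hx s hs) hy)
    have e5 : ∀ t, g (t, 0, x, y) = segmentTransport Ω L (x, t • Y x, y) := fun t => by
      simp only [g, zero_smul, add_zero, hP0]
    rw [e5, e5, zero_smul, hP0] at e2
    change g (t, s, x, y) = _
    rw [e1, e4, e3, e2, smul_add, smul_smul]
    abel
  · change dslope (fun s => g₂ (s, 0, x, y)) 0 0 = _
    rw [dslope_same]
    have hxb := hX.subset_ball hx
    have hz := hδ.mem_of_mem_ball hxb hy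
    have e1 : ∀ s ∈ Ioo (-ε) ε, g₂ (s, 0, x, y) =
        -localConn L (x + s • X x, segmentTransport Ω L (x, s • X x, y)) (Y x) := by
      intro s hs
      change dslope (fun t => g (t, s, x, y)) 0 0 = _
      rw [dslope_same]
      exact (hδ.hasDerivAt_transport h (hX.add_mem x hx s hs) (Y x)
        (hδ.transport_ne_zero h hxb (hX.smul_mem x hx s hs) hy)).deriv
    have e2 : HasDerivAt (fun s : ℝ => (x + s • X x, segmentTransport Ω L (x, s • X x, y)))
        (localHor L (x, y) (X x)) 0 := by
      have h1 : HasDerivAt (fun s : ℝ => x + s • X x) (X x) 0 := by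
        simpa using ((hasDerivAt_id (0 : ℝ)).smul_const (X x)).const_add x
      exact h1.prodMk (hδ.hasDerivAt_transport h hxb (X x) hy)
    have e3 : HasFDerivAt (fun w => localConn L w (Y x))
        (fderiv ℝ (fun w => localConn L w (Y x)) (x, y)) (x, y) :=
      (((h.smooth_localConn_const (Y x)).contDiffAt (h.mem_nhds hz)).differentiableAt
        (by simp)).hasFDerivAt
    have e4 := (HasFDerivAt.comp_hasDerivAt_of_eq (0 : ℝ) e3 e2 (by
      simp [hδ.transport_zero h hxb hy])).neg
    exact (e4.congr_of_eventuallyEq (by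
      filter_upwards [isOpen_Ioo.mem_nhds h0] with s hs using e1 s hs)).deriv

/-- The curvature fields are tangent to the holonomy groups, smoothly in the base point. -/
theorem isTangentTo_localCurv (hδ : IsTransportRadius Ω L x₀ δ) (h : IsLocalFinsler Ω L)
    {V : Set (Coord n)} (hV : IsOpen V) (hx₀ : x₀ ∈ V) (hX : ContDiffOn ℝ ∞ X V)
    (hY : ContDiffOn ℝ ∞ Y V) :
    ∃ r > 0, IsTangentTo (polygonLoops Ω L x₀ δ) {y | y ≠ 0} (Metric.ball x₀ r)
      fun z => localCurv L z (X z.1) (Y z.1) := by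
  have hV' : IsOpen (V ∩ Metric.ball x₀ (δ / 2)) := hV.inter Metric.isOpen_ball
  have hx₀' : x₀ ∈ V ∩ Metric.ball x₀ (δ / 2) := ⟨hx₀, Metric.mem_ball_self (half_pos hδ.pos)⟩
  -- Half the radius: the opposite corner x + tX + tY then still lies in the ball of radius δ.
  obtain ⟨r₁, hr₁, ε₁, hε₁, -, h₁⟩ := exists_isSmallField (half_pos hδ.pos) hV' hx₀'
    (hX.mono inter_subset_left)
  obtain ⟨r₂, hr₂, ε₂, hε₂, -, h₂⟩ := exists_isSmallField (half_pos hδ.pos) hV' hx₀'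
    (hY.mono inter_subset_left)
  set r := min r₁ r₂
  set ε := min ε₁ ε₂
  have hε : 0 < ε := lt_min hε₁ hε₂
  have h0 : (0 : ℝ) ∈ Ioo (-ε) ε := ⟨by linarith, hε⟩
  have hX' := h₁ r (min_le_left _ _) ε (min_le_left _ _)
  have hY' := h₂ r (min_le_right _ _) ε (min_le_right _ _)
  set W := Metric.ball x₀ r
  have hδ2 : δ / 2 ≤ δ := half_le_self hδ.pos.le
  have hb2 : ∀ c : Coord n, Metric.ball c (δ / 2) ⊆ Metric.ball c δ := fun c =>
    Metric.ball_subset_ball hδ2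
  have widen : ∀ {X}, IsSmallField x₀ (δ / 2) W (V ∩ Metric.ball x₀ (δ / 2)) ε X →
      IsSmallField x₀ δ W (Metric.ball x₀ δ) ε X := fun hX =>
    ⟨hX.isOpen, hX.subset_ball.trans (hb2 _), hX.smooth, fun x hx s hs => hb2 _ (hX.smul_mem x hx s hs),
      fun x hx s hs => hb2 _ (hX.add_mem x hx s hs).2⟩
  have hX₁ := widen hX'
  have hY₁ := widen hY'
  have hcorner : ∀ {X Y}, IsSmallField x₀ (δ / 2) W (V ∩ Metric.ball x₀ (δ / 2)) ε X →
      IsSmallField x₀ (δ / 2) W (V ∩ Metric.ball x₀ (δ / 2)) ε Y →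
      ∀ x ∈ W, ∀ s ∈ Ioo (-ε) ε, x + s • X x + s • Y x ∈ Metric.ball x₀ δ := by
    intro X Y hX hY x hx s hs
    have h1 := mem_ball_iff_norm.1 (hX.add_mem x hx s hs).2
    have h2 := mem_ball_zero_iff.1 (hY.smul_mem x hx s hs)
    rw [mem_ball_iff_norm]
    calc ‖x + s • X x + s • Y x - x₀‖ = ‖(x + s • X x - x₀) + s • Y x‖ := by congr 1; abel
      _ ≤ ‖x + s • X x - x₀‖ + ‖s • Y x‖ := norm_add_le _ _
      _ < δ := by linarith
  have hU : IsOpen {y : Coord n | y ≠ 0} := isOpen_ne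
  obtain ⟨c, hc, hce, hc0⟩ := exists_corner_expansion hδ h hε hX₁ hY₁
  obtain ⟨d, hd, hde, hd0⟩ := exists_corner_expansion hδ h hε hY₁ hX₁
  have hsx : ContDiffOn ℝ ∞ (fun p : ℝ × Coord n × Coord n => p.1 • X p.2.1)
      (curveDomain ε W {y | y ≠ 0}) :=
    contDiffOn_fst.smul (hX'.smooth.comp (by fun_prop) fun p hp => hp.2.1)
  have hsy : ContDiffOn ℝ ∞ (fun p : ℝ × Coord n × Coord n => p.1 • Y p.2.1)
      (curveDomain ε W {y | y ≠ 0}) :=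
    contDiffOn_fst.smul (hY'.smooth.comp (by fun_prop) fun p hp => hp.2.1)
  have hneg : ∀ {a : Coord n}, a ∈ Metric.ball (0 : Coord n) δ → -a ∈ Metric.ball (0 : Coord n) δ :=
    fun ha => by simpa using ha
  -- C translates to the opposite corner along X, then Y; B along Y, then X; B' undoes B. The loop
  -- is B' ∘ C.
  let C : ℝ × Coord n × Coord n → Coord n := fun p => segmentTransport Ω L
    (p.2.1 + p.1 • X p.2.1, p.1 • Y p.2.1, segmentTransport Ω L (p.2.1, p.1 • X p.2.1, p.2.2))
  let B : ℝ × Coord n × Coord n → Coord n := fun p => segmentTransport Ω L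
    (p.2.1 + p.1 • Y p.2.1, p.1 • X p.2.1, segmentTransport Ω L (p.2.1, p.1 • Y p.2.1, p.2.2))
  let B' : ℝ × Coord n × Coord n → Coord n := fun p => segmentTransport Ω L
    (p.2.1 + p.1 • Y p.2.1, -(p.1 • Y p.2.1), segmentTransport Ω L
      (p.2.1 + p.1 • Y p.2.1 + p.1 • X p.2.1, -(p.1 • X p.2.1), p.2.2))
  have hfst : ContDiffOn ℝ ∞ (fun p : ℝ × Coord n × Coord n => p.2.1)
    (curveDomain ε W {y | y ≠ 0}) := by fun_prop
  have hsnd : ContDiffOn ℝ ∞ (fun p : ℝ × Coord n × Coord n => p.2.2)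
    (curveDomain ε W {y | y ≠ 0}) := by fun_prop
  have hCU : ∀ p ∈ curveDomain ε W {y | y ≠ 0}, C p ≠ 0 := fun p hp =>
    hδ.transport_ne_zero h (hX₁.add_mem _ hp.2.1 _ hp.1) (hY₁.smul_mem _ hp.2.1 _ hp.1)
      (hδ.transport_ne_zero h (hX₁.subset_ball hp.2.1) (hX₁.smul_mem _ hp.2.1 _ hp.1) hp.2.2)
  have hBU : ∀ p ∈ curveDomain ε W {y | y ≠ 0}, B p ≠ 0 := fun p hp =>
    hδ.transport_ne_zero h (hY₁.add_mem _ hp.2.1 _ hp.1) (hX₁.smul_mem _ hp.2.1 _ hp.1)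
      (hδ.transport_ne_zero h (hY₁.subset_ball hp.2.1) (hY₁.smul_mem _ hp.2.1 _ hp.1) hp.2.2)
  have hB'U₁ : ∀ p ∈ curveDomain ε W {y | y ≠ 0}, segmentTransport Ω L
      (p.2.1 + p.1 • Y p.2.1 + p.1 • X p.2.1, -(p.1 • X p.2.1), p.2.2) ≠ 0 := fun p hp =>
    hδ.transport_ne_zero h (hcorner hY' hX' _ hp.2.1 _ hp.1)
      (hneg (hX₁.smul_mem _ hp.2.1 _ hp.1)) hp.2.2
  have hB'U : ∀ p ∈ curveDomain ε W {y | y ≠ 0}, B' p ≠ 0 := fun p hp =>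
    hδ.transport_ne_zero h (hY₁.add_mem _ hp.2.1 _ hp.1) (hneg (hY₁.smul_mem _ hp.2.1 _ hp.1))
      (hB'U₁ p hp)
  have hBs : ContDiffOn ℝ ∞ B (curveDomain ε W {y | y ≠ 0}) := by
    refine hδ.contDiffOn.comp ((hfst.add hsy).prodMk (hsx.prodMk (hδ.contDiffOn.comp
      (hfst.prodMk (hsy.prodMk hsnd)) fun p hp => ?_))) fun p hp => ?_
    · exact ⟨hY₁.subset_ball hp.2.1, hY₁.smul_mem _ hp.2.1 _ hp.1, hp.2.2⟩
    · exact ⟨hY₁.add_mem _ hp.2.1 _ hp.1, hX₁.smul_mem _ hp.2.1 _ hp.1,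
        hδ.transport_ne_zero h (hY₁.subset_ball hp.2.1) (hY₁.smul_mem _ hp.2.1 _ hp.1) hp.2.2⟩
  have hB's : ContDiffOn ℝ ∞ B' (curveDomain ε W {y | y ≠ 0}) := by
    refine hδ.contDiffOn.comp ((hfst.add hsy).prodMk (hsy.neg.prodMk (hδ.contDiffOn.comp
      (((hfst.add hsy).add hsx).prodMk (hsx.neg.prodMk hsnd)) fun p hp => ?_))) fun p hp => ?_
    · exact ⟨hcorner hY' hX' _ hp.2.1 _ hp.1, hneg (hX₁.smul_mem _ hp.2.1 _ hp.1), hp.2.2⟩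
    · exact ⟨hY₁.add_mem _ hp.2.1 _ hp.1, hneg (hY₁.smul_mem _ hp.2.1 _ hp.1), hB'U₁ p hp⟩
  have hB'B : ∀ p ∈ curveDomain ε W {y | y ≠ 0}, B' (p.1, p.2.1, B p) = p.2.2 := fun p hp => by
    simp only [B', B]
    rw [hδ.transport_neg h (hY₁.add_mem _ hp.2.1 _ hp.1) (hX₁.smul_mem _ hp.2.1 _ hp.1)
      (hδ.transport_ne_zero h (hY₁.subset_ball hp.2.1) (hY₁.smul_mem _ hp.2.1 _ hp.1) hp.2.2),
      hδ.transport_neg h (hY₁.subset_ball hp.2.1) (hY₁.smul_mem _ hp.2.1 _ hp.1) hp.2.2]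
  let κ : ℝ × Coord n × Coord n → Coord n := fun p =>
    c (p.1, p.1, p.2.1, p.2.2) - d (p.1, p.1, p.2.1, p.2.2)
  have hκ : ContDiffOn ℝ ∞ κ (curveDomain ε W {y | y ≠ 0}) := by
    have hj : ContDiffOn ℝ ∞ (fun p : ℝ × Coord n × Coord n => (p.1, p.1, p.2.1, p.2.2))
      (curveDomain ε W {y | y ≠ 0}) := by fun_prop
    exact (hc.comp hj fun p hp => ⟨hp.1, hp.1, hp.2⟩).sub (hd.comp hj fun p hp => ⟨hp.1, hp.1, hp.2⟩)
  have hCB : ∀ p ∈ curveDomain ε W {y | y ≠ 0}, C p = B p + p.1 ^ 2 • κ p := fun p hp => by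
    simp only [C, B, κ]
    rw [hce _ hp.1 _ hp.1 _ hp.2.1 _ hp.2.2, hde _ hp.1 _ hp.1 _ hp.2.1 _ hp.2.2, smul_sub, sq]
    abel
  -- C = B + t²κ, and B' is to be expanded at the point B(y). The increment κ(y) must therefore be a
  -- function of B(y), namely κ ∘ B'.
  have hθ : ContDiffOn ℝ ∞ (fun p => κ (p.1, p.2.1, B' p)) (curveDomain ε W {y | y ≠ 0}) :=
    contDiffOn_comp_curveDomain hκ hB's hB'U
  obtain ⟨D, μ, hDm, hμ, hμe, hμ0⟩ := IsTangentTo.exists_expansion hU hX'.isOpen hB's hθ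
  have hBm : ∀ p ∈ curveDomain ε W {y | y ≠ 0},
      (p.1, p.2.1, B p) ∈ curveDomain ε W {y : Coord n | y ≠ 0} := fun p hp =>
    ⟨hp.1, hp.2.1, hBU p hp⟩
  have hBκ : ∀ p ∈ curveDomain ε W {y | y ≠ 0},
      B p + p.1 ^ 2 • κ (p.1, p.2.1, B' (p.1, p.2.1, B p)) ∈ {y : Coord n | y ≠ 0} := fun p hp => by
    rw [hB'B p hp, show (p.1, p.2.1, p.2.2) = p from rfl, ← hCB p hp]
    exact hCU p hp
  refine ⟨r, lt_min hr₁ hr₂, 2, ε, fun p => B' (p.1, p.2.1, C p),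
    fun p => μ (p.1 ^ 2, p.1, p.2.1, B p), by norm_num, hε, fun t ht x hx => ?_, ?_,
    fun p hp => ?_, fun x hx y hy => ?_⟩
  · have s1 : IsPolygonTransport Ω L x₀ δ x (x + t • X x) fun y =>
        segmentTransport Ω L (x, t • X x, y) :=
      .segment (hX₁.subset_ball hx) (hX₁.smul_mem x hx t ht) (hX₁.add_mem x hx t ht) rfl
    have s2 : IsPolygonTransport Ω L x₀ δ (x + t • X x) (x + t • Y x + t • X x) fun y =>
        segmentTransport Ω L (x + t • X x, t • Y x, y) :=
      .segment (hX₁.add_mem x hx t ht) (hY₁.smul_mem x hx t ht) (hcorner hY' hX' x hx t ht)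
        (by abel)
    have s3 : IsPolygonTransport Ω L x₀ δ (x + t • Y x + t • X x) (x + t • Y x) fun y =>
        segmentTransport Ω L (x + t • Y x + t • X x, -(t • X x), y) :=
      .segment (hcorner hY' hX' x hx t ht) (hneg (hX₁.smul_mem x hx t ht)) (hY₁.add_mem x hx t ht)
        (by abel)
    have s4 : IsPolygonTransport Ω L x₀ δ (x + t • Y x) x fun y =>
        segmentTransport Ω L (x + t • Y x, -(t • Y x), y) :=
      .segment (hY₁.add_mem x hx t ht) (hneg (hY₁.smul_mem x hx t ht)) (hX₁.subset_ball hx)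
        (by abel)
    exact ((s1.trans s2).trans s3).trans s4
  · have hj : ContDiffOn ℝ ∞ (fun p : ℝ × Coord n × Coord n => (p.1 ^ 2, p.1, p.2.1, B p))
        (curveDomain ε W {y | y ≠ 0}) :=
      ContDiffOn.prodMk (by fun_prop) (ContDiffOn.prodMk (by fun_prop) (hfst.prodMk hBs))
    exact hμ.comp hj fun p hp => hDm _ (p.1, p.2.1, B p) (hBm p hp) (hBκ p hp)
  · have h1 := hμe (p.1 ^ 2) (p.1, p.2.1, B p) (hBm p hp) (hBκ p hp)
    simp only [hB'B p hp] at h1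
    rw [show (p.1, p.2.1, p.2.2) = p from rfl, ← hCB p hp] at h1
    exact h1
  -- At t = 0 all translations are identities, so μ = κ = c − d = D(NX)(Yʰ) − D(NY)(Xʰ).
  · have hB0 : B (0, x, y) = y := by
      simp only [B, zero_smul, add_zero, hδ.transport_zero h (hX₁.subset_ball hx) hy]
    have hB'0 : ∀ z ≠ 0, B' (0, x, z) = z := fun z hz => by
      simp only [B', zero_smul, add_zero, neg_zero, hδ.transport_zero h (hX₁.subset_ball hx) hz]
    have h1 := hμ0 (0, x, y) ⟨h0, hx, hy⟩
    have h2 : (fun z => B' (0, x, z)) =ᶠ[𝓝 y] id := by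
      filter_upwards [hU.mem_nhds hy] with z hz using hB'0 z hz
    simp only [h2.fderiv_eq, fderiv_id, hB'0 y hy] at h1
    simp only [hB0]
    rw [zero_pow two_ne_zero, h1]
    simp only [κ, hc0 x hx y hy, hd0 x hx y hy, localCurv, ContinuousLinearMap.id_apply]
    abel

/-- Base point and direction both move, but transport in direction 0 is the identity at every base
point, so only the direction −ta contributes. -/
theorem IsTransportRadius.hasDerivAt_transport_back (hδ : IsTransportRadius Ω L x₀ δ)
    (h : IsLocalFinsler Ω L) {x z : Coord n} (hx : x ∈ Metric.ball x₀ δ) (a : Coord n)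
    (hz : z ≠ 0) : HasDerivAt (fun t : ℝ => segmentTransport Ω L (x + t • a, -(t • a), z))
      (localConn L (x, z) a) 0 := by
  have d1 : HasFDerivAt (segmentTransport Ω L) (fderiv ℝ (segmentTransport Ω L) (x, 0, z))
      (x, 0, z) := ((hδ.contDiffAt x hx 0 (Metric.mem_ball_self hδ.pos) z hz).differentiableAt
        (by simp)).hasFDerivAt
  have d2 : ∀ a b : Coord n, HasDerivAt (fun t : ℝ => (x + t • a, t • b, z)) (a, b, 0) 0 := by
    intro a b
    have h1 : HasDerivAt (fun t : ℝ => x + t • a) a 0 := by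
      simpa using ((hasDerivAt_id (0 : ℝ)).smul_const a).const_add x
    have h2 : HasDerivAt (fun t : ℝ => t • b) b 0 := by
      simpa using (hasDerivAt_id (0 : ℝ)).smul_const b
    exact h1.prodMk (h2.prodMk (hasDerivAt_const _ _))
  have d3 : ∀ a b : Coord n, HasDerivAt (fun t : ℝ => segmentTransport Ω L (x + t • a, t • b, z))
      (fderiv ℝ (segmentTransport Ω L) (x, 0, z) (a, b, 0)) 0 := fun a b =>
    HasFDerivAt.comp_hasDerivAt_of_eq (0 : ℝ) d1 (d2 a b) (by simp)
  have d4 : fderiv ℝ (segmentTransport Ω L) (x, 0, z) (a, 0, 0) = 0 := by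
    refine (d3 a 0).unique ((hasDerivAt_const (0 : ℝ) z).congr_of_eventuallyEq ?_)
    have hc : ∀ᶠ t : ℝ in 𝓝 0, x + t • a ∈ Metric.ball x₀ δ := by
      have : Continuous fun t : ℝ => x + t • a := by fun_prop
      exact this.continuousAt.eventually_mem (Metric.isOpen_ball.mem_nhds (by simpa using hx))
    filter_upwards [hc] with t ht
    rw [smul_zero]
    exact hδ.transport_zero h ht hz
  have d5 : fderiv ℝ (segmentTransport Ω L) (x, 0, z) (0, -a, 0) = localConn L (x, z) a := by
    have h1 := hδ.hasDerivAt_transport h hx (-a) hz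
    have h2 := d3 0 (-a)
    simp only [smul_zero, add_zero] at h2
    rw [h2.unique h1, show -a = (-1 : ℝ) • a by simp,
      h.localConn_smul (hδ.mem_of_mem_ball hx hz)]
    simp
  have d6 := d3 a (-a)
  rw [show (a, -a, (0 : Coord n)) = (a, 0, 0) + (0, -a, 0) by simp, map_add, d4, d5,
    zero_add] at d6
  simpa only [smul_neg] using d6

/-- The derivative of a parameter-dependent field along a horizontal curve. -/
theorem IsTransportRadius.hasDerivAt_comp_transport (hδ : IsTransportRadius Ω L x₀ δ)
    (h : IsLocalFinsler Ω L) {x y : Coord n} (hx : x ∈ Metric.ball x₀ δ) (a : Coord n)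
    (hy : y ≠ 0) {ρ : ℝ × Coord n × Coord n → Coord n} (hρ : DifferentiableAt ℝ ρ (0, x, y)) :
    HasDerivAt (fun t : ℝ => ρ (t, x + t • a, segmentTransport Ω L (x, t • a, y)) - ρ (t, x, y))
      (fderiv ℝ (fun z : Coord n × Coord n => ρ (0, z)) (x, y) (localHor L (x, y) a)) 0 := by
  have h2 := hδ.hasDerivAt_transport h hx a hy
  have h1 : HasDerivAt (fun t : ℝ => x + t • a) a 0 := by
    simpa using ((hasDerivAt_id (0 : ℝ)).smul_const a).const_add x
  have e1 := (hasDerivAt_id' (0 : ℝ)).prodMk (h1.prodMk h2)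
  have e2 := (hasDerivAt_id' (0 : ℝ)).prodMk (hasDerivAt_const (0 : ℝ) (x, y))
  have e3 := (HasFDerivAt.comp_hasDerivAt_of_eq (0 : ℝ) hρ.hasFDerivAt e1
    (by simp [hδ.transport_zero h hx hy])).sub
      (HasFDerivAt.comp_hasDerivAt_of_eq (0 : ℝ) hρ.hasFDerivAt e2 rfl)
  have e4 : HasFDerivAt (fun z : Coord n × Coord n => ρ (0, z))
      ((fderiv ℝ ρ (0, x, y)).comp (ContinuousLinearMap.inr ℝ ℝ (Coord n × Coord n))) (x, y) :=
    HasFDerivAt.comp (x, y) (g := ρ) hρ.hasFDerivAt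
      (hasFDerivAt_prodMk_right (𝕜 := ℝ) (0 : ℝ) (x, y))
  rw [e4.fderiv]
  refine e3.congr_deriv ?_
  rw [← map_sub]
  simp [localHor]

/-- The fields tangent to the holonomy groups are closed under covariant differentiation. -/
theorem IsTangentTo.covariantDerivative (hδ : IsTransportRadius Ω L x₀ δ) (h : IsLocalFinsler Ω L)
    {V : Set (Coord n)} (hV : IsOpen V) (hx₀ : x₀ ∈ V) (hVδ : V ⊆ Metric.ball x₀ δ)
    (hX : ContDiffOn ℝ ∞ X V) {ξ : Coord n × Coord n → Coord n}
    (hξ : IsTangentTo (polygonLoops Ω L x₀ δ) {y | y ≠ 0} V ξ) :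
    ∃ r > 0, Metric.ball x₀ r ⊆ V ∧
      IsTangentTo (polygonLoops Ω L x₀ δ) {y | y ≠ 0} (Metric.ball x₀ r) fun z =>
        fderiv ℝ ξ z (localHor L z (X z.1)) +
          fderiv ℝ (fun y => localConn L (z.1, y) (X z.1)) z.2 (ξ z) := by
  obtain ⟨k, ε₂, φ, ρ, hφ⟩ := hξ
  have hU : IsOpen {y : Coord n | y ≠ 0} := isOpen_ne
  have hG := isDiffeoFamily_polygonLoops hδ h V
  obtain ⟨r, hr, ε₁, hε₁, hrV, h₁⟩ := exists_isSmallField hδ.pos hV hx₀ hX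
  set ε := min ε₁ ε₂
  have hε : 0 < ε := lt_min hε₁ hφ.pos
  have h0 : (0 : ℝ) ∈ Ioo (-ε) ε := ⟨by linarith, hε⟩
  have hX' := h₁ r le_rfl ε (min_le_left _ _)
  replace hφ := hφ.mono Subset.rfl hε (min_le_right _ _)
  obtain ⟨ψ, hψ, hψG, hψU, hψl, hψr⟩ := hφ.exists_inverse hG hU hV
  set W := Metric.ball x₀ r
  have hneg : ∀ {a : Coord n}, a ∈ Metric.ball (0 : Coord n) δ → -a ∈ Metric.ball (0 : Coord n) δ :=
    fun ha => by simpa using ha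
  have hsub : curveDomain ε W {y : Coord n | y ≠ 0} ⊆ curveDomain ε V {y | y ≠ 0} :=
    prod_mono Subset.rfl (prod_mono hrV Subset.rfl)
  have hDo : IsOpen (curveDomain ε W {y : Coord n | y ≠ 0}) :=
    isOpen_Ioo.prod (hX'.isOpen.prod hU)
  have hsx : ContDiffOn ℝ ∞ (fun p : ℝ × Coord n × Coord n => p.1 • X p.2.1)
      (curveDomain ε W {y | y ≠ 0}) :=
    contDiffOn_fst.smul (hX'.smooth.comp (by fun_prop) fun p hp => hp.2.1)
  have hfst : ContDiffOn ℝ ∞ (fun p : ℝ × Coord n × Coord n => p.2.1)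
    (curveDomain ε W {y | y ≠ 0}) := by fun_prop
  have hsnd : ContDiffOn ℝ ∞ (fun p : ℝ × Coord n × Coord n => p.2.2)
    (curveDomain ε W {y | y ≠ 0}) := by fun_prop
  -- T carries the fibre at x to the fibre at x + tX(x), and S carries it back. The same t drives
  -- the base point and the loop φ(t, x + tX, ·); hence the need for curves smooth in x.
  let T : ℝ × Coord n × Coord n → Coord n := fun p =>
    segmentTransport Ω L (p.2.1, p.1 • X p.2.1, p.2.2)
  let S : ℝ × Coord n × Coord n → Coord n := fun p =>
    segmentTransport Ω L (p.2.1 + p.1 • X p.2.1, -(p.1 • X p.2.1), p.2.2)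
  have hT : ContDiffOn ℝ ∞ T (curveDomain ε W {y | y ≠ 0}) :=
    hδ.contDiffOn.comp (hfst.prodMk (hsx.prodMk hsnd)) fun p hp =>
      ⟨hX'.subset_ball hp.2.1, hX'.smul_mem _ hp.2.1 _ hp.1, hp.2.2⟩
  have hS : ContDiffOn ℝ ∞ S (curveDomain ε W {y | y ≠ 0}) :=
    hδ.contDiffOn.comp ((hfst.add hsx).prodMk (hsx.neg.prodMk hsnd)) fun p hp =>
      ⟨hVδ (hX'.add_mem _ hp.2.1 _ hp.1), hneg (hX'.smul_mem _ hp.2.1 _ hp.1), hp.2.2⟩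
  have hTU : ∀ p ∈ curveDomain ε W {y | y ≠ 0}, T p ∈ {y : Coord n | y ≠ 0} := fun p hp =>
    hδ.transport_ne_zero h (hX'.subset_ball hp.2.1) (hX'.smul_mem _ hp.2.1 _ hp.1) hp.2.2
  have hST : ∀ p ∈ curveDomain ε W {y | y ≠ 0}, S (p.1, p.2.1, T p) = p.2.2 := fun p hp =>
    hδ.transport_neg h (hX'.subset_ball hp.2.1) (hX'.smul_mem _ hp.2.1 _ hp.1) hp.2.2
  have hT0 : ∀ x ∈ W, ∀ y ≠ 0, T (0, x, y) = y := fun x hx y hy => by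
    simp only [T, zero_smul, hδ.transport_zero h (hX'.subset_ball hx) hy]
  have hS0 : ∀ x ∈ W, ∀ y ≠ 0, S (0, x, y) = y := fun x hx y hy => by
    simp only [S, zero_smul, neg_zero, add_zero, hδ.transport_zero h (hX'.subset_ball hx) hy]
  have hmove : ∀ p ∈ curveDomain ε W {y : Coord n | y ≠ 0},
      (p.1, p.2.1 + p.1 • X p.2.1, p.2.2) ∈ curveDomain ε V {y : Coord n | y ≠ 0} := fun p hp =>
    ⟨hp.1, hX'.add_mem _ hp.2.1 _ hp.1, hp.2.2⟩
  let ρ' : ℝ × Coord n × Coord n → Coord n := fun p => ρ (p.1, p.2.1 + p.1 • X p.2.1, p.2.2)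
  have hρ' : ContDiffOn ℝ ∞ ρ' (curveDomain ε W {y | y ≠ 0}) :=
    hφ.smooth.comp (contDiffOn_fst.prodMk ((hfst.add hsx).prodMk hsnd)) hmove
  let q : ℝ × Coord n × Coord n → Coord n := fun p => dslope (fun t => S (t, p.2)) 0 p.1
  have hq : ContDiffOn ℝ ∞ q (curveDomain ε W {y | y ≠ 0}) :=
    contDiffOn_dslope hDo (fun t z hz => ⟨h0, hz.2⟩) hS
  have hSq : ∀ p ∈ curveDomain ε W {y | y ≠ 0}, S p = p.2.2 + p.1 • q p := fun p hp => by
    have := dslope_decomp (fun t => S (t, p.2)) p.1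
    rw [show (0, p.2) = ((0 : ℝ), p.2.1, p.2.2) from rfl, hS0 _ hp.2.1 _ hp.2.2] at this
    exact this
  obtain ⟨D, μ, hDm, hμ, hμe, hμ0⟩ := IsTangentTo.exists_expansion hU hX'.isOpen hq hρ'
  have hTm : ∀ p ∈ curveDomain ε W {y | y ≠ 0},
      (p.1, p.2.1, T p) ∈ curveDomain ε W {y : Coord n | y ≠ 0} := fun p hp =>
    ⟨hp.1, hp.2.1, hTU p hp⟩
  have hφm : ∀ p ∈ curveDomain ε W {y | y ≠ 0},
      φ (p.1, p.2.1 + p.1 • X p.2.1, p.2.2) = p.2.2 + p.1 ^ k • ρ' p := fun p hp =>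
    hφ.eq _ (hmove p hp)
  have hφU : ∀ p ∈ curveDomain ε W {y | y ≠ 0}, p.2.2 + p.1 ^ k • ρ' p ∈ {y : Coord n | y ≠ 0} :=
    fun p hp => by rw [← hφm p hp]; exact hφ.map_mem hG _ (hmove p hp)
  let g : ℝ × Coord n × Coord n → Coord n := fun p => ρ' (p.1, p.2.1, T p) - ρ p
  have hg : ContDiffOn ℝ ∞ g (curveDomain ε W {y | y ≠ 0}) :=
    (contDiffOn_comp_curveDomain hρ' hT hTU).sub (hφ.smooth.mono hsub)
  let γ : ℝ × Coord n × Coord n → Coord n := fun p =>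
    dslope (fun t => g (t, p.2)) 0 p.1 + μ (p.1 ^ k, p.1, p.2.1, T p)
  have hγ : ContDiffOn ℝ ∞ γ (curveDomain ε W {y | y ≠ 0}) := by
    refine (contDiffOn_dslope hDo (fun t z hz => ⟨h0, hz.2⟩) hg).add ?_
    have hj : ContDiffOn ℝ ∞ (fun p : ℝ × Coord n × Coord n => (p.1 ^ k, p.1, p.2.1, T p))
        (curveDomain ε W {y | y ≠ 0}) :=
      ContDiffOn.prodMk (by fun_prop) (ContDiffOn.prodMk (by fun_prop) (hfst.prodMk hT))
    exact hμ.comp hj fun p hp => hDm _ (p.1, p.2.1, T p) (hTm p hp) (hφU _ (hTm p hp))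
  -- Write S = id + tq. Then S(T + tᵏρ') = S(T) + tᵏρ' + tᵏ⁺¹μ with S(T) = y, and ρ' at T(y) differs
  -- from ρ at y by t times a difference quotient. Both corrections have order k + 1.
  have hconj : ∀ p ∈ curveDomain ε W {y | y ≠ 0},
      S (p.1, p.2.1, φ (p.1, p.2.1 + p.1 • X p.2.1, T p)) = φ p + p.1 ^ (k + 1) • γ p := by
    intro p hp
    have hp' := hTm p hp
    have e1 := hφm _ hp'
    have e2 := hμe (p.1 ^ k) _ hp' (hφU _ hp')
    have e3 := hSq _ hp'
    have e4 := dslope_decomp (fun t => g (t, p.2)) p.1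
    simp only at e1 e2 e3
    rw [hST p hp] at e3
    rw [e1, hSq (p.1, p.2.1, T p + p.1 ^ k • ρ' (p.1, p.2.1, T p)) ⟨hp.1, hp.2.1, hφU _ hp'⟩]
    simp only
    rw [e2, hφ.eq p (hsub hp)]
    have e5 : g (0, p.2) = 0 := by
      simp only [g, ρ', zero_smul, add_zero]
      rw [show ((0 : ℝ), p.2) = (0, p.2.1, p.2.2) from rfl, hT0 _ hp.2.1 _ hp.2.2, sub_self]
    have e6 : ρ' (p.1, p.2.1, T p) = ρ p + p.1 • dslope (fun t => g (t, p.2)) 0 p.1 := by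
      rw [e5, zero_add] at e4
      rw [← e4]
      simp only [g]
      rw [show (p.1, p.2) = p from rfl]
      abel
    have e7 : T p = p.2.2 - p.1 • q (p.1, p.2.1, T p) := by rw [e3]; abel
    simp only [γ]
    rw [e6]
    nth_rewrite 1 [e7]
    rw [pow_succ]
    simp only [smul_add, smul_smul]
    rw [mul_comm p.1 (p.1 ^ k)]
    abel
  have hψm : ∀ p ∈ curveDomain ε W {y | y ≠ 0},
      (p.1, p.2.1, ψ p) ∈ curveDomain ε W {y : Coord n | y ≠ 0} := fun p hp =>
    ⟨hp.1, hp.2.1, hψU p (hsub hp)⟩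
  refine ⟨r, hr, hrV, k + 1, ε,
    fun p => S (p.1, p.2.1, φ (p.1, p.2.1 + p.1 • X p.2.1, T (p.1, p.2.1, ψ p))),
    fun p => γ (p.1, p.2.1, ψ p), by omega, hε, fun t ht x hx => ?_,
    contDiffOn_comp_curveDomain hγ (hψ.mono hsub) fun p hp => hψU p (hsub hp), fun p hp => ?_,
    fun x hx y hy => ?_⟩
  · have s1 : IsPolygonTransport Ω L x₀ δ x x fun y => ψ (t, x, y) := hψG t ht x (hrV hx)
    have s2 : IsPolygonTransport Ω L x₀ δ x (x + t • X x) fun y => T (t, x, y) :=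
      .segment (hX'.subset_ball hx) (hX'.smul_mem x hx t ht) (hVδ (hX'.add_mem x hx t ht)) rfl
    have s3 : IsPolygonTransport Ω L x₀ δ (x + t • X x) (x + t • X x)
      fun y => φ (t, x + t • X x, y) := hφ.mem t ht _ (hX'.add_mem x hx t ht)
    have s4 : IsPolygonTransport Ω L x₀ δ (x + t • X x) x fun y => S (t, x, y) :=
      .segment (hVδ (hX'.add_mem x hx t ht)) (hneg (hX'.smul_mem x hx t ht))
        (hX'.subset_ball hx) (by abel)
    exact ((s1.trans s2).trans s3).trans s4
  · have e2 : φ (p.1, p.2.1, ψ p) = p.2.2 := hψr p (hsub hp)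
    have e1 : S (p.1, p.2.1, φ (p.1, p.2.1 + p.1 • X p.2.1, T (p.1, p.2.1, ψ p))) =
      φ (p.1, p.2.1, ψ p) + p.1 ^ (k + 1) • γ (p.1, p.2.1, ψ p) := hconj _ (hψm p hp)
    rw [e2] at e1
    exact e1
  · have hz := hδ.mem_of_mem_ball (hX'.subset_ball hx) hy
    have hψ0 : ψ (0, x, y) = y := by
      have := hψl (0, x, y) ⟨h0, hrV hx, hy⟩
      rwa [hφ.map_zero (hrV hx) hy] at this
    simp only [hψ0, γ, dslope_same, zero_pow (show k ≠ 0 by have := hφ.order; omega), hT0 x hx y hy]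
    rw [hμ0 (0, x, y) ⟨h0, hx, hy⟩]
    -- The difference quotient of ρ' gives the derivative of ξ along Xʰ; μ gives the fibre
    -- derivative of q, where q = NX at t = 0, applied to ξ.
    congr 1
    · have hopen : IsOpen (curveDomain ε V {y : Coord n | y ≠ 0}) :=
        isOpen_Ioo.prod (hV.prod hU)
      have hmem : ((0 : ℝ), x, y) ∈ curveDomain ε V {y : Coord n | y ≠ 0} := ⟨h0, hrV hx, hy⟩
      have hρd : DifferentiableAt ℝ ρ (0, x, y) :=
        (hφ.smooth.contDiffAt (hopen.mem_nhds hmem)).differentiableAt (by simp)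
      have e5 : ξ =ᶠ[𝓝 (x, y)] fun z => ρ (0, z) := by
        filter_upwards [(hV.prod hU).mem_nhds ⟨hrV hx, hy⟩] with z hz'
        exact (hφ.zero z.1 hz'.1 z.2 hz'.2).symm
      rw [e5.fderiv_eq]
      exact (hδ.hasDerivAt_comp_transport h (hX'.subset_ball hx) (X x) hy hρd).deriv
    · have hρ0 : ρ' (0, x, y) = ξ (x, y) := by
        simp only [ρ', zero_smul, add_zero]
        exact hφ.zero x (hrV hx) y hy
      rw [hρ0]
      have : (fun y => q (0, x, y)) =ᶠ[𝓝 y] fun y => localConn L (x, y) (X x) := by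
        filter_upwards [hU.mem_nhds hy] with z hz'
        have hxb := hX'.subset_ball hx
        change dslope (fun t => S (t, x, z)) 0 0 = _
        rw [dslope_same]
        exact (hδ.hasDerivAt_transport_back h hxb (X x) hz').deriv
      rw [this.fderiv_eq]

end TangentLoops

/-! ### Induced charts of the tangent bundle and their transition maps. -/

section Charts

variable {n : ℕ} {M : Type*} [TopologicalSpace M] [ChartedSpace (Coord n) M]
  [IsManifold (Mdl n) ∞ M]

/-- The chart of `TM` that is induced by the preferred chart of `M` at `o`. -/
abbrev tchart (o : M) : PartialEquiv (TangentBundle (Mdl n) M) (Coord n × Coord n) :=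
  extChartAt (Mdl n).tangent (⟨o, 0⟩ : TangentBundle (Mdl n) M)

/-- The change from the chart at `o` to the chart at `o'`. -/
def transition (o o' : M) (x : Coord n) : Coord n :=
  extChartAt (Mdl n) o' ((extChartAt (Mdl n) o).symm x)

/-- The domain of `transition o o'`. -/
def overlap (o o' : M) : Set (Coord n) :=
  (extChartAt (Mdl n) o).target ∩ (extChartAt (Mdl n) o).symm ⁻¹' (extChartAt (Mdl n) o').source

theorem isOpen_overlap (o o' : M) : IsOpen (overlap (n := n) o o') :=
  (continuousOn_extChartAt_symm o).isOpen_inter_preimage (isOpen_extChartAt_target o)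
    (isOpen_extChartAt_source o')

theorem transition_mem {o o' : M} {x : Coord n} (hx : x ∈ overlap o o') :
    transition o o' x ∈ overlap o' o := by
  refine ⟨(extChartAt (Mdl n) o').map_source hx.2, ?_⟩
  simp only [transition, mem_preimage, (extChartAt (Mdl n) o').left_inv hx.2]
  exact (extChartAt (Mdl n) o).map_target hx.1

theorem transition_transition {o o' : M} {x : Coord n} (hx : x ∈ overlap o o') :
    transition o' o (transition o o' x) = x := by
  simp only [transition, (extChartAt (Mdl n) o').left_inv hx.2,
    (extChartAt (Mdl n) o).right_inv hx.1]

theorem contDiffOn_transition (o o' : M) : ContDiffOn ℝ ∞ (transition (n := n) o o') (overlap o o') :=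
  by
  have h1 : ContMDiffOn 𝓘(ℝ, Coord n) (Mdl n) ∞ (extChartAt (Mdl n) o).symm (overlap o o') :=
    (contMDiffOn_extChartAt_symm o).mono inter_subset_left
  have h2 : ContMDiffOn (Mdl n) 𝓘(ℝ, Coord n) ∞ (extChartAt (Mdl n) o')
      (extChartAt (Mdl n) o').source := by
    rw [extChartAt_source]
    exact contMDiffOn_extChartAt
  exact contMDiffOn_iff_contDiffOn.1 (h2.comp h1 fun x hx => hx.2)

theorem fderiv_transition {o o' z : M} (hz : z ∈ (extChartAt (Mdl n) o).source)
    (hz' : z ∈ (extChartAt (Mdl n) o').source) :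
    fderiv ℝ (transition (n := n) o o') (extChartAt (Mdl n) o z) =
      tangentCoordChange (Mdl n) o o' z := by
  have := hasFDerivWithinAt_tangentCoordChange (I := Mdl n) ⟨hz, hz'⟩
  rw [modelWithCornersSelf_coe, range_id, hasFDerivWithinAt_univ] at this
  exact this.fderiv

theorem tchart_apply (o : M) (v : TangentBundle (Mdl n) M) :
    tchart o v = (extChartAt (Mdl n) o v.1, tangentCoordChange (Mdl n) v.1 o v.1 v.2) := rfl

theorem tchart_symm_apply (o : M) (z : Coord n × Coord n) :
    (tchart o).symm z = (⟨(extChartAt (Mdl n) o).symm z.1,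
      tangentCoordChange (Mdl n) o ((extChartAt (Mdl n) o).symm z.1)
        ((extChartAt (Mdl n) o).symm z.1) z.2⟩ : TangentBundle (Mdl n) M) := rfl

theorem mem_tchart_source {o : M} {v : TangentBundle (Mdl n) M} :
    v ∈ (tchart o).source ↔ v.1 ∈ (extChartAt (Mdl n) o).source := by
  rw [extChartAt_source, extChartAt_source]
  exact TangentBundle.mem_chart_source_iff _ _

theorem mem_tchart_target {o : M} {z : Coord n × Coord n} :
    z ∈ (tchart o).target ↔ z.1 ∈ (extChartAt (Mdl n) o).target := by
  rw [FiberBundle.extChartAt_target]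
  simp only [mem_prod, mem_univ, and_true, mem_inter_iff, mem_preimage,
    TangentBundle.trivializationAt_baseSet]
  refine ⟨fun h => h.1, fun h => ⟨h, ?_⟩⟩
  rw [← extChartAt_source (Mdl n)]
  exact (extChartAt (Mdl n) o).map_target h

theorem tchart_center (o : M) (y : Coord n) :
    tchart o (⟨o, y⟩ : TangentBundle (Mdl n) M) = (extChartAt (Mdl n) o o, y) := by
  rw [tchart_apply]
  exact Prod.ext rfl (tangentCoordChange_self (mem_extChartAt_source o))

theorem tchart_symm_center (o : M) (y : Coord n) :
    (tchart o).symm (extChartAt (Mdl n) o o, y) = (⟨o, y⟩ : TangentBundle (Mdl n) M) := by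
  rw [← tchart_center]
  exact (tchart o).left_inv (mem_tchart_source.2 (mem_extChartAt_source o))

/-- The cocycle identity for tangent coordinate changes. It is the bridge between the bundle TM and
the coordinate transformation laws. -/
theorem tchart_tchart_symm {o o' : M} {z : Coord n × Coord n} (hz : z.1 ∈ overlap o o') :
    tchart o' ((tchart (n := n) o).symm z) = tangentLift (transition o o') z := by
  have h1 : (extChartAt (Mdl n) o).symm z.1 ∈ (extChartAt (Mdl n) o).source :=
    (extChartAt (Mdl n) o).map_target hz.1
  rw [tchart_apply, tangentLift]
  refine Prod.ext rfl ?_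
  conv_rhs => rw [← (extChartAt (Mdl n) o).right_inv hz.1]
  rw [fderiv_transition h1 hz.2]
  exact tangentCoordChange_comp ⟨⟨h1, mem_extChartAt_source _⟩, hz.2⟩

/-- The differential of the chart of `TM` at `o`, where `T_v TM` is `ℝⁿ × ℝⁿ` by means of the chart
at `v`. -/
def chartDeriv (o : M) (v : TangentBundle (Mdl n) M) : Coord n × Coord n →L[ℝ] Coord n × Coord n :=
  mfderiv (Mdl n).tangent 𝓘(ℝ, Coord n × Coord n) (tchart o) v

theorem mdifferentiableAt_tchart {o : M} {v : TangentBundle (Mdl n) M}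
    (hv : v.1 ∈ (extChartAt (Mdl n) o).source) :
    MDifferentiableAt (Mdl n).tangent 𝓘(ℝ, Coord n × Coord n) (tchart o) v :=
  (contMDiffAt_extChartAt' (n := ∞) (by
    rw [← extChartAt_source (Mdl n).tangent]
    exact mem_tchart_source.2 hv)).mdifferentiableAt (by simp)

theorem isInvertible_chartDeriv {o : M} {v : TangentBundle (Mdl n) M}
    (hv : v.1 ∈ (extChartAt (Mdl n) o).source) : (chartDeriv o v).IsInvertible :=
  isInvertible_mfderiv_extChartAt (mem_tchart_source.2 hv)

theorem extChartAt_mem_overlap {o o' : M} {x : M} (hx : x ∈ (extChartAt (Mdl n) o).source)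
    (hx' : x ∈ (extChartAt (Mdl n) o').source) : extChartAt (Mdl n) o x ∈ overlap (n := n) o o' :=
  ⟨(extChartAt (Mdl n) o).map_source hx, by
    simpa only [mem_preimage, (extChartAt (Mdl n) o).left_inv hx] using hx'⟩

theorem tchart_symm_eventuallyEq {o o' : M} {z : Coord n × Coord n} (hz : z.1 ∈ overlap o o') :
    (fun w => tchart o' ((tchart (n := n) o).symm w)) =ᶠ[𝓝 z] tangentLift (transition o o') := by
  have : ∀ᶠ w : Coord n × Coord n in 𝓝 z, w.1 ∈ overlap o o' :=
    continuousAt_fst.eventually_mem ((isOpen_overlap o o').mem_nhds hz)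
  filter_upwards [this] with w hw using tchart_tchart_symm hw

/-- T_v TM is read in the chart at v, so the differential of another chart is that of the transition
map. -/
theorem chartDeriv_eq {o : M} {v : TangentBundle (Mdl n) M}
    (hv : v.1 ∈ (extChartAt (Mdl n) o).source) :
    chartDeriv o v = fderiv ℝ (tangentLift (transition v.1 o)) (tchart v.1 v) := by
  have h1 : HasFDerivWithinAt (fun w => tchart o ((tchart v.1).symm w)) (chartDeriv o v)
      (range (Mdl n).tangent) (tchart v.1 v) := (mdifferentiableAt_tchart hv).hasMFDerivAt.2
  rw [ModelWithCorners.range_eq_univ, hasFDerivWithinAt_univ] at h1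
  refine h1.fderiv.symm.trans (Filter.EventuallyEq.fderiv_eq ?_)
  exact tchart_symm_eventuallyEq (extChartAt_mem_overlap (mem_extChartAt_source _) hv)

end Charts

/-! ### Positivity of the norm and the bracket of horizontal fields. -/

section LocalFinsler

variable {n : ℕ} {Ω : Set (Coord n)} {L : Coord n × Coord n → ℝ}

theorem IsLocalFinsler.mono (h : IsLocalFinsler Ω L) {V : Set (Coord n)} (hV : IsOpen V)
    (hVΩ : V ⊆ Ω) : IsLocalFinsler V L :=
  ⟨hV, h.smooth.mono (prod_mono hVΩ Subset.rfl), fun x hx => h.homogeneous x (hVΩ hx),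
    fun z hz => h.pos z ⟨hVΩ hz.1, hz.2⟩⟩

theorem IsLocalFinsler.norm_pos (h : IsLocalFinsler Ω L) {z : Coord n × Coord n} (hz : z ∈ slit Ω) :
    0 < L z := by
  have h1 := h.pos' hz hz.2
  rw [h.euler_fderiv hz, h.euler hz] at h1
  linarith

/-- The base components are constant, so the bracket is vertical with component −D(Nb)(aʰ) +
D(Na)(bʰ). -/
theorem lieBracket_localHor (h : IsLocalFinsler Ω L) {z : Coord n × Coord n} (hz : z ∈ slit Ω)
    (a b : Coord n) : VectorField.lieBracket ℝ (fun w => localHor L w a) (fun w => localHor L w b) z =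
      (0, localCurv L z a b) := by
  have hd : ∀ a : Coord n, fderiv ℝ (fun w => localHor L w a) z =
      (0 : Coord n × Coord n →L[ℝ] Coord n).prod (-fderiv ℝ (fun w => localConn L w a) z) := by
    intro a
    have hN : HasFDerivAt (fun w => localConn L w a) (fderiv ℝ (fun w => localConn L w a) z) z :=
      (((h.smooth_localConn_const a).contDiffAt (h.mem_nhds hz)).differentiableAt
        (by simp)).hasFDerivAt
    exact ((hasFDerivAt_const a z).prodMk hN.neg).fderiv
  rw [VectorField.lieBracket, hd, hd, localCurv]
  ext <;> simp [sub_eq_add_neg, add_comm]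

end LocalFinsler

/-! ### A Finsler manifold seen in its charts. -/

section FinslerManifold

variable {n : ℕ} {M : Type*} [TopologicalSpace M] [ChartedSpace (Coord n) M]
  [IsManifold (Mdl n) ∞ M] {F : TangentBundle (Mdl n) M → ℝ}

theorem tchart_symm_snd_ne_zero {o : M} {z : Coord n × Coord n}
    (hz : z ∈ slit (extChartAt (Mdl n) o).target) : ((tchart (n := n) o).symm z).2 ≠ 0 := by
  intro h0
  have h1 := (tchart (n := n) o).right_inv (mem_tchart_target.2 hz.1)
  rw [tchart_apply, h0] at h1
  refine hz.2 ?_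
  rw [← h1]
  exact map_zero _

theorem tchart_mem_slit {o : M} {v : TangentBundle (Mdl n) M}
    (hv : v.1 ∈ (extChartAt (Mdl n) o).source) (hv0 : v.2 ≠ 0) :
    tchart o v ∈ slit (extChartAt (Mdl n) o).target := by
  refine ⟨(extChartAt (Mdl n) o).map_source hv, fun h0 => hv0 ?_⟩
  have h1 := (tchart (n := n) o).left_inv (mem_tchart_source.2 hv)
  rw [show tchart o v = ((tchart o v).1, (0 : Coord n)) from Prod.ext rfl h0, tchart_symm_apply,
    map_zero] at h1
  rw [← h1]
  rfl

/-- The norm on the fibre at `x` in the coordinates of the chart at `x`. -/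
def fibreNorm (F : TangentBundle (Mdl n) M → ℝ) (x : M) (y : Coord n) : ℝ := F ⟨x, y⟩

theorem tangentLift_transition {o : M} {v : TangentBundle (Mdl n) M}
    (hv : v.1 ∈ (extChartAt (Mdl n) o).source) :
    tangentLift (transition v.1 o) (tchart v.1 v) = tchart o v := by
  rw [← tchart_tchart_symm (extChartAt_mem_overlap (mem_extChartAt_source _) hv),
    (tchart (n := n) v.1).left_inv (mem_tchart_source.2 (mem_extChartAt_source _))]

theorem tchart_mem_slit_overlap {o : M} {v : TangentBundle (Mdl n) M}
    (hv : v.1 ∈ (extChartAt (Mdl n) o).source) (hv0 : v.2 ≠ 0) :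
    tchart v.1 v ∈ slit (overlap v.1 o) :=
  ⟨extChartAt_mem_overlap (mem_extChartAt_source _) hv,
    (tchart_mem_slit (mem_extChartAt_source _) hv0).2⟩

namespace IsFinsler

variable (hF : IsFinsler F)
include hF

theorem map_zero (x : M) : F ⟨x, 0⟩ = 0 := by
  have := hF.homogeneous x 0 2 two_pos
  rw [smul_zero] at this
  linarith

theorem fibreNorm_smul (x : M) (y : Coord n) {a : ℝ} (ha : 0 < a) :
    fibreNorm F x (a • y) = a * fibreNorm F x y := hF.homogeneous x y a ha

theorem snd_ne_zero {v : TangentBundle (Mdl n) M} (hv : v ∈ indicatrixBundle F) : v.2 ≠ 0 := by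
  intro h0
  have h1 : F ⟨v.1, v.2⟩ = 1 := hv
  rw [h0, hF.map_zero] at h1
  exact zero_ne_one h1

theorem contMDiffOn_comp_tchart_symm (o : M) :
    ContDiffOn ℝ ∞ (fun z => F ((tchart o).symm z)) (slit (extChartAt (Mdl n) o).target) := by
  have h1 : ContMDiffOn 𝓘(ℝ, Coord n × Coord n) (Mdl n).tangent ∞ (tchart (n := n) o).symm
      (slit (extChartAt (Mdl n) o).target) :=
    (contMDiffOn_extChartAt_symm _).mono fun z hz => mem_tchart_target.2 hz.1
  exact contMDiffOn_iff_contDiffOn.1 (hF.smooth.comp h1 fun z hz => tchart_symm_snd_ne_zero hz)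

/-- Positivity is `posDef` read through the linear map A from the fibre of the chart to T_xM. The
iterated one-variable derivatives of `fundamentalForm` become Fréchet derivatives along y + tu,
valid as long as y + su ≠ 0, that is, for small s. -/
theorem isLocalFinsler (o : M) :
    IsLocalFinsler (extChartAt (Mdl n) o).target (normSqInChart F o) := by
  have hopen : IsOpen (slit (extChartAt (Mdl n) o).target) :=
    (isOpen_extChartAt_target o).prod isOpen_ne
  have hs : ContDiffOn ℝ ∞ (normSqInChart F o) (slit (extChartAt (Mdl n) o).target) :=
    (hF.contMDiffOn_comp_tchart_symm o).pow 2
  refine ⟨isOpen_extChartAt_target o, hs, fun x hx y a ha => ?_, fun z hz u hu => ?_⟩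
  · change fibreNorm F _ (tangentCoordChange (Mdl n) o _ _ (a • y)) ^ 2 =
      a ^ 2 * fibreNorm F _ (tangentCoordChange (Mdl n) o _ _ y) ^ 2
    rw [map_smul, hF.fibreNorm_smul _ _ ha, mul_pow]
    rfl
  · let A : Coord n →L[ℝ] Coord n := tangentCoordChange (Mdl n) o ((extChartAt (Mdl n) o).symm z.1)
      ((extChartAt (Mdl n) o).symm z.1)
    have hpos := hF.posDef ((extChartAt (Mdl n) o).symm z.1) (A z.2) (A u)
      (tchart_symm_snd_ne_zero hz) (tchart_symm_snd_ne_zero (z := (z.1, u)) ⟨hz.1, hu⟩)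
    have hL : ∀ y : Coord n, fibreNorm F ((extChartAt (Mdl n) o).symm z.1) (A y) ^ 2 =
        normSqInChart F o (z.1, y) := fun y => rfl
    have hline : ∀ y : Coord n, HasDerivAt (fun t : ℝ => (z.1, y + t • u)) (0, u) 0 := fun y => by
      have : HasDerivAt (fun t : ℝ => y + t • u) u 0 := by
        simpa using ((hasDerivAt_id (0 : ℝ)).smul_const u).const_add y
      exact (hasDerivAt_const (0 : ℝ) z.1).prodMk this
    have hdL : ∀ w ∈ slit (extChartAt (Mdl n) o).target,
        HasFDerivAt (normSqInChart F o) (fderiv ℝ (normSqInChart F o) w) w := fun w hw =>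
      ((hs.contDiffAt (hopen.mem_nhds hw)).differentiableAt (by simp)).hasFDerivAt
    have h1 : ∀ s : ℝ, z.2 + s • u ≠ 0 →
        deriv (fun t : ℝ => fibreNorm F ((extChartAt (Mdl n) o).symm z.1)
          (A z.2 + s • A u + t • A u) ^ 2) 0 = fderiv ℝ (normSqInChart F o) (z.1, z.2 + s • u) (0, u) := by
      intro s hs
      simp only [← map_smul, ← map_add, hL]
      exact (HasFDerivAt.comp_hasDerivAt_of_eq (0 : ℝ) (hdL (z.1, z.2 + s • u) ⟨hz.1, hs⟩)
        (hline _) (by simp)).deriv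
    have h2 : (fun s : ℝ => deriv (fun t : ℝ => fibreNorm F ((extChartAt (Mdl n) o).symm z.1)
        (A z.2 + s • A u + t • A u) ^ 2) 0) =ᶠ[𝓝 0]
        fun s => fderiv ℝ (normSqInChart F o) (z.1, z.2 + s • u) (0, u) := by
      have : ∀ᶠ s : ℝ in 𝓝 0, z.2 + s • u ≠ 0 := by
        have hc : Continuous fun s : ℝ => z.2 + s • u := by fun_prop
        exact hc.continuousAt.eventually_ne (by simpa using hz.2)
      filter_upwards [this] with s hs using h1 s hs
    have h3 : HasFDerivAt (fun w => fderiv ℝ (normSqInChart F o) w (0, u))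
        (fderiv ℝ (fun w => fderiv ℝ (normSqInChart F o) w (0, u)) z) z :=
      ((((hs.fderiv_of_isOpen (m := ∞) hopen (by simp)).clm_apply contDiffOn_const).contDiffAt
        (hopen.mem_nhds hz)).differentiableAt (by simp)).hasFDerivAt
    have h4 := (HasFDerivAt.comp_hasDerivAt_of_eq (0 : ℝ) h3 (hline z.2) (by simp)).deriv
    have h5 : fundamentalForm F ((extChartAt (Mdl n) o).symm z.1) (A z.2) (A u) (A u) =
        1 / 2 * deriv (fun s : ℝ => fderiv ℝ (normSqInChart F o) (z.1, z.2 + s • u) (0, u)) 0 :=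
      congrArg (fun c : ℝ => 1 / 2 * c) h2.deriv_eq
    rw [h5] at hpos
    change 0 < 1 / 2 * deriv ((fun w => fderiv ℝ (normSqInChart F o) w (0, u)) ∘
      fun t : ℝ => (z.1, z.2 + t • u)) 0 at hpos
    rw [h4] at hpos
    linarith

theorem isCoordChange (o o' : M) : IsCoordChange (overlap o o') (overlap o' o)
    (normSqInChart F o) (normSqInChart F o') (transition o o') := by
  refine ⟨contDiffOn_transition o o', fun x hx => transition_mem hx, fun x hx => ?_, fun z hz => ?_⟩
  · have hd : ∀ {o o' : M} {x : Coord n}, x ∈ overlap o o' → DifferentiableAt ℝ (transition o o') x :=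
      fun {o o' x} hx => ((contDiffOn_transition o o').contDiffAt
        ((isOpen_overlap o o').mem_nhds hx)).differentiableAt (by simp)
    have h1 : HasFDerivAt (transition o' o ∘ transition o o') _ x :=
      (hd (transition_mem hx)).hasFDerivAt.comp x (hd hx).hasFDerivAt
    have h2 : HasFDerivAt (transition o' o ∘ transition o o') (ContinuousLinearMap.id ℝ _) x :=
      (hasFDerivAt_id x).congr_of_eventuallyEq (by
        filter_upwards [(isOpen_overlap o o').mem_nhds hx] with w hw using transition_transition hw)
    have h3 := h1.unique h2
    exact Function.LeftInverse.injective (g := fderiv ℝ (transition o' o) (transition o o' x))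
      fun a => congrArg (fun A : _ →L[ℝ] Coord n => A a) h3
  · rw [← tchart_tchart_symm hz.1]
    simp only [normSqInChart]
    rw [(tchart (n := n) o').left_inv (mem_tchart_source (v := (tchart o).symm z).2 hz.1.2)]

theorem isLocalFinsler_overlap (o o' : M) : IsLocalFinsler (overlap o o') (normSqInChart F o) :=
  (hF.isLocalFinsler o).mono (isOpen_overlap o o') inter_subset_left

/-- The lift is defined in the chart at the base point of v; the transformation law of horizontal
vectors carries it to the chart at o. -/
theorem chartDeriv_horizontalLift {o : M} {v : TangentBundle (Mdl n) M}
    (hv : v.1 ∈ (extChartAt (Mdl n) o).source) (hv0 : v.2 ≠ 0) (a : TangentSpace (Mdl n) v.1) :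
    chartDeriv o v (horizontalLift F v a) = localHor (normSqInChart F o) (tchart o v)
      (tangentCoordChange (Mdl n) v.1 o v.1 a) := by
  have h1 := (hF.isCoordChange v.1 o).localHor_tangentLift (hF.isLocalFinsler_overlap v.1 o)
    (hF.isLocalFinsler_overlap o v.1) (tchart_mem_slit_overlap hv hv0) a
  rw [tangentLift_transition hv] at h1
  have h2 := fderiv_transition (mem_extChartAt_source (I := Mdl n) v.1) hv
  change localHor _ _ (fderiv ℝ (transition v.1 o) (extChartAt (Mdl n) v.1 v.1) a) = _ at h1
  rw [h2] at h1
  rw [chartDeriv_eq hv, h1]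
  rfl

/-- The three brackets to which h is applied involve a constant field; they are vertical, since hA
and hB have constant base components, and h kills them. Only [hA, hB] remains. -/
theorem curvature_eq {v : TangentBundle (Mdl n) M} (hv0 : v.2 ≠ 0)
    (a b : TangentSpace (Mdl n) v.1) :
    curvature F v (horizontalLift F v a) (horizontalLift F v b) =
      ((0 : Coord n), localCurv (normSqInChart F v.1) (tchart v.1 v) a b) := by
  have h := hF.isLocalFinsler v.1
  have hz := tchart_mem_slit (mem_extChartAt_source (I := Mdl n) v.1) hv0
  have hvert : ∀ c : Coord n, horizontalProj F v.1 (tchart v.1 v) ((0 : Coord n), c) = 0 := by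
    intro c
    change ((0 : Coord n), -localConn (normSqInChart F v.1) (tchart v.1 v) 0) = 0
    rw [IsLocalFinsler.localConn_zero, neg_zero]
    rfl
  have hN : ∀ a : Coord n, DifferentiableAt ℝ (fun w => localConn (normSqInChart F v.1) w a)
      (tchart v.1 v) := fun a =>
    ((h.smooth_localConn_const a).contDiffAt (h.mem_nhds hz)).differentiableAt (by simp)
  have hd : ∀ a : Coord n, fderiv ℝ (fun w => localHor (normSqInChart F v.1) w a) (tchart v.1 v) =
      (0 : Coord n × Coord n →L[ℝ] Coord n).prod
        (-fderiv ℝ (fun w => localConn (normSqInChart F v.1) w a) (tchart v.1 v)) := fun a =>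
    ((hasFDerivAt_const a _).prodMk (hN a).hasFDerivAt.neg).fderiv
  have hc : ∀ C : Coord n × Coord n, fderiv ℝ (fun _ : Coord n × Coord n => C) (tchart v.1 v) = 0 :=
    fun C => by simp
  have t1 : ∀ (a : Coord n) (C : Coord n × Coord n),
      horizontalProj F v.1 (tchart v.1 v) (VectorField.lieBracket ℝ
        (fun w => localHor (normSqInChart F v.1) w a) (fun _ => C) (tchart v.1 v)) = 0 := by
    intro a C
    rw [VectorField.lieBracket, hd, hc]
    convert! hvert (fderiv ℝ (fun w => localConn (normSqInChart F v.1) w a) (tchart v.1 v) C) using 2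
    ext <;> simp
  have t2 : ∀ (a : Coord n) (C : Coord n × Coord n),
      horizontalProj F v.1 (tchart v.1 v) (VectorField.lieBracket ℝ (fun _ => C)
        (fun w => localHor (normSqInChart F v.1) w a) (tchart v.1 v)) = 0 := by
    intro a C
    rw [VectorField.lieBracket, hd, hc]
    convert! hvert (-fderiv ℝ (fun w => localConn (normSqInChart F v.1) w a) (tchart v.1 v) C) using 2
    ext <;> simp
  have t3 : ∀ C C' : Coord n × Coord n,
      horizontalProj F v.1 (tchart v.1 v) (VectorField.lieBracket ℝ (fun _ => C)
        (fun _ => C') (tchart v.1 v)) = 0 := by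
    intro C C'
    rw [VectorField.lieBracket, hc, hc]
    convert! hvert 0 using 2
    simp
    rfl
  have key : ∀ (a b : Coord n) (A B : Coord n × Coord n),
      VectorField.lieBracket ℝ (fun w => localHor (normSqInChart F v.1) w a)
        (fun w => localHor (normSqInChart F v.1) w b) (tchart v.1 v) -
      horizontalProj F v.1 (tchart v.1 v) (VectorField.lieBracket ℝ
        (fun w => localHor (normSqInChart F v.1) w a) (fun _ => B) (tchart v.1 v)) -
      horizontalProj F v.1 (tchart v.1 v) (VectorField.lieBracket ℝ (fun _ => A)
        (fun w => localHor (normSqInChart F v.1) w b) (tchart v.1 v)) +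
      horizontalProj F v.1 (tchart v.1 v) (VectorField.lieBracket ℝ (fun _ => A)
        (fun _ => B) (tchart v.1 v)) =
      (0, localCurv (normSqInChart F v.1) (tchart v.1 v) a b) := by
    intro a b A B
    rw [t1, t2, t3, lieBracket_localHor h hz]
    simp
  exact key a b _ _

theorem chartDeriv_curvature {o : M} {v : TangentBundle (Mdl n) M}
    (hv : v.1 ∈ (extChartAt (Mdl n) o).source) (hv0 : v.2 ≠ 0) (a b : TangentSpace (Mdl n) v.1) :
    chartDeriv o v (curvature F v (horizontalLift F v a) (horizontalLift F v b)) =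
      (0, localCurv (normSqInChart F o) (tchart o v) (tangentCoordChange (Mdl n) v.1 o v.1 a)
        (tangentCoordChange (Mdl n) v.1 o v.1 b)) := by
  have hz := tchart_mem_slit_overlap hv hv0
  have h1 := (hF.isCoordChange v.1 o).localCurv_tangentLift (hF.isLocalFinsler_overlap v.1 o)
    (hF.isLocalFinsler_overlap o v.1) hz a b
  rw [tangentLift_transition hv] at h1
  have h2 := fderiv_transition (mem_extChartAt_source (I := Mdl n) v.1) hv
  change localCurv _ _ (fderiv ℝ (transition v.1 o) (extChartAt (Mdl n) v.1 v.1) a)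
    (fderiv ℝ (transition v.1 o) (extChartAt (Mdl n) v.1 v.1) b) =
    fderiv ℝ (transition v.1 o) (extChartAt (Mdl n) v.1 v.1) _ at h1
  rw [h2] at h1
  rw [hF.curvature_eq hv0, chartDeriv_eq hv, (hF.isCoordChange v.1 o).fderiv_tangentLift
    (hF.isLocalFinsler_overlap v.1 o) hz.1, h1]
  simp only [ContinuousLinearMap.map_zero, zero_apply, add_zero]
  change (_, fderiv ℝ (transition v.1 o) (extChartAt (Mdl n) v.1 v.1) _) = _
  rw [h2]

end IsFinsler

end FinslerManifold

/-! ### Derivatives within level sets of homogeneous functions. -/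

section LevelSets

variable {E G : Type} [NormedAddCommGroup E] [NormedSpace ℝ E] [NormedAddCommGroup G]
  [NormedSpace ℝ G]

/-- A vector tangent to a level set of a function that is homogeneous in the directions of the range
of a projector is the velocity of a curve in the level set. -/
theorem exists_curve_in_level (P Q : E →L[ℝ] E) (hPQ : ∀ w, P w + Q w = w) {f : E → ℝ} {z A : E}
    (hhom : ∀ᶠ w in 𝓝 z, ∀ c : ℝ, 0 < c → f (P w + c • Q w) = c * f w) {f' : E →L[ℝ] ℝ}
    (hf : HasFDerivAt f f' z) (hz : f z = 1) (hA : f' A = 0) :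
    ∃ γ : ℝ → E, HasDerivAt γ A 0 ∧ γ 0 = z ∧ ∀ᶠ t in 𝓝 0, f (γ t) = 1 := by
  have hl : HasDerivAt (fun t : ℝ => z + t • A) A 0 := by
    simpa using ((hasDerivAt_id (0 : ℝ)).smul_const A).const_add z
  have hl0 : z + (0 : ℝ) • A = z := by simp
  have hfl : HasDerivAt (fun t : ℝ => f (z + t • A)) 0 0 := by
    have := HasFDerivAt.comp_hasDerivAt_of_eq (0 : ℝ) hf hl hl0.symm
    rwa [hA] at this
  have hinv : HasDerivAt (fun t : ℝ => (f (z + t • A))⁻¹) 0 0 := by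
    have := hfl.inv (by simp [hz])
    rw [neg_zero, zero_div] at this
    exact this
  have ht : Tendsto (fun t : ℝ => z + t • A) (𝓝 0) (𝓝 z) := by
    have := hl.continuousAt.tendsto
    rwa [hl0] at this
  -- The line z + tA is renormalised by 1/f in the Q directions. As f'(A) = 0, the factor has
  -- derivative 0 and the velocity stays A.
  refine ⟨fun t => P (z + t • A) + (f (z + t • A))⁻¹ • Q (z + t • A), ?_, ?_, ?_⟩
  · have := (P.hasFDerivAt.comp_hasDerivAt (0 : ℝ) hl).add
      (hinv.smul (Q.hasFDerivAt.comp_hasDerivAt (0 : ℝ) hl))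
    convert! this using 1
    simp [hz, hPQ]
  · simp [hz, hPQ]
  · have hpos : ∀ᶠ t : ℝ in 𝓝 0, 0 < f (z + t • A) := by
      have := hfl.continuousAt.eventually (lt_mem_nhds (a := 0) (by simp [hz]))
      exact this
    filter_upwards [ht.eventually hhom, hpos] with t h1 h2
    rw [h1 _ (inv_pos.2 h2), inv_mul_cancel₀ h2.ne']

/-- A derivative within a hypersurface is not unique, but on the velocity of a curve in S every such
derivative equals the derivative of g₀ along the curve. Hence brackets taken within S are well
determined in tangent directions. -/
theorem fderivWithin_apply_of_curve {S : Set E} {z A : E} {γ : ℝ → E} (hγ : HasDerivAt γ A 0)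
    (hγ0 : γ 0 = z) (hγS : ∀ᶠ t in 𝓝 0, γ t ∈ S) {g g₀ : E → G} (hg : DifferentiableAt ℝ g z)
    (heq : g₀ =ᶠ[𝓝[S] z] g) (hz : z ∈ S) : fderivWithin ℝ g₀ S z A = fderiv ℝ g z A := by
  have h0 : HasFDerivWithinAt g₀ (fderiv ℝ g z) S z :=
    hg.hasFDerivAt.hasFDerivWithinAt.congr_of_eventuallyEq heq (heq.eq_of_nhdsWithin hz)
  have h1 : HasFDerivWithinAt g₀ (fderivWithin ℝ g₀ S z) S z :=
    h0.differentiableWithinAt.hasFDerivWithinAt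
  have key : ∀ {g' : E →L[ℝ] G}, HasFDerivWithinAt g₀ g' S z → HasDerivAt (g₀ ∘ γ) (g' A) 0 := by
    intro g' h
    have h2 : HasDerivWithinAt (g₀ ∘ γ) (g' A) (γ ⁻¹' S) 0 :=
      HasFDerivWithinAt.comp_hasDerivWithinAt_of_eq (t := S) (0 : ℝ) h hγ.hasDerivWithinAt
        (fun t ht => ht) hγ0.symm
    exact h2.hasDerivAt hγS
  exact (key h1).unique (key h0)

theorem lieBracketWithin_eq_of_curves {S : Set E} {z : E} (hz : z ∈ S) {V W V₀ W₀ : E → E}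
    (hV : DifferentiableAt ℝ V z) (hW : DifferentiableAt ℝ W z) (hV₀ : V₀ =ᶠ[𝓝[S] z] V)
    (hW₀ : W₀ =ᶠ[𝓝[S] z] W)
    (hVS : ∃ γ : ℝ → E, HasDerivAt γ (V z) 0 ∧ γ 0 = z ∧ ∀ᶠ t in 𝓝 0, γ t ∈ S)
    (hWS : ∃ γ : ℝ → E, HasDerivAt γ (W z) 0 ∧ γ 0 = z ∧ ∀ᶠ t in 𝓝 0, γ t ∈ S) :
    VectorField.lieBracketWithin ℝ V₀ W₀ S z = VectorField.lieBracket ℝ V W z := by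
  obtain ⟨γ, h1, h2, h3⟩ := hVS
  obtain ⟨β, h4, h5, h6⟩ := hWS
  rw [VectorField.lieBracketWithin, VectorField.lieBracket, hV₀.eq_of_nhdsWithin hz,
    hW₀.eq_of_nhdsWithin hz, fderivWithin_apply_of_curve h1 h2 h3 hW hW₀ hz,
    fderivWithin_apply_of_curve h4 h5 h6 hV hV₀ hz]

end LevelSets

/-! ### The bracket on the indicatrix bundle in charts. -/

section BundleBracket

variable {n : ℕ} {M : Type*} [TopologicalSpace M] [ChartedSpace (Coord n) M]
  [IsManifold (Mdl n) ∞ M] {F : TangentBundle (Mdl n) M → ℝ}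

/-- `A` represents the field `ξ` in the chart at `o` near the point `v`. -/
def IsRepresentation (F : TangentBundle (Mdl n) M → ℝ) (o : M) (ξ : BundleField F)
    (U : Set (Coord n × Coord n)) (A : Coord n × Coord n → Coord n × Coord n) : Prop :=
  ∀ v : indicatrixBundle F, v.1.1 ∈ (extChartAt (Mdl n) o).source → tchart o v.1 ∈ U →
    chartDeriv o v.1 (ξ v) = A (tchart o v.1)

theorem chartDeriv_self (v : TangentBundle (Mdl n) M) :
    chartDeriv v.1 v = ContinuousLinearMap.id ℝ (Coord n × Coord n) :=
  mfderiv_extChartAt_self (I := (Mdl n).tangent) (x := v)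

theorem mpullbackWithin_tchart_symm {o : M} {z : Coord n × Coord n}
    (hz : z.1 ∈ (extChartAt (Mdl n) o).target)
    (V : (v : TangentBundle (Mdl n) M) → TangentSpace (Mdl n).tangent v) :
    VectorField.mpullbackWithin 𝓘(ℝ, Coord n × Coord n) (Mdl n).tangent (tchart o).symm V
      (range (Mdl n).tangent) z = chartDeriv o ((tchart o).symm z) (V ((tchart o).symm z)) := by
  have h1 := mfderiv_extChartAt_comp_mfderivWithin_extChartAt_symm (I := (Mdl n).tangent)
    (mem_tchart_target.2 hz)
  have h2 := mfderivWithin_extChartAt_symm_comp_mfderiv_extChartAt (I := (Mdl n).tangent)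
    (mem_tchart_target.2 hz)
  have h3 : (mfderivWithin 𝓘(ℝ, Coord n × Coord n) (Mdl n).tangent (tchart o).symm
      (range (Mdl n).tangent) z).inverse = chartDeriv o ((tchart o).symm z) :=
    ContinuousLinearMap.inverse_eq h2 h1
  exact congrArg (fun A : Coord n × Coord n →L[ℝ] Coord n × Coord n =>
    A (V ((tchart o).symm z))) h3

theorem tangentLift_tchart {o o' : M} {v : TangentBundle (Mdl n) M}
    (hv : v.1 ∈ (extChartAt (Mdl n) o).source) (hv' : v.1 ∈ (extChartAt (Mdl n) o').source) :
    tangentLift (transition o o') (tchart o v) = tchart o' v := by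
  rw [← tchart_tchart_symm (extChartAt_mem_overlap hv hv'),
    (tchart (n := n) o).left_inv (mem_tchart_source.2 hv)]

theorem contDiffAt_tangentLift_transition {o o' : M} {z : Coord n × Coord n}
    (hz : z.1 ∈ overlap o o') : ContDiffAt ℝ ∞ (tangentLift (transition o o')) z := by
  have h1 : ContDiffAt ℝ ∞ (transition (n := n) o o') z.1 :=
    (contDiffOn_transition o o').contDiffAt ((isOpen_overlap o o').mem_nhds hz)
  have h2 : ContDiffAt ℝ ∞ (fderiv ℝ (transition (n := n) o o')) z.1 :=
    h1.fderiv_right (by simp)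
  exact (h1.comp z contDiffAt_fst).prodMk ((h2.comp z contDiffAt_fst).clm_apply contDiffAt_snd)

theorem chartDeriv_comp {o o' : M} {v : TangentBundle (Mdl n) M}
    (hv : v.1 ∈ (extChartAt (Mdl n) o).source) (hv' : v.1 ∈ (extChartAt (Mdl n) o').source) :
    chartDeriv o' v = (fderiv ℝ (tangentLift (transition o o')) (tchart o v)).comp
      (chartDeriv o v) := by
  have hs := mem_extChartAt_source (I := Mdl n) v.1
  have hd : ∀ {o o' : M}, v.1 ∈ (extChartAt (Mdl n) o).source →
      v.1 ∈ (extChartAt (Mdl n) o').source → HasFDerivAt (tangentLift (transition (n := n) o o'))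
      (fderiv ℝ (tangentLift (transition o o')) (tchart o v)) (tchart o v) := fun h h' =>
    ((contDiffAt_tangentLift_transition (z := tchart _ v)
      (extChartAt_mem_overlap h h')).differentiableAt (by simp)).hasFDerivAt
  have h1 := hd hv hv'
  rw [← tangentLift_tchart hs hv] at h1
  have h2 := h1.comp (tchart v.1 v) (hd hs hv)
  rw [chartDeriv_eq hv', chartDeriv_eq hv, ← tangentLift_tchart hs hv, ← h2.fderiv]
  refine Filter.EventuallyEq.fderiv_eq ?_
  have h3 : ∀ᶠ w : Coord n × Coord n in 𝓝 (tchart v.1 v), w.1 ∈ overlap v.1 o :=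
    continuousAt_fst.eventually_mem ((isOpen_overlap v.1 o).mem_nhds (extChartAt_mem_overlap hs hv))
  have h4 : ∀ᶠ w : Coord n × Coord n in 𝓝 (tchart v.1 v), w.1 ∈ overlap v.1 o' :=
    continuousAt_fst.eventually_mem
      ((isOpen_overlap v.1 o').mem_nhds (extChartAt_mem_overlap hs hv'))
  filter_upwards [h3, h4] with w h3 h4
  rw [Function.comp_apply, ← tchart_tchart_symm h3, ← tchart_tchart_symm h4]
  exact (tangentLift_tchart (v := (tchart v.1).symm w) h3.2 h4.2).symm

theorem bundleExt_of_mem (ξ : BundleField F) (v : indicatrixBundle F) :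
    bundleExt F ξ v = ξ v := dif_pos v.2

/-- The bracket is evaluated in the chart at v, whose differential at v is the identity, so the
outer inverse differential disappears. -/
theorem bundleBracket_eq (ξ η : BundleField F) (v : indicatrixBundle F) :
    bundleBracket F ξ η v = VectorField.lieBracketWithin ℝ
      (VectorField.mpullbackWithin 𝓘(ℝ, Coord n × Coord n) (Mdl n).tangent (tchart v.1.1).symm
        (bundleExt F ξ) (range (Mdl n).tangent))
      (VectorField.mpullbackWithin 𝓘(ℝ, Coord n × Coord n) (Mdl n).tangent (tchart v.1.1).symm
        (bundleExt F η) (range (Mdl n).tangent))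
      ((tchart v.1.1).symm ⁻¹' indicatrixBundle F) (tchart v.1.1 v.1) := by
  have h1 := VectorField.mlieBracketWithin_apply (I := (Mdl n).tangent) (V := bundleExt F ξ)
    (W := bundleExt F η) (s := indicatrixBundle F) (x₀ := v.1)
  have h2 : (mfderiv (Mdl n).tangent 𝓘(ℝ, Coord n × Coord n) (extChartAt (Mdl n).tangent v.1)
      v.1).inverse = ContinuousLinearMap.id ℝ (Coord n × Coord n) := by
    rw [mfderiv_extChartAt_self (I := (Mdl n).tangent) (x := v.1)]
    exact ContinuousLinearMap.inverse_id
  rw [bundleBracket, h1]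
  rw [h2, ModelWithCorners.range_eq_univ, inter_univ]
  rfl

end BundleBracket

section BundleBracket

variable {n : ℕ} {M : Type*} [TopologicalSpace M] [ChartedSpace (Coord n) M]
  [IsManifold (Mdl n) ∞ M] {F : TangentBundle (Mdl n) M → ℝ}

theorem IsRepresentation.congr_set {o : M} {ξ : BundleField F} {U V : Set (Coord n × Coord n)}
    {A : Coord n × Coord n → Coord n × Coord n} (h : IsRepresentation F o ξ U A) (hVU : V ⊆ U) :
    IsRepresentation F o ξ V A := fun v hv hvV => h v hv (hVU hvV)

/-- Along the hypersurface the extension by zero may be replaced by the pullback of A, which can be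
differentiated in all directions. -/
theorem mpullbackWithin_eventuallyEq {o : M} {v : indicatrixBundle F}
    (hv : v.1.1 ∈ (extChartAt (Mdl n) o).source) {ξ : BundleField F} {U : Set (Coord n × Coord n)}
    (hU : U ∈ 𝓝 (tchart o v.1)) {A : Coord n × Coord n → Coord n × Coord n}
    (h : IsRepresentation F o ξ U A) :
    VectorField.mpullbackWithin 𝓘(ℝ, Coord n × Coord n) (Mdl n).tangent (tchart v.1.1).symm
        (bundleExt F ξ) (range (Mdl n).tangent)
      =ᶠ[𝓝[(tchart v.1.1).symm ⁻¹' indicatrixBundle F] (tchart v.1.1 v.1)]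
      VectorField.pullback ℝ (tangentLift (transition v.1.1 o)) A := by
  have hs := mem_extChartAt_source (I := Mdl n) v.1.1
  have h1 : ∀ᶠ w : Coord n × Coord n in 𝓝 (tchart v.1.1 v.1), w.1 ∈ overlap v.1.1 o :=
    continuousAt_fst.eventually_mem
      ((isOpen_overlap v.1.1 o).mem_nhds (extChartAt_mem_overlap hs hv))
  have h2 : ∀ᶠ w in 𝓝 (tchart v.1.1 v.1), tangentLift (transition v.1.1 o) w ∈ U := by
    have hc : ContinuousAt (tangentLift (transition v.1.1 o)) (tchart v.1.1 v.1) :=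
      (contDiffAt_tangentLift_transition (extChartAt_mem_overlap hs hv)).continuousAt
    exact hc.eventually_mem (by rwa [tangentLift_tchart hs hv])
  filter_upwards [nhdsWithin_le_nhds h1, nhdsWithin_le_nhds h2, self_mem_nhdsWithin] with w h1 h2 h3
  have e1 : tchart v.1.1 ((tchart v.1.1).symm w) = w :=
    (tchart v.1.1).right_inv (mem_tchart_target.2 h1.1)
  have m1 : ((tchart v.1.1).symm w).1 ∈ (extChartAt (Mdl n) v.1.1).source :=
    (extChartAt (Mdl n) v.1.1).map_target h1.1
  have m2 : ((tchart v.1.1).symm w).1 ∈ (extChartAt (Mdl n) o).source := h1.2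
  have e2 : tchart o ((tchart v.1.1).symm w) = tangentLift (transition v.1.1 o) w :=
    tchart_tchart_symm h1
  have e3 := h ⟨(tchart v.1.1).symm w, h3⟩ m2 (by rwa [e2])
  have e4 := chartDeriv_comp m1 m2
  rw [e1] at e4
  rw [e2, e4] at e3
  replace e3 : fderiv ℝ (tangentLift (transition v.1.1 o)) w (chartDeriv v.1.1
      ((tchart v.1.1).symm w) (ξ ⟨(tchart v.1.1).symm w, h3⟩)) =
      A (tangentLift (transition v.1.1 o) w) := e3
  have hinv : (fderiv ℝ (tangentLift (transition v.1.1 o)) w).IsInvertible := by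
    obtain ⟨B, hB⟩ := isInvertible_chartDeriv m1
    have := isInvertible_chartDeriv m2
    rw [e4, ← hB] at this
    simpa using this
  obtain ⟨B, hB⟩ := hinv
  rw [mpullbackWithin_tchart_symm h1.1, VectorField.pullback_eq_of_fderiv_eq hB, ← e3, ← hB,
    show bundleExt F ξ ((tchart v.1.1).symm w) = ξ ⟨_, h3⟩ from bundleExt_of_mem ξ ⟨_, h3⟩]
  exact (B.symm_apply_apply _).symm

theorem tchart_symm_tchart_self (v : TangentBundle (Mdl n) M) :
    (tchart v.1).symm (tchart v.1 v) = v :=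
  (tchart v.1).left_inv (mem_tchart_source.2 (mem_extChartAt_source _))

theorem fibreNorm_tchart_symm_dilate (hF : IsFinsler F) (o : M) (z : Coord n × Coord n) {c : ℝ}
    (hc : 0 < c) : F ((tchart o).symm (z.1, c • z.2)) = c * F ((tchart o).symm z) := by
  change fibreNorm F _ (tangentCoordChange (Mdl n) o _ _ (c • z.2)) =
    c * fibreNorm F _ (tangentCoordChange (Mdl n) o _ _ z.2)
  rw [map_smul, hF.fibreNorm_smul _ _ hc]
  rfl

/-- A vector tangent to the indicatrix bundle in a chart is the velocity of a curve in it. -/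
theorem exists_curve_in_indicatrixBundle (hF : IsFinsler F) {o : M} {z : Coord n × Coord n}
    (hz : z ∈ slit (extChartAt (Mdl n) o).target)
    (hzF : (tchart o).symm z ∈ indicatrixBundle F) {A : Coord n × Coord n}
    (hA : fderiv ℝ (normSqInChart F o) z A = 0) :
    ∃ γ : ℝ → Coord n × Coord n, HasDerivAt γ A 0 ∧ γ 0 = z ∧
      ∀ᶠ t in 𝓝 0, γ t ∈ (tchart o).symm ⁻¹' indicatrixBundle F := by
  have hopen := (hF.isLocalFinsler o).isOpen_slit
  have hd : HasFDerivAt (fun z => F ((tchart o).symm z))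
      (fderiv ℝ (fun z => F ((tchart o).symm z)) z) z :=
    (((hF.contMDiffOn_comp_tchart_symm o).contDiffAt (hopen.mem_nhds hz)).differentiableAt
      (by simp)).hasFDerivAt
  have h1 : F ((tchart o).symm z) = 1 := hzF
  have h2 : fderiv ℝ (fun z => F ((tchart o).symm z)) z A = 0 := by
    have h3 : HasFDerivAt (normSqInChart F o) _ z := hd.pow 2
    rw [h3.fderiv, h1] at hA
    simpa using hA
  refine exists_curve_in_level
    ((ContinuousLinearMap.inl ℝ (Coord n) (Coord n)).comp (ContinuousLinearMap.fst ℝ _ _))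
    ((ContinuousLinearMap.inr ℝ (Coord n) (Coord n)).comp (ContinuousLinearMap.snd ℝ _ _))
    (fun w => by simp) (Eventually.of_forall fun w c hc => ?_) hd h1 h2
  rw [← fibreNorm_tchart_symm_dilate hF o w hc]
  simp

/-- The bracket of fields along the indicatrix bundle in a chart. -/
theorem chartDeriv_bundleBracket (hF : IsFinsler F) {o : M} {v : indicatrixBundle F}
    (hv : v.1.1 ∈ (extChartAt (Mdl n) o).source) {ξ η : BundleField F}
    {U : Set (Coord n × Coord n)} (hU : U ∈ 𝓝 (tchart o v.1))
    {A B : Coord n × Coord n → Coord n × Coord n} (hξ : IsRepresentation F o ξ U A)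
    (hη : IsRepresentation F o η U B) (hA : ContDiffAt ℝ ∞ A (tchart o v.1))
    (hB : ContDiffAt ℝ ∞ B (tchart o v.1))
    (hAt : fderiv ℝ (normSqInChart F o) (tchart o v.1) (A (tchart o v.1)) = 0)
    (hBt : fderiv ℝ (normSqInChart F o) (tchart o v.1) (B (tchart o v.1)) = 0) :
    chartDeriv o v.1 (bundleBracket F ξ η v) = VectorField.lieBracket ℝ A B (tchart o v.1) := by
  have hs := mem_extChartAt_source (I := Mdl n) v.1.1
  have hv0 := hF.snd_ne_zero v.2
  have hf : ContDiffAt ℝ ∞ (tangentLift (transition v.1.1 o)) (tchart v.1.1 v.1) :=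
    contDiffAt_tangentLift_transition (extChartAt_mem_overlap hs hv)
  have hinv : (fderiv ℝ (tangentLift (transition v.1.1 o)) (tchart v.1.1 v.1)).IsInvertible := by
    rw [← chartDeriv_eq hv]
    exact isInvertible_chartDeriv hv
  have he := tangentLift_tchart hs hv
  rw [← he] at hA hB hAt hBt
  have hS : tchart v.1.1 v.1 ∈ (tchart v.1.1).symm ⁻¹' indicatrixBundle F := by
    rw [mem_preimage, tchart_symm_tchart_self]
    exact v.2
  have hdiff : ∀ {A : Coord n × Coord n → Coord n × Coord n},
      ContDiffAt ℝ ∞ A (tangentLift (transition v.1.1 o) (tchart v.1.1 v.1)) →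
      DifferentiableAt ℝ (VectorField.pullback ℝ (tangentLift (transition v.1.1 o)) A)
        (tchart v.1.1 v.1) := by
    intro A hA
    have := VectorField.DifferentiableWithinAt.pullbackWithin (𝕜 := ℝ) (s := univ) (t := univ)
      (hA.differentiableAt (by simp)).differentiableWithinAt
      (hf.of_le (le_minSmoothness.trans IsLocalFinsler.two_le_infty)).contDiffWithinAt
      (by rwa [fderivWithin_univ]) uniqueDiffOn_univ (mem_univ _) (mapsTo_univ _ _)
    rwa [VectorField.pullbackWithin_univ, differentiableWithinAt_univ] at this
  have htan : ∀ {A : Coord n × Coord n → Coord n × Coord n},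
      fderiv ℝ (normSqInChart F o) (tangentLift (transition v.1.1 o) (tchart v.1.1 v.1))
        (A (tangentLift (transition v.1.1 o) (tchart v.1.1 v.1))) = 0 →
      fderiv ℝ (normSqInChart F v.1.1) (tchart v.1.1 v.1)
        (VectorField.pullback ℝ (tangentLift (transition v.1.1 o)) A (tchart v.1.1 v.1)) = 0 := by
    intro A hA
    rw [(hF.isCoordChange v.1.1 o).fderiv_eq (hF.isLocalFinsler_overlap v.1.1 o)
      (hF.isLocalFinsler_overlap o v.1.1) (tchart_mem_slit_overlap hv hv0),
      VectorField.fderiv_pullback _ _ _ hinv, hA]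
  have hcurve : ∀ {C : Coord n × Coord n},
      fderiv ℝ (normSqInChart F v.1.1) (tchart v.1.1 v.1) C = 0 → _ := fun {C} hC =>
    exists_curve_in_indicatrixBundle hF (tchart_mem_slit hs hv0) hS hC
  -- In the chart at the base point of v the bracket is that of the pullbacks of A and B; naturality
  -- of the Lie bracket moves it to the chart at o.
  rw [bundleBracket_eq, lieBracketWithin_eq_of_curves hS (hdiff hA) (hdiff hB)
    (mpullbackWithin_eventuallyEq hv hU hξ) (mpullbackWithin_eventuallyEq hv hU hη)
    (hcurve (htan hAt)) (hcurve (htan hBt)),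
    ← VectorField.pullback_lieBracket IsLocalFinsler.two_le_infty hf (hA.differentiableAt (by simp))
      (hB.differentiableAt (by simp)), chartDeriv_eq hv, VectorField.fderiv_pullback _ _ _ hinv, he]

end BundleBracket

/-! ### Smooth fields on the indicatrix bundle and on M in charts. -/

section Fields

variable {n : ℕ} {M : Type*} [TopologicalSpace M] [ChartedSpace (Coord n) M]
  [IsManifold (Mdl n) ∞ M] {F : TangentBundle (Mdl n) M → ℝ}

theorem mfderiv_finsler_apply (hF : IsFinsler F) {v : TangentBundle (Mdl n) M}
    (hv : v ∈ indicatrixBundle F) {A : Coord n × Coord n}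
    (hA : fderiv ℝ (normSqInChart F v.1) (tchart v.1 v) A = 0) :
    mfderiv (Mdl n).tangent 𝓘(ℝ, ℝ) F v A = 0 := by
  have hz := tchart_mem_slit (mem_extChartAt_source (I := Mdl n) v.1) (hF.snd_ne_zero hv)
  have hopen := (hF.isLocalFinsler v.1).isOpen_slit
  have hd : HasFDerivAt (fun z => F ((tchart v.1).symm z))
      (fderiv ℝ (fun z => F ((tchart v.1).symm z)) (tchart v.1 v)) (tchart v.1 v) :=
    (((hF.contMDiffOn_comp_tchart_symm v.1).contDiffAt (hopen.mem_nhds hz)).differentiableAt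
      (by simp)).hasFDerivAt
  have h1 : F ((tchart v.1).symm (tchart v.1 v)) = 1 := by
    rw [tchart_symm_tchart_self]
    exact hv
  have h2 : fderiv ℝ (fun z => F ((tchart v.1).symm z)) (tchart v.1 v) A = 0 := by
    have h3 : HasFDerivAt (normSqInChart F v.1) _ (tchart v.1 v) := hd.pow 2
    rw [h3.fderiv, h1] at hA
    simpa using hA
  have h4 : HasMFDerivAt (Mdl n).tangent 𝓘(ℝ, ℝ) F v
      (fderiv ℝ (fun z => F ((tchart v.1).symm z)) (tchart v.1 v)) := by
    refine ⟨hF.continuous.continuousAt, ?_⟩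
    exact hd.hasFDerivWithinAt
  rw [h4.mfderiv]
  exact h2

theorem contMDiffAt_mpullback_tchart {o : M} {v : TangentBundle (Mdl n) M}
    (hv : v.1 ∈ (extChartAt (Mdl n) o).source) {A : Coord n × Coord n → Coord n × Coord n}
    (hA : ContDiffAt ℝ ∞ A (tchart o v)) :
    ContMDiffAt (Mdl n).tangent (Mdl n).tangent.tangent ∞ (fun w =>
      (⟨w, VectorField.mpullback (Mdl n).tangent 𝓘(ℝ, Coord n × Coord n) (tchart o) A w⟩ :
        TangentBundle (Mdl n).tangent (TangentBundle (Mdl n) M))) v := by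
  have h1 : ContMDiffAt (Mdl n).tangent 𝓘(ℝ, Coord n × Coord n) ∞ (tchart (n := n) o) v :=
    contMDiffAt_extChartAt' (by
      rw [← extChartAt_source (Mdl n).tangent]
      exact mem_tchart_source.2 hv)
  exact ContMDiffAt.mpullback_vectorField_preimage (n := ∞) (m := ∞)
    (contMDiffAt_vectorSpace_iff_contDiffAt.2 hA) h1 (isInvertible_chartDeriv hv) (by simp)

/-- Near v the field is the restriction of the pullback of A under the chart, which is smooth at v
as a field on TM. -/
theorem mem_bundleFields (hF : IsFinsler F) {ξ : BundleField F}
    (h : ∀ v : indicatrixBundle F, ∃ U ∈ 𝓝 (tchart v.1.1 v.1), ∃ A,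
      IsRepresentation F v.1.1 ξ U A ∧ ContDiffAt ℝ ∞ A (tchart v.1.1 v.1) ∧
      fderiv ℝ (normSqInChart F v.1.1) (tchart v.1.1 v.1) (A (tchart v.1.1 v.1)) = 0) :
    ξ ∈ bundleFields F := by
  refine ⟨fun v hv => ?_, fun v => ?_⟩
  · obtain ⟨U, hU, A, hξ, hA, -⟩ := h ⟨v, hv⟩
    have hs := mem_extChartAt_source (I := Mdl n) v.1
    have h1 := contMDiffAt_mpullback_tchart hs hA
    have hsrc : (tchart v.1).source ∈ 𝓝 v := extChartAt_source_mem_nhds (I := (Mdl n).tangent) v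
    have hUv : ∀ᶠ w in 𝓝 v, tchart v.1 w ∈ U :=
      (continuousAt_extChartAt (I := (Mdl n).tangent) v).eventually_mem hU
    have heq : ∀ w ∈ indicatrixBundle F, w ∈ (tchart v.1).source → tchart v.1 w ∈ U →
        bundleExt F ξ w =
          VectorField.mpullback (Mdl n).tangent 𝓘(ℝ, Coord n × Coord n) (tchart v.1) A w := by
      intro w hw hws hwU
      have h2 := hξ ⟨w, hw⟩ (mem_tchart_source.1 hws) hwU
      have h3 : VectorField.mpullback (Mdl n).tangent 𝓘(ℝ, Coord n × Coord n) (tchart v.1) A w =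
        (chartDeriv v.1 w).inverse (A (tchart v.1 w)) := rfl
      obtain ⟨B, hB⟩ := isInvertible_chartDeriv (mem_tchart_source.1 hws)
      rw [h3, ← h2, ← hB, ContinuousLinearMap.inverse_equiv,
        show bundleExt F ξ w = ξ ⟨w, hw⟩ from bundleExt_of_mem ξ ⟨w, hw⟩]
      exact (B.symm_apply_apply _).symm
    refine h1.contMDiffWithinAt.congr_of_eventuallyEq ?_ ?_
    · filter_upwards [nhdsWithin_le_nhds hsrc, nhdsWithin_le_nhds hUv, self_mem_nhdsWithin]
        with w h2 h3 h4
      rw [heq w h4 h2 h3]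
    · rw [heq v hv (mem_of_mem_nhds hsrc) (mem_of_mem_nhds hU)]
  · obtain ⟨U, hU, A, hξ, -, hA⟩ := h v
    have h1 := hξ v (mem_extChartAt_source _) (mem_of_mem_nhds hU)
    rw [chartDeriv_self] at h1
    replace h1 : ξ v = A (tchart v.1.1 v.1) := h1
    rw [← h1] at hA
    exact mfderiv_finsler_apply hF v.2 hA

/-- A vector field on `M` in the chart at `o`. -/
def fieldInChart (o : M) (X : (x : M) → TangentSpace (Mdl n) x) (x : Coord n) : Coord n :=
  (tchart o (⟨(extChartAt (Mdl n) o).symm x, X ((extChartAt (Mdl n) o).symm x)⟩ :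
    TangentBundle (Mdl n) M)).2

theorem fieldInChart_extChartAt {o x : M} (hx : x ∈ (extChartAt (Mdl n) o).source)
    (X : (x : M) → TangentSpace (Mdl n) x) :
    fieldInChart o X (extChartAt (Mdl n) o x) = tangentCoordChange (Mdl n) x o x (X x) :=
  congrArg (fun y => (tchart o (⟨y, X y⟩ : TangentBundle (Mdl n) M)).2)
    ((extChartAt (Mdl n) o).left_inv hx)

theorem contDiffOn_fieldInChart (o : M) {X : (x : M) → TangentSpace (Mdl n) x}
    (hX : IsSmoothField X) : ContDiffOn ℝ ∞ (fieldInChart o X) (extChartAt (Mdl n) o).target := by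
  have h1 : ContMDiffOn 𝓘(ℝ, Coord n) (Mdl n) ∞ (extChartAt (Mdl n) o).symm
      (extChartAt (Mdl n) o).target := contMDiffOn_extChartAt_symm o
  have h2 : ContMDiffOn (Mdl n).tangent 𝓘(ℝ, Coord n × Coord n) ∞ (tchart (n := n) o)
      (tchart o).source := by
    rw [extChartAt_source]
    exact contMDiffOn_extChartAt
  have h3 := h2.comp (ContMDiff.comp_contMDiffOn hX h1)
    fun x hx => mem_tchart_source.2 ((extChartAt (Mdl n) o).map_target hx)
  exact contDiff_snd.comp_contDiffOn (contMDiffOn_iff_contDiffOn.1 h3)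

theorem isRepresentation_horizontalLift (hF : IsFinsler F) (o : M)
    (X : (x : M) → TangentSpace (Mdl n) x) :
    IsRepresentation F o (fun v => horizontalLift F v.1 (X v.1.1)) univ
      fun z => localHor (normSqInChart F o) z (fieldInChart o X z.1) := by
  intro v hv _
  rw [hF.chartDeriv_horizontalLift hv (hF.snd_ne_zero v.2), ← fieldInChart_extChartAt hv]
  rfl

theorem chartDeriv_curvatureField (hF : IsFinsler F) {o : M} {v : TangentBundle (Mdl n) M}
    (hv : v.1 ∈ (extChartAt (Mdl n) o).source) (hv0 : v.2 ≠ 0)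
    (X Y : (x : M) → TangentSpace (Mdl n) x) :
    chartDeriv o v (curvature F v (horizontalLift F v (X v.1)) (horizontalLift F v (Y v.1))) =
      (0, localCurv (normSqInChart F o) (tchart o v) (fieldInChart o X (tchart o v).1)
        (fieldInChart o Y (tchart o v).1)) := by
  rw [hF.chartDeriv_curvature hv hv0, ← fieldInChart_extChartAt hv, ← fieldInChart_extChartAt hv]
  rfl

end Fields

/-- dL([A, B]) = A(B L) − B(A L), and the inner functions vanish near z. -/
theorem fderiv_lieBracket_eq_zero {E : Type*} [NormedAddCommGroup E] [NormedSpace ℝ E] {L : E → ℝ}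
    {A B : E → E} {z : E} {S : Set E} (hS : IsOpen S) (hz : z ∈ S) (hL : ContDiffAt ℝ ∞ L z)
    (hA : DifferentiableAt ℝ A z) (hB : DifferentiableAt ℝ B z)
    (hA0 : ∀ w ∈ S, fderiv ℝ L w (A w) = 0) (hB0 : ∀ w ∈ S, fderiv ℝ L w (B w) = 0) :
    fderiv ℝ L z (VectorField.lieBracket ℝ A B z) = 0 := by
  have key : ∀ {A : E → E}, (∀ w ∈ S, fderiv ℝ L w (A w) = 0) →
      fderiv ℝ (fun w => fderiv ℝ L w (A w)) z = 0 := by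
    intro A hA
    have : (fun w => fderiv ℝ L w (A w)) =ᶠ[𝓝 z] fun _ => 0 := by
      filter_upwards [hS.mem_nhds hz] with w hw using hA w hw
    rw [this.fderiv_eq]
    simp
  rw [VectorField.fderiv_apply_lieBracket hL IsLocalFinsler.two_le_infty hB hA, key hA0, key hB0]
  simp

/-! ### Brackets with vertical fields in coordinates. -/

section VerticalFields

variable {n : ℕ} {ξ η : Coord n × Coord n → Coord n} {z : Coord n × Coord n}

theorem fderiv_fibre (hξ : DifferentiableAt ℝ ξ z) (w : Coord n) :
    fderiv ℝ (fun y => ξ (z.1, y)) z.2 w = fderiv ℝ ξ z (0, w) := by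
  have h1 : HasFDerivAt (fun y : Coord n => (z.1, y))
      ((0 : Coord n →L[ℝ] Coord n).prod (ContinuousLinearMap.id ℝ (Coord n))) z.2 :=
    (hasFDerivAt_const z.1 z.2).prodMk (hasFDerivAt_id z.2)
  have h2 : HasFDerivAt (fun y => ξ (z.1, y)) _ z.2 :=
    HasFDerivAt.comp z.2 (g := ξ) (hξ.hasFDerivAt : HasFDerivAt ξ (fderiv ℝ ξ z) (z.1, z.2)) h1
  rw [h2.fderiv]
  rfl

theorem fderiv_vertical (hξ : DifferentiableAt ℝ ξ z) (A : Coord n × Coord n) :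
    fderiv ℝ (fun z => ((0 : Coord n), ξ z)) z A = (0, fderiv ℝ ξ z A) := by
  rw [((hasFDerivAt_const (0 : Coord n) z).prodMk hξ.hasFDerivAt).fderiv]
  rfl

theorem lieBracket_vertical (hξ : DifferentiableAt ℝ ξ z) (hη : DifferentiableAt ℝ η z) :
    VectorField.lieBracket ℝ (fun z => ((0 : Coord n), ξ z)) (fun z => ((0 : Coord n), η z)) z =
      (0, fderiv ℝ (fun y => η (z.1, y)) z.2 (ξ z) - fderiv ℝ (fun y => ξ (z.1, y)) z.2 (η z)) := by
  rw [VectorField.lieBracket, fderiv_vertical hξ, fderiv_vertical hη, fderiv_fibre hξ,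
    fderiv_fibre hη, Prod.mk_sub_mk, sub_zero]

/-- The base component X depends on x alone, so a vertical field does not differentiate it. The
result is the expression produced by `IsTangentTo.covariantDerivative`. -/
theorem lieBracket_localHor_vertical {L : Coord n × Coord n → ℝ} {X : Coord n → Coord n}
    (hX : DifferentiableAt ℝ X z.1)
    (hN : DifferentiableAt ℝ (fun z => localConn L z (X z.1)) z) (hξ : DifferentiableAt ℝ ξ z) :
    VectorField.lieBracket ℝ (fun z => localHor L z (X z.1)) (fun z => ((0 : Coord n), ξ z)) z =
      (0, fderiv ℝ ξ z (localHor L z (X z.1)) +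
        fderiv ℝ (fun y => localConn L (z.1, y) (X z.1)) z.2 (ξ z)) := by
  have h1 : HasFDerivAt (fun z : Coord n × Coord n => X z.1)
      ((fderiv ℝ X z.1).comp (ContinuousLinearMap.fst ℝ (Coord n) (Coord n))) z :=
    HasFDerivAt.comp z (g := X) hX.hasFDerivAt
      (hasFDerivAt_fst (𝕜 := ℝ) (E := Coord n) (F := Coord n))
  have h2 : HasFDerivAt (fun z => localHor L z (X z.1)) _ z := h1.prodMk hN.hasFDerivAt.neg
  have h3 := fderiv_fibre hN (ξ z)
  rw [VectorField.lieBracket, fderiv_vertical hξ, h2.fderiv]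
  ext i
  · simp
  · simp [h3]

end VerticalFields

/-! ### The algebra of fields smoothly tangent to the holonomy groups. -/

section HolonomyTangent

variable {n : ℕ} {M : Type*} [TopologicalSpace M] [ChartedSpace (Coord n) M]
  [IsManifold (Mdl n) ∞ M] {F : TangentBundle (Mdl n) M → ℝ}

/-- Near `p` the field `ξ` is represented by the vertical field `Ξ`, which is smoothly tangent to the
groups of parallel translations along small closed polygons in the chart at `p`. -/
structure IsTangentRepresentation (F : TangentBundle (Mdl n) M → ℝ) (p : M) (δ r : ℝ)
    (ξ : BundleField F) (Ξ : Coord n × Coord n → Coord n) : Prop where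
  pos : 0 < r
  subset_target : Metric.ball (extChartAt (Mdl n) p p) r ⊆ (extChartAt (Mdl n) p).target
  subset_ball : Metric.ball (extChartAt (Mdl n) p p) r ⊆ Metric.ball (extChartAt (Mdl n) p p) δ
  tangent : IsTangentTo (polygonLoops (extChartAt (Mdl n) p).target (normSqInChart F p)
    (extChartAt (Mdl n) p p) δ) {y | y ≠ 0} (Metric.ball (extChartAt (Mdl n) p p) r) Ξ
  level : ∀ z ∈ slit (Metric.ball (extChartAt (Mdl n) p p) r),
    fderiv ℝ (normSqInChart F p) z (0, Ξ z) = 0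
  rep : IsRepresentation F p ξ (slit (Metric.ball (extChartAt (Mdl n) p p) r)) fun z => (0, Ξ z)

/-- The fields along the indicatrix bundle that are smoothly tangent to the holonomy groups. -/
def holonomyTangentFields (F : TangentBundle (Mdl n) M → ℝ) : Set (BundleField F) :=
  {ξ | ∀ (p : M) (δ : ℝ), IsTransportRadius (extChartAt (Mdl n) p).target (normSqInChart F p)
    (extChartAt (Mdl n) p p) δ → ∃ r Ξ, IsTangentRepresentation F p δ r ξ Ξ}

namespace IsTangentRepresentation

variable {p : M} {δ r : ℝ} {ξ η : BundleField F} {Ξ H : Coord n × Coord n → Coord n}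

theorem mono (h : IsTangentRepresentation F p δ r ξ Ξ) {s : ℝ} (hs : 0 < s) (hsr : s ≤ r) :
    IsTangentRepresentation F p δ s ξ Ξ := by
  have h1 := Metric.ball_subset_ball (x := extChartAt (Mdl n) p p) hsr
  have h2 : slit (Metric.ball (extChartAt (Mdl n) p p) s) ⊆
    slit (Metric.ball (extChartAt (Mdl n) p p) r) := prod_mono h1 Subset.rfl
  exact ⟨hs, h1.trans h.subset_target, h1.trans h.subset_ball, h.tangent.mono h1,
    fun z hz => h.level z (h2 hz), h.rep.congr_set h2⟩

theorem isOpen_slit (r : ℝ) : IsOpen (slit (Metric.ball (extChartAt (Mdl n) p p) r)) :=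
  Metric.isOpen_ball.prod isOpen_ne

theorem contDiffAt (h : IsTangentRepresentation F p δ r ξ Ξ) {z : Coord n × Coord n}
    (hz : z ∈ slit (Metric.ball (extChartAt (Mdl n) p p) r)) : ContDiffAt ℝ ∞ Ξ z :=
  (h.tangent.contDiffOn).contDiffAt ((isOpen_slit r).mem_nhds hz)

theorem tchart_mem (hF : IsFinsler F) (h : IsTangentRepresentation F p δ r ξ Ξ)
    (v : indicatrixBundle F) (hv : v.1.1 = p) :
    tchart p v.1 ∈ slit (Metric.ball (extChartAt (Mdl n) p p) r) := by
  subst hv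
  exact ⟨Metric.mem_ball_self h.pos,
    (tchart_mem_slit (mem_extChartAt_source _) (hF.snd_ne_zero v.2)).2⟩

theorem add (hF : IsFinsler F) (hδ : IsTransportRadius (extChartAt (Mdl n) p).target
    (normSqInChart F p) (extChartAt (Mdl n) p p) δ) (h : IsTangentRepresentation F p δ r ξ Ξ)
    (h' : IsTangentRepresentation F p δ r η H) :
    IsTangentRepresentation F p δ r (ξ + η) fun z => Ξ z + H z := by
  refine ⟨h.pos, h.subset_target, h.subset_ball,
    h.tangent.add h'.tangent (isDiffeoFamily_polygonLoops hδ (hF.isLocalFinsler p) _),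
    fun z hz => ?_, fun v hv hvU => ?_⟩
  · have : ((0 : Coord n), Ξ z + H z) = (0, Ξ z) + (0, H z) := by simp
    rw [this, map_add, h.level z hz, h'.level z hz, add_zero]
  · refine ((chartDeriv p v.1).map_add (ξ v) (η v)).trans ?_
    rw [h.rep v hv hvU, h'.rep v hv hvU]
    simp

theorem smul (hF : IsFinsler F) (hδ : IsTransportRadius (extChartAt (Mdl n) p).target
    (normSqInChart F p) (extChartAt (Mdl n) p p) δ) (h : IsTangentRepresentation F p δ r ξ Ξ)
    (c : ℝ) : IsTangentRepresentation F p δ r (c • ξ) fun z => c • Ξ z := by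
  refine ⟨h.pos, h.subset_target, h.subset_ball,
    h.tangent.smul (isDiffeoFamily_polygonLoops hδ (hF.isLocalFinsler p) _) isOpen_ne
      Metric.isOpen_ball c, fun z hz => ?_, fun v hv hvU => ?_⟩
  · have : ((0 : Coord n), c • Ξ z) = c • (0, Ξ z) := by simp
    rw [this, map_smul, h.level z hz, smul_zero]
  · refine ((chartDeriv p v.1).map_smul c (ξ v)).trans ?_
    rw [h.rep v hv hvU]
    simp

theorem lie (hF : IsFinsler F) (hδ : IsTransportRadius (extChartAt (Mdl n) p).target
    (normSqInChart F p) (extChartAt (Mdl n) p p) δ) (h : IsTangentRepresentation F p δ r ξ Ξ)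
    (h' : IsTangentRepresentation F p δ r η H) :
    IsTangentRepresentation F p δ r (bundleBracket F ξ η) fun z =>
      fderiv ℝ (fun y => H (z.1, y)) z.2 (Ξ z) - fderiv ℝ (fun y => Ξ (z.1, y)) z.2 (H z) := by
  have hsub : slit (Metric.ball (extChartAt (Mdl n) p p) r) ⊆ slit (extChartAt (Mdl n) p).target :=
    prod_mono h.subset_target Subset.rfl
  have hd : ∀ z ∈ slit (Metric.ball (extChartAt (Mdl n) p p) r), DifferentiableAt ℝ Ξ z :=
    fun z hz => (h.contDiffAt hz).differentiableAt (by simp)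
  have hd' : ∀ z ∈ slit (Metric.ball (extChartAt (Mdl n) p p) r), DifferentiableAt ℝ H z :=
    fun z hz => (h'.contDiffAt hz).differentiableAt (by simp)
  -- `IsTangentTo.bracket` for the pair (H, Ξ), in this order, gives DH(Ξ) − DΞ(H) = [Ξ, H].
  refine ⟨h.pos, h.subset_target, h.subset_ball,
    h'.tangent.bracket h.tangent (isDiffeoFamily_polygonLoops hδ (hF.isLocalFinsler p) _) isOpen_ne
      Metric.isOpen_ball, fun z hz => ?_, fun v hv hvU => ?_⟩
  · rw [← lieBracket_vertical (hd z hz) (hd' z hz)]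
    exact fderiv_lieBracket_eq_zero (isOpen_slit r) hz
      ((hF.isLocalFinsler p).smooth.contDiffAt ((hF.isLocalFinsler p).mem_nhds (hsub hz)))
      ((differentiableAt_const _).prodMk (hd z hz)) ((differentiableAt_const _).prodMk (hd' z hz))
      h.level h'.level
  · rw [chartDeriv_bundleBracket hF hv ((isOpen_slit r).mem_nhds hvU) h.rep h'.rep
      (contDiffAt_const.prodMk (h.contDiffAt hvU)) (contDiffAt_const.prodMk (h'.contDiffAt hvU))
      (h.level _ hvU) (h'.level _ hvU), lieBracket_vertical (hd _ hvU) (hd' _ hvU)]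

end IsTangentRepresentation

end HolonomyTangent

section HolonomyTangent

variable {n : ℕ} {M : Type*} [TopologicalSpace M] [ChartedSpace (Coord n) M]
  [IsManifold (Mdl n) ∞ M] {F : TangentBundle (Mdl n) M → ℝ}

theorem extChartAt_self_mem_target (p : M) :
    extChartAt (Mdl n) p p ∈ (extChartAt (Mdl n) p).target :=
  (extChartAt (Mdl n) p).map_source (mem_extChartAt_source p)

/-- Positive radii of balls around `x` that are contained in two given neighbourhoods. -/
theorem exists_ball_subset {E : Type*} [PseudoMetricSpace E] {x : E} {U V : Set E} (hU : U ∈ 𝓝 x)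
    (hV : V ∈ 𝓝 x) : ∃ r > 0, Metric.ball x r ⊆ U ∧ Metric.ball x r ⊆ V := by
  obtain ⟨r, hr, h⟩ := Metric.mem_nhds_iff.1 (inter_mem hU hV)
  exact ⟨r, hr, h.trans inter_subset_left, h.trans inter_subset_right⟩

theorem zero_mem_holonomyTangentFields (hF : IsFinsler F) :
    (0 : BundleField F) ∈ holonomyTangentFields F := by
  intro p δ hδ
  obtain ⟨r, hr, h1, h2⟩ := exists_ball_subset
    ((isOpen_extChartAt_target p).mem_nhds (extChartAt_self_mem_target p))
    (Metric.ball_mem_nhds (extChartAt (Mdl n) p p) hδ.pos)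
  refine ⟨r, fun _ => 0, hr, h1, h2,
    IsTangentTo.zero (isDiffeoFamily_polygonLoops hδ (hF.isLocalFinsler p) _), fun z _ => ?_,
    fun v hv _ => (chartDeriv p v.1).map_zero⟩
  exact map_zero (fderiv ℝ (normSqInChart F p) z)

theorem exists_common_representation {p : M} {δ : ℝ} (hδ : IsTransportRadius
    (extChartAt (Mdl n) p).target (normSqInChart F p) (extChartAt (Mdl n) p p) δ)
    {ξ η : BundleField F} (hξ : ξ ∈ holonomyTangentFields F) (hη : η ∈ holonomyTangentFields F) :
    ∃ r Ξ H, IsTangentRepresentation F p δ r ξ Ξ ∧ IsTangentRepresentation F p δ r η H := by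
  obtain ⟨r, Ξ, h⟩ := hξ p δ hδ
  obtain ⟨s, H, h'⟩ := hη p δ hδ
  exact ⟨min r s, Ξ, H, h.mono (lt_min h.pos h'.pos) (min_le_left _ _),
    h'.mono (lt_min h.pos h'.pos) (min_le_right _ _)⟩

theorem holonomyTangentFields_subset (hF : IsFinsler F) :
    holonomyTangentFields F ⊆ bundleFields F := by
  intro ξ hξ
  refine mem_bundleFields hF fun v => ?_
  obtain ⟨δ, hδ⟩ := exists_transportRadius (hF.isLocalFinsler v.1.1)
    (extChartAt_self_mem_target v.1.1)
  obtain ⟨r, Ξ, h⟩ := hξ v.1.1 δ hδ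
  have hmem := h.tchart_mem hF v rfl
  exact ⟨_, (IsTangentRepresentation.isOpen_slit r).mem_nhds hmem, _, h.rep,
    contDiffAt_const.prodMk (h.contDiffAt hmem), h.level _ hmem⟩

theorem isLieSubalgebraOf_holonomyTangentFields (hF : IsFinsler F) :
    IsLieSubalgebraOf (bundleBracket F) (bundleFields F) (holonomyTangentFields F) where
  subset := holonomyTangentFields_subset hF
  zero_mem := zero_mem_holonomyTangentFields hF
  add_mem _ hξ _ hη _ _ hδ :=
    let ⟨r, _, _, h, h'⟩ := exists_common_representation hδ hξ hη
    ⟨r, _, h.add hF hδ h'⟩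
  smul_mem c _ hξ p δ hδ :=
    let ⟨r, _, h⟩ := hξ p δ hδ
    ⟨r, _, h.smul hF hδ c⟩
  lie_mem _ hξ _ hη _ _ hδ :=
    let ⟨r, _, _, h, h'⟩ := exists_common_representation hδ hξ hη
    ⟨r, _, h.lie hF hδ h'⟩

theorem curvatureFields_subset_holonomyTangentFields (hF : IsFinsler F) :
    curvatureFields F ⊆ holonomyTangentFields F := by
  rintro ξ ⟨X, Y, hX, hY, hξ⟩ p δ hδ
  obtain ⟨s, hs, ht⟩ := isTangentTo_localCurv hδ (hF.isLocalFinsler p)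
    (isOpen_extChartAt_target p) (extChartAt_self_mem_target p) (contDiffOn_fieldInChart p hX)
    (contDiffOn_fieldInChart p hY)
  obtain ⟨r, hr, h1, h2⟩ := exists_ball_subset
    ((isOpen_extChartAt_target p).mem_nhds (extChartAt_self_mem_target p))
    (Metric.ball_mem_nhds (extChartAt (Mdl n) p p) hδ.pos)
  have hb := Metric.ball_subset_ball (x := extChartAt (Mdl n) p p) (min_le_left r s)
  refine ⟨min r s, _, lt_min hr hs, hb.trans h1, hb.trans h2,
    ht.mono (Metric.ball_subset_ball (min_le_right r s)), fun z hz => ?_, fun v hv _ => ?_⟩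
  · exact (hF.isLocalFinsler p).fderiv_localCurv ⟨h1 (hb hz.1), hz.2⟩ _ _
  · rw [hξ v]
    exact chartDeriv_curvatureField hF hv (hF.snd_ne_zero v.2) X Y

theorem berwald_mem_holonomyTangentFields (hF : IsFinsler F) {ξ : BundleField F}
    (hξ : ξ ∈ holonomyTangentFields F) {X : (x : M) → TangentSpace (Mdl n) x}
    (hX : IsSmoothField X) : berwald F X ξ ∈ holonomyTangentFields F := by
  intro p δ hδ
  obtain ⟨s, Ξ, h⟩ := hξ p δ hδ
  have hf := hF.isLocalFinsler p
  have hXs := contDiffOn_fieldInChart p hX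
  obtain ⟨r, hr, hrs, ht⟩ := IsTangentTo.covariantDerivative hδ hf Metric.isOpen_ball
    (Metric.mem_ball_self h.pos) h.subset_ball (hXs.mono h.subset_target) h.tangent
  have hslit : slit (Metric.ball (extChartAt (Mdl n) p p) r) ⊆
    slit (Metric.ball (extChartAt (Mdl n) p p) s) := prod_mono hrs Subset.rfl
  have htarget : slit (Metric.ball (extChartAt (Mdl n) p p) r) ⊆
    slit (extChartAt (Mdl n) p).target := prod_mono (hrs.trans h.subset_target) Subset.rfl
  have hN : ∀ z ∈ slit (Metric.ball (extChartAt (Mdl n) p p) r),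
      ContDiffAt ℝ ∞ (fun z => localConn (normSqInChart F p) z (fieldInChart p X z.1)) z := by
    intro z hz
    have h1 : ContDiffOn ℝ ∞ (fun z : Coord n × Coord n => (z, fieldInChart p X z.1))
        (slit (extChartAt (Mdl n) p).target) :=
      contDiffOn_id.prodMk (hXs.comp contDiffOn_fst fun w hw => hw.1)
    exact (hf.smooth_localConn.comp h1 fun w hw => ⟨hw, mem_univ _⟩).contDiffAt
      (hf.mem_nhds (htarget hz))
  have hX1 : ∀ z ∈ slit (Metric.ball (extChartAt (Mdl n) p p) r),
      ContDiffAt ℝ ∞ (fieldInChart p X) z.1 := fun z hz =>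
    hXs.contDiffAt ((isOpen_extChartAt_target p).mem_nhds (htarget hz).1)
  have hA : ∀ z ∈ slit (Metric.ball (extChartAt (Mdl n) p p) r),
      ContDiffAt ℝ ∞ (fun z => localHor (normSqInChart F p) z (fieldInChart p X z.1)) z :=
    fun z hz => ((hX1 z hz).comp z contDiffAt_fst).prodMk (hN z hz).neg
  have hbr : ∀ z ∈ slit (Metric.ball (extChartAt (Mdl n) p p) r), _ := fun z hz =>
    lieBracket_localHor_vertical ((hX1 z hz).differentiableAt (by simp))
      ((hN z hz).differentiableAt (by simp)) ((h.contDiffAt (hslit hz)).differentiableAt (by simp))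
  refine ⟨r, _, hr, hrs.trans h.subset_target, hrs.trans h.subset_ball, ht, fun z hz => ?_,
    fun v hv hvU => ?_⟩
  · rw [← hbr z hz]
    exact fderiv_lieBracket_eq_zero (IsTangentRepresentation.isOpen_slit r) hz
      (hf.smooth.contDiffAt (hf.mem_nhds (htarget hz))) ((hA z hz).differentiableAt (by simp))
      ((differentiableAt_const _).prodMk ((h.contDiffAt (hslit hz)).differentiableAt (by simp)))
      (fun w hw => hf.fderiv_localHor (htarget hw) _) fun w hw => h.level w (hslit hw)
  · refine Eq.trans ?_ (hbr _ hvU)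
    exact chartDeriv_bundleBracket hF hv ((IsTangentRepresentation.isOpen_slit r).mem_nhds hvU)
      ((isRepresentation_horizontalLift hF p X).congr_set (subset_univ _))
      (h.rep.congr_set hslit) (hA _ hvU) (contDiffAt_const.prodMk (h.contDiffAt (hslit hvU)))
      (hf.fderiv_localHor (htarget hvU) _) (h.level _ (hslit hvU))

/-- Minimality: `holonomyTangentFields` is one of the algebras over which the intersection is taken.
-/
theorem infHolonomyAlgebra_subset (hF : IsFinsler F) :
    infHolonomyAlgebra F ⊆ holonomyTangentFields F := fun _ hξ =>
  hξ _ (isLieSubalgebraOf_holonomyTangentFields hF) (curvatureFields_subset_holonomyTangentFields hF)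
    fun _ hη _ _ hX => berwald_mem_holonomyTangentFields hF hη hX

/-- An intersection over no algebra would be everything, so containment in `bundleFields` needs one
admissible algebra; `holonomyTangentFields` serves. -/
theorem isLieSubalgebraOf_infHolonomyAlgebra (hF : IsFinsler F) :
    IsLieSubalgebraOf (bundleBracket F) (bundleFields F) (infHolonomyAlgebra F) where
  subset := (infHolonomyAlgebra_subset hF).trans (holonomyTangentFields_subset hF)
  zero_mem _ hL _ _ := hL.zero_mem
  add_mem ξ hξ η hη L hL h1 h2 := hL.add_mem ξ (hξ L hL h1 h2) η (hη L hL h1 h2)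
  smul_mem c ξ hξ L hL h1 h2 := hL.smul_mem c ξ (hξ L hL h1 h2)
  lie_mem ξ hξ η hη L hL h1 h2 := hL.lie_mem ξ (hξ L hL h1 h2) η (hη L hL h1 h2)

theorem curvatureFields_subset_infHolonomyAlgebra :
    curvatureFields F ⊆ infHolonomyAlgebra F := fun _ hξ _ _ h _ => h hξ

end HolonomyTangent

/-! ### Vector fields on one indicatrix through homogeneous extensions. -/

section Fibre

variable {n : ℕ} {M : Type*} [TopologicalSpace M] [ChartedSpace (Coord n) M]
  [IsManifold (Mdl n) ∞ M] {F : TangentBundle (Mdl n) M → ℝ} {p : M}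

/-- The extension of a map on the indicatrix to a positively homogeneous map. -/
def homExt (F : TangentBundle (Mdl n) M → ℝ) (p : M) (f : Coord n → Coord n) (y : Coord n) :
    Coord n :=
  fibreNorm F p y • f ((fibreNorm F p y)⁻¹ • y)

theorem indicatrixExt_of_mem (ζ : indicatrix F p → Coord n) (y : indicatrix F p) :
    indicatrixExt F p ζ y = ζ y := dif_pos y.2

theorem fibreNorm_eq_one (y : indicatrix F p) : fibreNorm F p y = 1 := y.2

theorem homExt_of_mem (f : Coord n → Coord n) (y : indicatrix F p) : homExt F p f y = f y := by
  rw [homExt, fibreNorm_eq_one, inv_one, one_smul, one_smul]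

section

variable (hF : IsFinsler F)
include hF

theorem contDiffOn_fibreNorm : ContDiffOn ℝ ∞ (fibreNorm F p) {y | y ≠ 0} := by
  have h1 : fibreNorm F p = fun y => F ((tchart p).symm (extChartAt (Mdl n) p p, y)) := by
    funext y
    rw [tchart_symm_center]
    rfl
  rw [h1]
  exact (hF.contMDiffOn_comp_tchart_symm p).comp (contDiff_prodMk_right _).contDiffOn
    fun y hy => ⟨extChartAt_self_mem_target p, hy⟩

theorem contDiffAt_fibreNorm {y : Coord n} (hy : y ≠ 0) : ContDiffAt ℝ ∞ (fibreNorm F p) y :=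
  (contDiffOn_fibreNorm hF).contDiffAt (isOpen_ne.mem_nhds hy)

theorem hasFDerivAt_fibreNorm {y : Coord n} (hy : y ≠ 0) :
    HasFDerivAt (fibreNorm F p) (fderiv ℝ (fibreNorm F p) y) y :=
  ((contDiffAt_fibreNorm hF hy).differentiableAt (by simp)).hasFDerivAt

theorem normSqInChart_center (y : Coord n) :
    normSqInChart F p (extChartAt (Mdl n) p p, y) = fibreNorm F p y ^ 2 := by
  rw [normSqInChart, tchart_symm_center]
  rfl

theorem fibreNorm_pos {y : Coord n} (hy : y ≠ 0) : 0 < fibreNorm F p y := by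
  have h1 := (hF.isLocalFinsler p).norm_pos (z := (extChartAt (Mdl n) p p, y))
    ⟨extChartAt_self_mem_target p, hy⟩
  rw [normSqInChart_center hF] at h1
  exact lt_of_le_of_ne (hF.nonneg _) fun h0 => by
    rw [show fibreNorm F p y = 0 from h0.symm] at h1
    simp at h1

theorem indicatrix_ne_zero (y : indicatrix F p) : (y : Coord n) ≠ 0 :=
  hF.snd_ne_zero (v := ⟨p, (y : Coord n)⟩) y.2

theorem normalize_mem {y : Coord n} (hy : y ≠ 0) : (fibreNorm F p y)⁻¹ • y ∈ indicatrix F p := by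
  have h := fibreNorm_pos (p := p) hF hy
  change fibreNorm F p _ = 1
  rw [hF.fibreNorm_smul p y (inv_pos.2 h), inv_mul_cancel₀ h.ne']

theorem contDiffOn_normalize :
    ContDiffOn ℝ ∞ (fun y => (fibreNorm F p y)⁻¹ • y) {y | y ≠ 0} :=
  ((contDiffOn_fibreNorm hF).inv fun _ hy => (fibreNorm_pos hF hy).ne').smul contDiffOn_id

theorem contDiffOn_homExt {f : Coord n → Coord n} (hf : ContDiffOn ℝ ∞ f (indicatrix F p)) :
    ContDiffOn ℝ ∞ (homExt F p f) {y | y ≠ 0} :=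
  (contDiffOn_fibreNorm hF).smul (hf.comp (contDiffOn_normalize hF) fun _ hy => normalize_mem hF hy)

theorem fderiv_fibreNorm_smul {y : Coord n} (hy : y ≠ 0) {c : ℝ} (hc : 0 < c) :
    fderiv ℝ (fibreNorm F p) (c • y) = fderiv ℝ (fibreNorm F p) y := by
  have h1 : HasFDerivAt (fun w => fibreNorm F p (c • w))
      ((fderiv ℝ (fibreNorm F p) (c • y)).comp (c • ContinuousLinearMap.id ℝ (Coord n))) y :=
    HasFDerivAt.comp y (g := fibreNorm F p)
      (hasFDerivAt_fibreNorm hF (smul_ne_zero hc.ne' hy)) ((hasFDerivAt_id y).const_smul c)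
  have h2 : HasFDerivAt (fun w => fibreNorm F p (c • w)) (c • fderiv ℝ (fibreNorm F p) y) y := by
    have : (fun w => fibreNorm F p (c • w)) = fun w => c • fibreNorm F p w :=
      funext fun w => hF.fibreNorm_smul p w hc
    rw [this]
    exact (hasFDerivAt_fibreNorm hF hy).const_smul c
  have h3 := h1.unique h2
  rw [ContinuousLinearMap.comp_smul, ContinuousLinearMap.comp_id] at h3
  exact smul_right_injective _ hc.ne' h3

theorem fderiv_fibreNorm_homExt {f : Coord n → Coord n}
    (hf : ∀ y : indicatrix F p, fderiv ℝ (fibreNorm F p) y (f y) = 0) {y : Coord n} (hy : y ≠ 0) :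
    fderiv ℝ (fibreNorm F p) y (homExt F p f y) = 0 := by
  rw [homExt, map_smul, ← fderiv_fibreNorm_smul hF hy (inv_pos.2 (fibreNorm_pos hF hy))]
  have := hf ⟨_, normalize_mem hF hy⟩
  rw [this, smul_zero]

theorem exists_curve_in_indicatrix (y : indicatrix F p) {A : Coord n}
    (hA : fderiv ℝ (fibreNorm F p) y A = 0) :
    ∃ γ : ℝ → Coord n, HasDerivAt γ A 0 ∧ γ 0 = y ∧ ∀ᶠ t in 𝓝 0, γ t ∈ indicatrix F p :=
  exists_curve_in_level 0 (ContinuousLinearMap.id ℝ _) (fun w => by simp)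
    (Eventually.of_forall fun w c hc => by simpa using! hF.fibreNorm_smul p w hc)
    (hasFDerivAt_fibreNorm hF (indicatrix_ne_zero hF y)) (fibreNorm_eq_one y) hA

/-- The derivatives are taken in directions that are velocities of curves in the indicatrix, so any
differentiable extensions compute the bracket. -/
theorem indicatrixBracket_eq {ζ ζ' : indicatrix F p → Coord n} {Z Z' : Coord n → Coord n}
    (hZ : ∀ y : indicatrix F p, Z y = ζ y) (hZ' : ∀ y : indicatrix F p, Z' y = ζ' y)
    (y : indicatrix F p) (hd : DifferentiableAt ℝ Z y) (hd' : DifferentiableAt ℝ Z' y)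
    (ht : fderiv ℝ (fibreNorm F p) y (Z y) = 0) (ht' : fderiv ℝ (fibreNorm F p) y (Z' y) = 0) :
    indicatrixBracket F p ζ ζ' y = VectorField.lieBracket ℝ Z Z' y := by
  have he : ∀ {ζ : indicatrix F p → Coord n} {Z : Coord n → Coord n},
      (∀ y : indicatrix F p, Z y = ζ y) → indicatrixExt F p ζ =ᶠ[𝓝[indicatrix F p] (y : Coord n)] Z :=
    fun {ζ Z} h => by
      filter_upwards [self_mem_nhdsWithin] with w hw
      exact (indicatrixExt_of_mem ζ ⟨w, hw⟩).trans (h ⟨w, hw⟩).symm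
  exact lieBracketWithin_eq_of_curves y.2 hd hd' (he hZ) (he hZ')
    (exists_curve_in_indicatrix hF y ht) (exists_curve_in_indicatrix hF y ht')

theorem mem_indicatrixFields_of_eq {ζ : indicatrix F p → Coord n} {Z : Coord n → Coord n}
    (hZ : ∀ y : indicatrix F p, Z y = ζ y) (hs : ContDiffOn ℝ ∞ Z {y | y ≠ 0})
    (ht : ∀ y : indicatrix F p, fderiv ℝ (fibreNorm F p) y (Z y) = 0) :
    ζ ∈ indicatrixFields F p := by
  refine ⟨(hs.mono fun y hy => indicatrix_ne_zero hF ⟨y, hy⟩).congr fun y hy => ?_, fun y => ?_⟩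
  · exact (indicatrixExt_of_mem ζ ⟨y, hy⟩).trans (hZ ⟨y, hy⟩).symm
  · rw [← hZ y]
    exact ht y

/-- The homogeneous extension of a vector field on the indicatrix. -/
theorem exists_extension {ζ : indicatrix F p → Coord n} (hζ : ζ ∈ indicatrixFields F p) :
    (∀ y : indicatrix F p, homExt F p (indicatrixExt F p ζ) y = ζ y) ∧
      ContDiffOn ℝ ∞ (homExt F p (indicatrixExt F p ζ)) {y | y ≠ 0} ∧
      ∀ y ≠ 0, fderiv ℝ (fibreNorm F p) y (homExt F p (indicatrixExt F p ζ) y) = 0 := by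
  refine ⟨fun y => ?_, contDiffOn_homExt hF hζ.1, fun y hy => fderiv_fibreNorm_homExt hF (fun y => ?_) hy⟩
  · rw [homExt_of_mem, indicatrixExt_of_mem]
  · rw [indicatrixExt_of_mem]
    exact hζ.2 y

theorem indicatrixBracket_mem {ζ ζ' : indicatrix F p → Coord n} (hζ : ζ ∈ indicatrixFields F p)
    (hζ' : ζ' ∈ indicatrixFields F p) : indicatrixBracket F p ζ ζ' ∈ indicatrixFields F p := by
  obtain ⟨h1, h2, h3⟩ := exists_extension hF hζ
  obtain ⟨h1', h2', h3'⟩ := exists_extension hF hζ'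
  set Z := homExt F p (indicatrixExt F p ζ)
  set Z' := homExt F p (indicatrixExt F p ζ')
  have hc : ∀ y : Coord n, y ≠ 0 → ContDiffAt ℝ ∞ Z y := fun y hy =>
    h2.contDiffAt (isOpen_ne.mem_nhds hy)
  have hc' : ∀ y : Coord n, y ≠ 0 → ContDiffAt ℝ ∞ Z' y := fun y hy =>
    h2'.contDiffAt (isOpen_ne.mem_nhds hy)
  refine mem_indicatrixFields_of_eq hF (Z := VectorField.lieBracket ℝ Z Z') (fun y => ?_)
    (fun y hy => ((hc y hy).lieBracket_vectorField (m := ∞) (hc' y hy) (by simp)).contDiffWithinAt)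
    fun y => ?_
  · have hy := indicatrix_ne_zero hF y
    exact (indicatrixBracket_eq hF h1 h1' y ((hc y hy).differentiableAt (by simp))
      ((hc' y hy).differentiableAt (by simp)) (h3 y hy) (h3' y hy)).symm
  · have hy := indicatrix_ne_zero hF y
    exact fderiv_lieBracket_eq_zero isOpen_ne hy (contDiffAt_fibreNorm hF hy)
      ((hc y hy).differentiableAt (by simp)) ((hc' y hy).differentiableAt (by simp)) h3 h3'

theorem isLieSubalgebraOf_indicatrixFields :
    IsLieSubalgebraOf (indicatrixBracket F p) (indicatrixFields F p) (indicatrixFields F p) where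
  subset := Subset.rfl
  zero_mem := mem_indicatrixFields_of_eq hF (Z := fun _ => 0) (fun _ => rfl) contDiffOn_const
    fun y => map_zero (fderiv ℝ (fibreNorm F p) y)
  add_mem ζ hζ ζ' hζ' := by
    obtain ⟨h1, h2, h3⟩ := exists_extension hF hζ
    obtain ⟨h1', h2', h3'⟩ := exists_extension hF hζ'
    refine mem_indicatrixFields_of_eq hF (fun y => ?_) (h2.add h2') fun y => ?_
    · exact congrArg₂ (· + ·) (h1 y) (h1' y)
    · have hy := indicatrix_ne_zero hF y
      exact (map_add _ _ _).trans (by rw [h3 y hy, h3' y hy, add_zero])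
  smul_mem c ζ hζ := by
    obtain ⟨h1, h2, h3⟩ := exists_extension hF hζ
    refine mem_indicatrixFields_of_eq hF (fun y => ?_) (h2.const_smul c) fun y => ?_
    · exact congrArg (c • ·) (h1 y)
    · exact (map_smul _ _ _).trans (by rw [h3 y (indicatrix_ne_zero hF y), smul_zero])
  lie_mem ζ hζ ζ' hζ' := indicatrixBracket_mem hF hζ hζ'

end

end Fibre

/-! ### Fields tangent to a subgroup of Diff(I_p). -/

section TangentFields

variable {n : ℕ} {M : Type*} [TopologicalSpace M] [ChartedSpace (Coord n) M]
  [IsManifold (Mdl n) ∞ M] {F : TangentBundle (Mdl n) M → ℝ} {p : M}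

/-- The homogeneous extensions of the elements of a group of diffeomorphisms of the indicatrix. -/
def homExtensions (F : TangentBundle (Mdl n) M → ℝ) (p : M) (G : Subgroup (diffGroup F p)) :
    Set (Coord n → Coord n) :=
  {σ | ∃ g ∈ G, ∀ (c : ℝ), 0 < c → ∀ y : indicatrix F p, σ (c • (y : Coord n)) = c • (g.1 y : Coord n)}

variable {G : Subgroup (diffGroup F p)}

section

variable (hF : IsFinsler F)
include hF

theorem exists_smul_indicatrix {y : Coord n} (hy : y ≠ 0) :
    ∃ (c : ℝ) (u : indicatrix F p), 0 < c ∧ y = c • (u : Coord n) :=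
  ⟨fibreNorm F p y, ⟨_, normalize_mem hF hy⟩, fibreNorm_pos hF hy,
    (smul_inv_smul₀ (fibreNorm_pos hF hy).ne' y).symm⟩

theorem homExt_smul (f : Coord n → Coord n) {c : ℝ} (hc : 0 < c) (u : indicatrix F p) :
    homExt F p f (c • (u : Coord n)) = c • f u := by
  have h1 : fibreNorm F p (c • (u : Coord n)) = c := by
    rw [hF.fibreNorm_smul p u hc, fibreNorm_eq_one, mul_one]
  rw [homExt, h1, inv_smul_smul₀ hc.ne']

theorem homExt_permMap_mem {g : diffGroup F p} (hg : g ∈ G) :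
    homExt F p (permMap F p g.1) ∈ homExtensions F p G :=
  ⟨g, hg, fun c hc y => by rw [homExt_smul hF _ hc, permMap_of_mem]⟩

/-- Each y ≠ 0 is a positive multiple of a point of the indicatrix, so products and inverses pass to
homogeneous extensions. This places the group on an open set, where the calculus of tangent curves
applies. -/
theorem isDiffeoFamily_homExtensions {Q : Type} (W : Set Q) :
    IsDiffeoFamily {y : Coord n | y ≠ 0} W fun _ => homExtensions F p G where
  one_mem _ _ := ⟨1, G.one_mem, fun _ _ _ => rfl⟩
  mul_mem := by
    rintro - - σ ⟨g, hg, h⟩ τ ⟨g', hg', h'⟩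
    refine ⟨g * g', G.mul_mem hg hg', fun c hc y => ?_⟩
    rw [Function.comp_apply, h' c hc, h c hc]
    rfl
  inv_mem := by
    rintro - - σ ⟨g, hg, h⟩
    refine ⟨_, homExt_permMap_mem hF (G.inv_mem hg), fun y hy => ?_, fun y hy => ?_⟩
    · obtain ⟨c, u, hc, rfl⟩ := exists_smul_indicatrix (F := F) (p := p) hF hy
      rw [h c hc, homExt_smul hF _ hc, permMap_of_mem]
      exact congrArg (fun w : indicatrix F p => c • (w : Coord n)) (Equiv.symm_apply_apply g.1 u)
    · obtain ⟨c, u, hc, rfl⟩ := exists_smul_indicatrix (F := F) (p := p) hF hy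
      rw [homExt_smul hF _ hc, permMap_of_mem, h c hc]
      exact congrArg (fun w : indicatrix F p => c • (w : Coord n)) (Equiv.apply_symm_apply g.1 u)
  mapsTo := by
    rintro - - σ ⟨g, hg, h⟩ y hy
    obtain ⟨c, u, hc, rfl⟩ := exists_smul_indicatrix (F := F) (p := p) hF hy
    rw [h c hc]
    exact smul_ne_zero hc.ne' (indicatrix_ne_zero hF _)
  differentiableOn := by
    rintro - - σ ⟨g, hg, h⟩
    refine ((contDiffOn_homExt hF g.2.1).differentiableOn (by simp)).congr fun y hy => ?_
    obtain ⟨c, u, hc, rfl⟩ := exists_smul_indicatrix (F := F) (p := p) hF hy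
    rw [h c hc, homExt_smul hF _ hc, permMap_of_mem]

/-- Tangency to a group of diffeomorphisms of the indicatrix in terms of an extension. -/
theorem mem_tangentFields_of_isTangentTo {Q : Type} [NormedAddCommGroup Q] [NormedSpace ℝ Q]
    {𝒢 : Q → Set (Coord n → Coord n)} {W : Set Q} {Ξ : Q × Coord n → Coord n}
    (h : IsTangentTo 𝒢 {y | y ≠ 0} W Ξ) {q : Q} (hq : q ∈ W)
    (hG : ∀ σ ∈ 𝒢 q, ∃ g ∈ G, ∀ y : indicatrix F p, σ y = (g.1 y : Coord n))
    {ζ : indicatrix F p → Coord n} (hζ : ∀ y : indicatrix F p, Ξ (q, y) = ζ y)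
    (ht : ∀ y : indicatrix F p, fderiv ℝ (fibreNorm F p) y (Ξ (q, y)) = 0) :
    ζ ∈ tangentFields F p G := by
  refine ⟨mem_indicatrixFields_of_eq hF hζ
    (h.contDiffOn.comp (contDiff_prodMk_right q).contDiffOn fun y hy => ⟨hq, hy⟩) ht, ?_⟩
  obtain ⟨k, ε₀, φ₀, ρ₀, h₀⟩ := h
  have hk : (0 : ℝ) < (k.factorial : ℝ) := by exact_mod_cast k.factorial_pos
  -- The k-th derivative of tᵏρ at 0 is k! ρ(0), whereas an integral curve of order k must produce ζ
  -- itself; hence the factor 1/k!.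
  obtain ⟨ε, φ, ρ, h⟩ := h₀.smul_of_pos (inv_pos.2 hk)
  choose! g hgG hg using fun t ht => hG _ (h.mem t ht q hq)
  have h0 := h.zero_mem_Ioo
  refine ⟨k, ε, g, h.pos, hgG, ?_, h.order, ?_, fun y => ?_⟩
  · have h1 : ContDiffOn ℝ ∞ (fun w : ℝ × Coord n => φ (w.1, q, w.2))
        (Ioo (-ε) ε ×ˢ indicatrix F p) :=
      h.smooth_map.comp (contDiff_fst.prodMk (contDiff_const.prodMk contDiff_snd)).contDiffOn
        fun w hw => ⟨hw.1, hq, indicatrix_ne_zero hF ⟨w.2, hw.2⟩⟩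
    refine h1.congr fun w hw => ?_
    exact (permMap_of_mem F p _ ⟨w.2, hw.2⟩).trans (hg w.1 hw.1 ⟨w.2, hw.2⟩).symm
  · refine Subtype.ext (Equiv.ext fun y => Subtype.ext ?_)
    rw [← hg 0 h0 y, h.map_zero hq (indicatrix_ne_zero hF y)]
    rfl
  · have hy := indicatrix_ne_zero hF y
    have hρ : ∀ j : ℕ, ContDiffAt ℝ j (fun t => ρ (t, q, (y : Coord n))) 0 := by
      intro j
      have h1 : ContDiffOn ℝ ∞ (fun t => ρ (t, q, (y : Coord n))) (Ioo (-ε) ε) :=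
        h.smooth.comp (contDiff_id.prodMk contDiff_const).contDiffOn fun t ht => ⟨ht, hq, hy⟩
      exact (h1.contDiffAt (isOpen_Ioo.mem_nhds h0)).of_le (by exact_mod_cast le_top)
    have he : ∀ j : ℕ, 1 ≤ j → iteratedDeriv j (fun t => ((g t).1 y : Coord n)) 0 =
        iteratedDeriv j (fun t => t ^ k • ρ (t, q, (y : Coord n))) 0 := by
      intro j hj
      have h1 : (fun t => ((g t).1 y : Coord n)) =ᶠ[𝓝 0]
          fun t => y + t ^ k • ρ (t, q, (y : Coord n)) := by
        filter_upwards [isOpen_Ioo.mem_nhds h0] with t ht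
        rw [← hg t ht y, h.eq (t, q, y) ⟨ht, hq, hy⟩]
      rw [h1.iteratedDeriv_eq j, ← iteratedDerivWithin_univ, ← iteratedDerivWithin_univ,
        iteratedDerivWithin_const_add hj]
    refine ⟨fun j hj hjk => ?_, ?_⟩
    · rw [he j hj, iteratedDeriv_pow_smul hjk.le (hρ j), if_neg hjk.ne]
    · rw [he k h.order, iteratedDeriv_pow_smul le_rfl (hρ k), if_pos rfl, h.zero q hq y hy, hζ,
        smul_inv_smul₀ hk.ne']

/-- The converse passage. As the derivatives of orders below k vanish, Φ − id is divisible by tᵏ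
with coefficient the extension of ζ/k!, and k! is restored by scaling. The parameter in ℝ is a
dummy, since only one group is involved. -/
theorem isTangentTo_homExt {ζ : indicatrix F p → Coord n} (hζ : ζ ∈ tangentFields F p G) :
    IsTangentTo (fun _ : ℝ => homExtensions F p G) {y : Coord n | y ≠ 0} univ
      fun w => homExt F p (indicatrixExt F p ζ) w.2 := by
  obtain ⟨-, k, ε, φ, hε, hφG, hφ, hk, hφ0, hφd⟩ := hζ
  have h0 : (0 : ℝ) ∈ Ioo (-ε) ε := ⟨by linarith, hε⟩
  set D : Set (ℝ × ℝ × Coord n) := curveDomain ε univ {y | y ≠ 0} with hDdef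
  have hD : IsOpen D := isOpen_Ioo.prod (isOpen_univ.prod isOpen_ne)
  set Φ : ℝ × ℝ × Coord n → Coord n := fun w => homExt F p (permMap F p (φ w.1).1) w.2.2 with hΦ
  have hsnd : ContDiff ℝ ∞ fun w : ℝ × ℝ × Coord n => w.2.2 := contDiff_snd.comp contDiff_snd
  have hΦs : ContDiffOn ℝ ∞ Φ D := by
    have h1 : ContDiffOn ℝ ∞ (fun w : ℝ × ℝ × Coord n => fibreNorm F p w.2.2) D :=
      (contDiffOn_fibreNorm hF).comp hsnd.contDiffOn fun w hw => hw.2.2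
    have h2 : ContDiffOn ℝ ∞ (fun w : ℝ × ℝ × Coord n =>
        (w.1, (fibreNorm F p w.2.2)⁻¹ • w.2.2)) D :=
      contDiffOn_fst.prodMk ((contDiffOn_normalize hF).comp hsnd.contDiffOn fun w hw => hw.2.2)
    exact h1.smul (ContDiffOn.comp hφ h2 fun w hw => ⟨hw.1, normalize_mem hF hw.2.2⟩)
  have hΦu : ∀ (t q c : ℝ) (u : indicatrix F p), 0 < c →
      Φ (t, q, c • (u : Coord n)) = c • ((φ t).1 u : Coord n) := fun t q c u hc => by
    rw [hΦ]
    simp only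
    rw [homExt_smul hF _ hc, permMap_of_mem]
  have hd : ∀ j : ℕ, 1 ≤ j → ∀ (q c : ℝ) (u : indicatrix F p), 0 < c →
      iteratedDeriv j (fun t => Φ (t, q, c • (u : Coord n)) - c • (u : Coord n)) 0 =
        c • iteratedDeriv j (fun t => ((φ t).1 u : Coord n)) 0 := by
    intro j hj q c u hc
    have h1 : (fun t => Φ (t, q, c • (u : Coord n)) - c • (u : Coord n)) =
        fun t => -(c • (u : Coord n)) + c • ((φ t).1 u : Coord n) := by
      funext t
      rw [hΦu t q c u hc, sub_eq_neg_add]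
    rw [h1, ← iteratedDerivWithin_univ, ← iteratedDerivWithin_univ, iteratedDerivWithin_const_add hj,
      iteratedDerivWithin_fun_const_smul_field]
  obtain ⟨ρ, hρs, hρe, hρ0⟩ := exists_contDiffOn_eq_pow_smul hD (fun t z hz => ⟨h0, hz.2⟩)
    (g := fun w => Φ w - w.2.2) (hΦs.sub hsnd.contDiffOn) k (by
      rintro ⟨q, y⟩ hz j hj
      obtain ⟨c, u, hc, rfl⟩ := exists_smul_indicatrix (F := F) (p := p) hF hz.2.2
      rcases Nat.eq_zero_or_pos j with rfl | hj0
      · rw [iteratedDeriv_zero, hΦu 0 q c u hc, hφ0]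
        exact sub_self _
      · rw [hd j hj0 q c u hc, (hφd u).1 j hj0 hj, smul_zero])
  have htan : IsTangentTo (fun _ : ℝ => homExtensions F p G) {y : Coord n | y ≠ 0} univ
      fun w => ρ (0, w) := by
    refine ⟨k, ε, Φ, ρ, hk, hε, fun t ht q _ => homExt_permMap_mem hF (hφG t ht), hρs,
      fun w hw => ?_, fun _ _ _ _ => rfl⟩
    rw [← hρe w hw]
    abel
  refine (htan.smul (isDiffeoFamily_homExtensions hF _) isOpen_ne isOpen_univ
    (k.factorial : ℝ)).congr fun q _ y hy => ?_
  obtain ⟨c, u, hc, rfl⟩ := exists_smul_indicatrix (F := F) (p := p) hF hy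
  rw [← hρ0 (q, c • (u : Coord n)) ⟨h0, mem_univ _, hy⟩, hd k hk q c u hc, (hφd u).2,
    homExt_smul hF _ hc, indicatrixExt_of_mem]

/-- Extend homogeneously, apply the calculus of tangent curves, and restrict at the dummy parameter
0. As before, the bracket takes its arguments in reversed order. -/
theorem isLieSubalgebraOf_tangentFields (G : Subgroup (diffGroup F p)) :
    IsLieSubalgebraOf (indicatrixBracket F p) (indicatrixFields F p) (tangentFields F p G) := by
  have hfam := isDiffeoFamily_homExtensions (Q := ℝ) (G := G) hF univ
  have hrestrict : ∀ σ ∈ homExtensions F p G, ∃ g ∈ G, ∀ y : indicatrix F p, σ y = (g.1 y : Coord n) := by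
    rintro σ ⟨g, hg, h⟩
    refine ⟨g, hg, fun y => ?_⟩
    have := h 1 one_pos y
    rwa [one_smul, one_smul] at this
  have hLie := isLieSubalgebraOf_indicatrixFields (p := p) hF
  have back : ∀ {ζ : indicatrix F p → Coord n} {Ξ : ℝ × Coord n → Coord n},
      IsTangentTo (fun _ : ℝ => homExtensions F p G) {y : Coord n | y ≠ 0} univ Ξ →
      (∀ y : indicatrix F p, Ξ (0, y) = ζ y) → ζ ∈ indicatrixFields F p → ζ ∈ tangentFields F p G :=
    fun h hζ hm => mem_tangentFields_of_isTangentTo hF h (mem_univ 0) hrestrict hζ fun y => by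
      rw [hζ]
      exact hm.2 y
  refine ⟨fun ζ h => h.1, ?_, fun ζ h ζ' h' => ?_, fun c ζ h => ?_, fun ζ h ζ' h' => ?_⟩
  · exact back (IsTangentTo.zero hfam) (fun _ => rfl) hLie.zero_mem
  · refine back ((isTangentTo_homExt hF h).add (isTangentTo_homExt hF h') hfam) (fun y => ?_)
      (hLie.add_mem ζ h.1 ζ' h'.1)
    rw [homExt_of_mem, homExt_of_mem, indicatrixExt_of_mem, indicatrixExt_of_mem]
    rfl
  · refine back ((isTangentTo_homExt hF h).smul hfam isOpen_ne isOpen_univ c) (fun y => ?_)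
      (hLie.smul_mem c ζ h.1)
    rw [homExt_of_mem, indicatrixExt_of_mem]
    rfl
  · refine back ((isTangentTo_homExt hF h').bracket (isTangentTo_homExt hF h) hfam isOpen_ne
      isOpen_univ) (fun y => ?_) (hLie.lie_mem ζ h.1 ζ' h'.1)
    obtain ⟨h1, h2, h3⟩ := exists_extension hF h.1
    obtain ⟨h1', h2', h3'⟩ := exists_extension hF h'.1
    have hy := indicatrix_ne_zero hF y
    rw [indicatrixBracket_eq hF h1 h1' y
      ((h2.contDiffAt (isOpen_ne.mem_nhds hy)).differentiableAt (by simp))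
      ((h2'.contDiffAt (isOpen_ne.mem_nhds hy)).differentiableAt (by simp)) (h3 y hy) (h3' y hy)]
    rfl

end

end TangentFields

/-! ### Concatenation of paths. -/

section Glue

/-- The path on `[0, ∞)` whose restriction to `[i, i + 1]` is the path `f i` on `[0, 1]`. -/
def glue {E : Type*} (f : ℕ → ℝ → E) (t : ℝ) : E := f ⌊t⌋₊ (t - ⌊t⌋₊)

/-- At the right end t = i + 1 the floor has already jumped; there the matching condition is used.
-/
theorem glue_eq {E : Type*} {f : ℕ → ℝ → E} {i : ℕ} (h : f i 1 = f (i + 1) 0) {t : ℝ}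
    (ht : t ∈ Icc (i : ℝ) (i + 1)) : glue f t = f i (t - i) := by
  rcases ht.2.eq_or_lt with h1 | h1
  · have h2 : ⌊t⌋₊ = i + 1 := by
      rw [h1]
      exact_mod_cast Nat.floor_natCast (R := ℝ) (i + 1)
    rw [glue, h2, h1]
    push_cast
    rw [sub_self, ← h, add_sub_cancel_left]
  · have h2 : ⌊t⌋₊ = i := (Nat.floor_eq_iff (i.cast_nonneg.trans ht.1)).2 ⟨ht.1, h1⟩
    rw [glue, h2]

theorem glue_natCast {E : Type*} (f : ℕ → ℝ → E) (i : ℕ) : glue f (i : ℝ) = f i 0 := by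
  rw [glue, Nat.floor_natCast, sub_self]

end Glue

/-! ### Polygons as curves parametrised by [0, 1]. -/

section Polygons

variable {n : ℕ} {Ω : Set (Coord n)} {L : Coord n × Coord n → ℝ} {x₀ x x' : Coord n} {δ : ℝ}
  {σ : Coord n → Coord n}

/-- The vertices of a polygon and the parallel fields along its edges. -/
theorem IsPolygonTransport.exists_vertices (hσ : IsPolygonTransport Ω L x₀ δ x x' σ)
    (hδ : IsTransportRadius Ω L x₀ δ) (h : IsLocalFinsler Ω L) :
    ∃ (m : ℕ) (v : ℕ → Coord n), v 0 = x ∧ v m = x' ∧ ∀ y ≠ 0, ∃ U : ℕ → ℝ → Coord n,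
      U 0 0 = y ∧ U m 0 = σ y ∧ ∀ i < m, IsHorizontalSegment Ω L (v i) (v (i + 1) - v i) (U i) ∧
        U i 1 = U (i + 1) 0 := by
  induction hσ with
  | nil => exact ⟨0, fun _ => _, rfl, rfl, fun y _ => ⟨fun _ _ => y, rfl, rfl, by simp⟩⟩
  | @cons x' x'' a σ hσ hx' ha hx'' he ih =>
    obtain ⟨m, v, hv0, hvm, hU⟩ := ih
    refine ⟨m + 1, fun i => if i ≤ m then v i else x'', by simpa using hv0, by simp, fun y hy => ?_⟩
    obtain ⟨U, hU0, hUm, hUs⟩ := hU y hy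
    obtain ⟨u, hu, hu0⟩ := hδ.exists_segment x' hx' a ha (σ y) (hσ.mapsTo hδ h hy)
    -- Beyond the last edge the field is constant, so that its value at index m + 1 records the
    -- transported vector.
    refine ⟨fun i => if i < m then U i else if i = m then u else fun _ => u 1, ?_, ?_, fun i hi => ?_⟩
    · rcases Nat.eq_zero_or_pos m with rfl | hm
      · simp [hu0, ← hUm, hU0]
      · simp [hm, hU0]
    · simp only [add_lt_iff_neg_left, not_lt_zero, if_false, Nat.succ_ne_self]
      rw [Function.comp_apply, ← hu0, hu.segmentTransport_eq h]
    · rcases (Nat.lt_succ_iff.1 hi).eq_or_lt with rfl | hi'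
      · have : x'' - v i = a := by rw [he, hvm, add_sub_cancel_left]
        simp only [le_refl, if_true, lt_irrefl, if_false, add_lt_iff_neg_left, not_lt_zero,
          Nat.succ_ne_self, show ¬ i + 1 ≤ i by omega, this, and_true]
        rwa [hvm]
      · obtain ⟨h1, h2⟩ := hUs i hi'
        simp only [hi'.le, if_true, show i + 1 ≤ m by omega, hi']
        refine ⟨h1, ?_⟩
        rcases (show i + 1 ≤ m by omega).eq_or_lt with h3 | h3
        · rw [if_neg (by omega), if_pos h3, hu0, h2, h3, hUm]
        · rw [if_pos h3, h2]

/-- The edges of a polygon with given vertices. -/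
def edge (v : ℕ → Coord n) (i : ℕ) (s : ℝ) : Coord n := v i + s • (v (i + 1) - v i)

theorem edge_one (v : ℕ → Coord n) (i : ℕ) : edge v i 1 = edge v (i + 1) 0 := by
  simp [edge]

theorem sub_mem_unit {m i : ℕ} (hm : 0 < m) {t : ℝ} (ht : t ∈ Icc ((i : ℝ) / m) ((i + 1 : ℕ) / m)) :
    t * m ∈ Icc (i : ℝ) (i + 1) ∧ t * m - i ∈ Icc (0 : ℝ) 1 := by
  have hm' : (0 : ℝ) < m := by exact_mod_cast hm
  have h1 := (div_le_iff₀ hm').1 ht.1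
  have h2 := (le_div_iff₀ hm').1 ht.2
  push_cast at h2
  exact ⟨⟨h1, h2⟩, by linarith, by linarith⟩

theorem edge_mem {m i : ℕ} {v : ℕ → Coord n} {U : ℕ → ℝ → Coord n}
    (hU : IsHorizontalSegment Ω L (v i) (v (i + 1) - v i) (U i)) (hm : 0 < m) {t : ℝ}
    (ht : t ∈ Icc ((i : ℝ) / m) ((i + 1 : ℕ) / m)) :
    (edge v i (t * m - i), U i (t * m - i)) ∈ slit Ω := hU.mem _ (sub_mem_unit hm ht).2

theorem hasDerivWithinAt_edge {m : ℕ} (i : ℕ) (v : ℕ → Coord n) (s : Set ℝ) (t : ℝ) :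
    HasDerivWithinAt (fun t : ℝ => edge v i (t * m - i)) ((m : ℝ) • (v (i + 1) - v i)) s t := by
  have h1 : HasDerivAt (fun t : ℝ => t * m - i) (m : ℝ) t := by
    simpa using ((hasDerivAt_id t).mul_const (m : ℝ)).sub_const (i : ℝ)
  exact ((h1.smul_const (v (i + 1) - v i)).const_add (v i)).hasDerivWithinAt

theorem hasDerivWithinAt_lift (h : IsLocalFinsler Ω L) {m i : ℕ} {v : ℕ → Coord n}
    {U : ℕ → ℝ → Coord n} (hU : IsHorizontalSegment Ω L (v i) (v (i + 1) - v i) (U i)) (hm : 0 < m)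
    {t : ℝ} (ht : t ∈ Icc ((i : ℝ) / m) ((i + 1 : ℕ) / m)) :
    HasDerivWithinAt (fun t : ℝ => (edge v i (t * m - i), U i (t * m - i)))
      (localHor L (edge v i (t * m - i), U i (t * m - i)) ((m : ℝ) • (v (i + 1) - v i)))
      (Icc ((i : ℝ) / m) ((i + 1 : ℕ) / m)) t := by
  have h1 : HasDerivWithinAt (fun t : ℝ => t * m - i) (m : ℝ) (Icc ((i : ℝ) / m) ((i + 1 : ℕ) / m)) t := by
    simpa using (((hasDerivAt_id t).mul_const (m : ℝ)).sub_const (i : ℝ)).hasDerivWithinAt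
  have h2 := (hU.hasDerivWithinAt _ (sub_mem_unit hm ht).2).scomp t h1
    fun s hs => (sub_mem_unit hm hs).2
  have h3 := (hasDerivWithinAt_edge (m := m) i v (Icc ((i : ℝ) / m) ((i + 1 : ℕ) / m)) t).prodMk h2
  rw [localHor, h.localConn_smul (edge_mem hU hm ht), ← smul_neg]
  exact h3

end Polygons

/-! ### Horizontal lifts of curves in charts and in the manifold. -/

section Lifts

variable {n : ℕ} {M : Type*} [TopologicalSpace M] [ChartedSpace (Coord n) M]
  [IsManifold (Mdl n) ∞ M] {F : TangentBundle (Mdl n) M → ℝ} {p : M} {s : Set ℝ} {t : ℝ}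

/-- Velocities at c(t) are read in the chart at c(t), whence the derivative of the transition from
the chart at p. -/
theorem hasMFDerivWithinAt_curve {c : ℝ → M} {γ : ℝ → Coord n} {a : Coord n} (ht : t ∈ s)
    (hc : ∀ w ∈ s, c w = (extChartAt (Mdl n) p).symm (γ w))
    (hmem : γ t ∈ (extChartAt (Mdl n) p).target) (hγ : HasDerivWithinAt γ a s t) :
    HasMFDerivWithinAt 𝓘(ℝ, ℝ) (Mdl n) c s t
      (ContinuousLinearMap.toSpanSingleton ℝ (fderiv ℝ (transition p (c t)) (γ t) a : Coord n)) := by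
  have h1 : ContinuousWithinAt c s t := by
    have h2 : ContinuousAt (extChartAt (Mdl n) p).symm (γ t) :=
      (continuousOn_extChartAt_symm p).continuousAt ((isOpen_extChartAt_target p).mem_nhds hmem)
    exact (h2.comp_continuousWithinAt hγ.continuousWithinAt).congr hc (hc t ht)
  have hov : γ t ∈ overlap p (c t) := ⟨hmem, by
    rw [mem_preimage, ← hc t ht]
    exact mem_extChartAt_source _⟩
  have h2 : HasFDerivAt (transition (n := n) p (c t)) (fderiv ℝ (transition p (c t)) (γ t)) (γ t) :=
    (((contDiffOn_transition p (c t)).contDiffAt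
      ((isOpen_overlap p (c t)).mem_nhds hov)).differentiableAt (by simp)).hasFDerivAt
  have h3 : HasDerivWithinAt (fun w => extChartAt (Mdl n) (c t) (c w))
      (fderiv ℝ (transition p (c t)) (γ t) a) s t :=
    (h2.comp_hasDerivWithinAt t hγ).congr (fun w hw => by rw [hc w hw]; rfl)
      (congrArg (extChartAt (Mdl n) (c t)) (hc t ht))
  exact ⟨h1, (h3.hasFDerivWithinAt).mono inter_subset_left⟩

theorem hasMFDerivWithinAt_lift {Γ : ℝ → TangentBundle (Mdl n) M} {γ : ℝ → Coord n × Coord n}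
    {A : Coord n × Coord n} (ht : t ∈ s) (hΓ : ∀ w ∈ s, Γ w = (tchart p).symm (γ w))
    (hmem : (γ t).1 ∈ (extChartAt (Mdl n) p).target) (hγ : HasDerivWithinAt γ A s t) :
    HasMFDerivWithinAt 𝓘(ℝ, ℝ) (Mdl n).tangent Γ s t (ContinuousLinearMap.toSpanSingleton ℝ
      (fderiv ℝ (tangentLift (transition p (Γ t).1)) (γ t) A : Coord n × Coord n)) := by
  have h1 : ContinuousWithinAt Γ s t := by
    have h2 : ContinuousAt (tchart p).symm (γ t) :=
      (continuousOn_extChartAt_symm (I := (Mdl n).tangent) _).continuousAt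
        ((isOpen_extChartAt_target _).mem_nhds (mem_tchart_target.2 hmem))
    exact (h2.comp_continuousWithinAt hγ.continuousWithinAt).congr hΓ (hΓ t ht)
  have hov : (γ t).1 ∈ overlap p (Γ t).1 := ⟨hmem, by
    rw [hΓ t ht]
    exact mem_extChartAt_source _⟩
  have h2 : HasFDerivAt (tangentLift (transition (n := n) p (Γ t).1))
      (fderiv ℝ (tangentLift (transition p (Γ t).1)) (γ t)) (γ t) :=
    ((contDiffAt_tangentLift_transition hov).differentiableAt (by simp)).hasFDerivAt
  have hnear : ∀ᶠ w in 𝓝[s] t, (γ w).1 ∈ overlap p (Γ t).1 :=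
    (continuousAt_fst.comp_continuousWithinAt hγ.continuousWithinAt).eventually_mem
      ((isOpen_overlap p (Γ t).1).mem_nhds hov)
  have h3 : HasDerivWithinAt (fun w => tchart (Γ t).1 (Γ w))
      (fderiv ℝ (tangentLift (transition p (Γ t).1)) (γ t) A) s t := by
    refine (h2.comp_hasDerivWithinAt t hγ).congr_of_eventuallyEq ?_ ?_
    · filter_upwards [hnear, self_mem_nhdsWithin] with w hw hws
      rw [hΓ w hws, tchart_tchart_symm hw]
      rfl
    · have : tchart (Γ t).1 (Γ t) = tchart (Γ t).1 ((tchart p).symm (γ t)) :=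
        congrArg (tchart (Γ t).1) (hΓ t ht)
      rw [this, tchart_tchart_symm hov]
      rfl
  exact ⟨h1, (h3.hasFDerivWithinAt).mono inter_subset_left⟩

/-- A curve in `TM` that is horizontal in the chart at `p` is horizontal. -/
theorem hasMFDerivWithinAt_horizontal (hF : IsFinsler F) {Γ : ℝ → TangentBundle (Mdl n) M}
    {γ : ℝ → Coord n × Coord n} {a : Coord n} (ht : t ∈ s) (hs : UniqueDiffWithinAt ℝ s t)
    (hΓ : ∀ w ∈ s, Γ w = (tchart p).symm (γ w))
    (hmem : γ t ∈ slit (extChartAt (Mdl n) p).target)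
    (hγ : HasDerivWithinAt γ (localHor (normSqInChart F p) (γ t) a) s t) :
    HasMFDerivWithinAt 𝓘(ℝ, ℝ) (Mdl n).tangent Γ s t (ContinuousLinearMap.toSpanSingleton ℝ
      (horizontalLift F (Γ t) (mfderivWithin 𝓘(ℝ, ℝ) (Mdl n) (fun w => (Γ w).1) s t (1 : ℝ)))) := by
  have h1 := hasMFDerivWithinAt_lift ht hΓ hmem.1 hγ
  have hγ1 : HasDerivWithinAt (fun w => (γ w).1) a s t := by
    have := hasFDerivAt_fst (𝕜 := ℝ) (E := Coord n) (F := Coord n) (p := γ t)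
    exact this.comp_hasDerivWithinAt t hγ
  have h2 := hasMFDerivWithinAt_curve (c := fun w => (Γ w).1) ht
    (fun w hw => congrArg (fun v : TangentBundle (Mdl n) M => v.1) (hΓ w hw)) hmem.1 hγ1
  have hs' : UniqueMDiffWithinAt 𝓘(ℝ, ℝ) s t := uniqueMDiffWithinAt_iff_uniqueDiffWithinAt.2 hs
  have h3 : (mfderivWithin 𝓘(ℝ, ℝ) (Mdl n) (fun w => (Γ w).1) s t (1 : ℝ) : Coord n) =
      fderiv ℝ (transition p (Γ t).1) (γ t).1 a := by
    rw [h2.mfderivWithin hs']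
    exact one_smul ℝ _
  have hov : γ t ∈ slit (overlap p (Γ t).1) := ⟨⟨hmem.1, by
    rw [hΓ t ht]
    exact mem_extChartAt_source _⟩, hmem.2⟩
  have h4 := (hF.isCoordChange p (Γ t).1).localHor_tangentLift (hF.isLocalFinsler_overlap p _)
    (hF.isLocalFinsler_overlap _ p) hov a
  have h5 : tangentLift (transition p (Γ t).1) (γ t) = tchart (Γ t).1 (Γ t) := by
    rw [← tchart_tchart_symm hov.1]
    exact congrArg (tchart (Γ t).1) (hΓ t ht).symm
  have h6 : (horizontalLift F (Γ t) (mfderivWithin 𝓘(ℝ, ℝ) (Mdl n) (fun w => (Γ w).1) s t (1 : ℝ)) :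
      Coord n × Coord n) = fderiv ℝ (tangentLift (transition p (Γ t).1)) (γ t)
        (localHor (normSqInChart F p) (γ t) a) := by
    refine Eq.trans ?_ h4
    rw [h5, ← h3]
    rfl
  exact h6 ▸ h1

end Lifts

/-! ### Polygon loops as elements of the holonomy group. -/

section Holonomy

variable {n : ℕ} {M : Type*} [TopologicalSpace M] [ChartedSpace (Coord n) M]
  [IsManifold (Mdl n) ∞ M] {F : TangentBundle (Mdl n) M → ℝ} {p : M} {δ : ℝ}
  {σ : Coord n → Coord n}

section

variable (hF : IsFinsler F) (hδ : IsTransportRadius (extChartAt (Mdl n) p).target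
  (normSqInChart F p) (extChartAt (Mdl n) p p) δ)
include hF hδ

theorem mem_indicatrix_of_polygonLoops (hσ : σ ∈ polygonLoops (extChartAt (Mdl n) p).target
    (normSqInChart F p) (extChartAt (Mdl n) p p) δ (extChartAt (Mdl n) p p)) (y : indicatrix F p) :
    σ y ∈ indicatrix F p := by
  have h1 := IsPolygonTransport.norm_sq hσ hδ (hF.isLocalFinsler p) (indicatrix_ne_zero hF y)
  rw [normSqInChart_center hF, normSqInChart_center hF, fibreNorm_eq_one] at h1
  change fibreNorm F p (σ y) = 1
  have h2 : 0 ≤ fibreNorm F p (σ y) := hF.nonneg _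
  nlinarith

/-- The restriction of a parallel translation along a closed polygon to the indicatrix. -/
theorem exists_diffeo_of_polygonLoops (hσ : σ ∈ polygonLoops (extChartAt (Mdl n) p).target
    (normSqInChart F p) (extChartAt (Mdl n) p p) δ (extChartAt (Mdl n) p p)) :
    ∃ g : diffGroup F p, ∀ y : indicatrix F p, σ y = (g.1 y : Coord n) := by
  have hf := hF.isLocalFinsler p
  obtain ⟨τ, hτ, hl, hr⟩ := IsPolygonTransport.exists_inverse hσ hδ hf
  let e : Equiv.Perm (indicatrix F p) :=
    { toFun := fun y => ⟨σ y, mem_indicatrix_of_polygonLoops hF hδ hσ y⟩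
      invFun := fun y => ⟨τ y, mem_indicatrix_of_polygonLoops hF hδ hτ y⟩
      left_inv := fun y => Subtype.ext (hl y (indicatrix_ne_zero hF y))
      right_inv := fun y => Subtype.ext (hr y (indicatrix_ne_zero hF y)) }
  have hsm : ∀ {σ : Coord n → Coord n}, σ ∈ polygonLoops (extChartAt (Mdl n) p).target
      (normSqInChart F p) (extChartAt (Mdl n) p p) δ (extChartAt (Mdl n) p p) →
      ContDiffOn ℝ ∞ σ (indicatrix F p) := fun hσ =>
    (IsPolygonTransport.contDiffOn hσ hδ hf).mono fun y hy => indicatrix_ne_zero hF ⟨y, hy⟩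
  exact ⟨⟨e, (hsm hσ).congr fun y hy => permMap_of_mem F p e ⟨y, hy⟩,
    (hsm hτ).congr fun y hy => permMap_of_mem F p e⁻¹ ⟨y, hy⟩⟩, fun y => rfl⟩

/-- The i-th of the m edges is traversed on [i/m, (i + 1)/m]. A polygon without edges gives no
subdivision of [0, 1]; it induces the identity, excluded by `hg1`. The point `y₀` serves to see that
the edges stay in the chart, which is recorded only through a parallel field along them. -/
theorem isParallelTranslation_of_polygonLoops (r : ℕ∞)
    (hσ : σ ∈ polygonLoops (extChartAt (Mdl n) p).target (normSqInChart F p)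
      (extChartAt (Mdl n) p p) δ (extChartAt (Mdl n) p p)) {g : Equiv.Perm (indicatrix F p)}
    (hg : ∀ y : indicatrix F p, σ y = (g y : Coord n)) (y₀ : indicatrix F p) (hg1 : g ≠ 1) :
    IsParallelTranslation F r p g := by
  have hf := hF.isLocalFinsler p
  obtain ⟨m, v, hv0, hvm, hU⟩ := IsPolygonTransport.exists_vertices hσ hδ hf
  have hm : 0 < m := by
    rcases Nat.eq_zero_or_pos m with rfl | hm
    · refine (hg1 (Equiv.ext fun y => Subtype.ext ?_)).elim
      obtain ⟨U, h1, h2, -⟩ := hU y (indicatrix_ne_zero hF y)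
      rw [← hg y, ← h2, h1]
      rfl
    · exact hm
  have hm' : (0 : ℝ) < m := by exact_mod_cast hm
  have hγ : ∀ i : ℕ, ∀ t ∈ Icc ((i : ℝ) / m) ((i + 1 : ℕ) / m),
      glue (edge v) (t * m) = edge v i (t * m - i) := fun i t ht =>
    glue_eq (edge_one v i) (sub_mem_unit hm ht).1
  refine ⟨m, fun i => i / m, fun t => (extChartAt (Mdl n) p).symm (glue (edge v) (t * m)),
    ⟨by simp, div_self hm'.ne', fun i hi => ⟨?_, ?_⟩⟩, ?_, ?_, fun y => ?_⟩
  · have : (i : ℝ) < (i + 1 : ℕ) := by exact_mod_cast i.lt_succ_self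
    exact div_lt_div_of_pos_right this hm'
  · obtain ⟨U, -, -, h3⟩ := hU y₀ (indicatrix_ne_zero hF y₀)
    have h1 : ContDiff ℝ ∞ fun t : ℝ => edge v i (t * m - i) := by
      unfold edge
      fun_prop
    have h2 : ContMDiffOn 𝓘(ℝ, Coord n) (Mdl n) ∞ (extChartAt (Mdl n) p).symm
        (extChartAt (Mdl n) p).target := contMDiffOn_extChartAt_symm p
    have h4 := h2.comp (s := Icc ((i : ℝ) / m) ((i + 1 : ℕ) / m)) h1.contMDiff.contMDiffOn
      fun t ht => (edge_mem (h3 i hi).1 hm ht).1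
    exact (h4.congr fun t ht => by rw [hγ i t ht]; rfl).of_le (by exact_mod_cast le_top)
  · simp only [zero_mul]
    rw [show (0 : ℝ) = (0 : ℕ) by simp, glue_natCast]
    simp [edge, hv0]
  · simp only [one_mul]
    rw [glue_natCast]
    simp [edge, hvm]
  · obtain ⟨U, hU0, hUm, hUs⟩ := hU y (indicatrix_ne_zero hF y)
    let P : ℕ → ℝ → Coord n × Coord n := fun i s => (edge v i s, U i s)
    let Γ : ℝ → TangentBundle (Mdl n) M := fun t => (tchart p).symm (glue P (t * m))
    refine ⟨fun t => (Γ t).2, fun i hi t ht => ?_, ?_, ?_⟩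
    · have hP : ∀ w ∈ Icc ((i : ℝ) / m) ((i + 1 : ℕ) / m), Γ w = (tchart p).symm
          (edge v i (w * m - i), U i (w * m - i)) := fun w hw =>
        congrArg (tchart p).symm (glue_eq (f := P) (Prod.ext (edge_one v i) (hUs i hi).2)
          (sub_mem_unit hm hw).1)
      have hlt : (i : ℝ) / m < (i + 1 : ℕ) / m := by
        have : (i : ℝ) < (i + 1 : ℕ) := by exact_mod_cast i.lt_succ_self
        exact div_lt_div_of_pos_right this hm'
      exact hasMFDerivWithinAt_horizontal hF ht (uniqueDiffOn_Icc hlt t ht) hP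
        (edge_mem (hUs i hi).1 hm ht) (hasDerivWithinAt_lift hf (hUs i hi).1 hm ht)
    · change Γ 0 = _
      have h1 : glue P ((0 : ℝ) * m) = (extChartAt (Mdl n) p p, (y : Coord n)) := by
        rw [zero_mul, show (0 : ℝ) = (0 : ℕ) by simp, glue_natCast]
        refine Prod.ext ?_ hU0
        simp [P, edge, hv0]
      exact (congrArg (tchart p).symm h1).trans (tchart_symm_center p (y : Coord n))
    · change Γ 1 = _
      have h1 : glue P ((1 : ℝ) * m) = (extChartAt (Mdl n) p p, (g y : Coord n)) := by
        rw [one_mul, glue_natCast]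
        refine Prod.ext ?_ (hUm.trans (hg y))
        simp [P, edge, hvm]
      exact (congrArg (tchart p).symm h1).trans (tchart_symm_center p _)

theorem exists_mem_holonomyGroup (r : ℕ∞)
    (hσ : σ ∈ polygonLoops (extChartAt (Mdl n) p).target (normSqInChart F p)
      (extChartAt (Mdl n) p p) δ (extChartAt (Mdl n) p p)) :
    ∃ g ∈ holonomyGroup F r p, ∀ y : indicatrix F p, σ y = (g.1 y : Coord n) := by
  obtain ⟨g, hg⟩ := exists_diffeo_of_polygonLoops hF hδ hσ
  refine ⟨g, ?_, hg⟩
  by_cases h1 : g = 1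
  · rw [h1]
    exact one_mem _
  · have h2 : g.1 ≠ 1 := fun h => h1 (Subtype.ext h)
    obtain ⟨y₀, -⟩ : ∃ y, g.1 y ≠ y := by
      by_contra! h
      exact h2 (Equiv.ext h)
    exact Subgroup.subset_closure (isParallelTranslation_of_polygonLoops hF hδ r hσ hg y₀ h2)

end

end Holonomy

/-! ### The algebras at a point. -/

section AtPoint

variable {n : ℕ} {M : Type*} [TopologicalSpace M] [ChartedSpace (Coord n) M]
  [IsManifold (Mdl n) ∞ M] {F : TangentBundle (Mdl n) M → ℝ} {p : M} {δ r : ℝ}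
  {ξ η : BundleField F} {Ξ H : Coord n × Coord n → Coord n} {ζ ζ' : indicatrix F p → Coord n}

/-- `ζ` is the restriction of the field `ξ` to the indicatrix at `p`. -/
def IsRestrictionAt (F : TangentBundle (Mdl n) M → ℝ) (p : M) (ξ : BundleField F)
    (ζ : indicatrix F p → Coord n) : Prop :=
  ∀ y : indicatrix F p, ξ ⟨⟨p, (y : Coord n)⟩, y.2⟩ =
    verticalLift (⟨p, (y : Coord n)⟩ : TangentBundle (Mdl n) M) (ζ y)

namespace IsTangentRepresentation

section

variable (hF : IsFinsler F) (h : IsTangentRepresentation F p δ r ξ Ξ)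
include hF h

theorem center_mem (y : indicatrix F p) : (extChartAt (Mdl n) p p, (y : Coord n)) ∈
    slit (Metric.ball (extChartAt (Mdl n) p p) r) :=
  ⟨Metric.mem_ball_self h.pos, indicatrix_ne_zero hF y⟩

theorem eq_verticalLift (y : indicatrix F p) : ξ ⟨⟨p, (y : Coord n)⟩, y.2⟩ =
    verticalLift (⟨p, (y : Coord n)⟩ : TangentBundle (Mdl n) M)
      (Ξ (extChartAt (Mdl n) p p, y)) := by
  have h1 := h.rep ⟨⟨p, (y : Coord n)⟩, y.2⟩ (mem_extChartAt_source p)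
  rw [tchart_center] at h1
  have h2 := h1 (h.center_mem hF y)
  rwa [chartDeriv_self (⟨p, (y : Coord n)⟩ : TangentBundle (Mdl n) M)] at h2

theorem isRestrictionAt_iff : IsRestrictionAt F p ξ ζ ↔
    ∀ y : indicatrix F p, Ξ (extChartAt (Mdl n) p p, y) = ζ y := by
  refine forall_congr' fun y => ?_
  rw [h.eq_verticalLift hF y]
  exact ⟨fun h1 => congrArg Prod.snd h1, fun h1 => congrArg (Prod.mk (0 : Coord n)) h1⟩

theorem fderiv_fibreNorm_center (y : indicatrix F p) :
    fderiv ℝ (fibreNorm F p) y (Ξ (extChartAt (Mdl n) p p, y)) = 0 := by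
  have hz := h.center_mem hF y
  have h1 : DifferentiableAt ℝ (normSqInChart F p) (extChartAt (Mdl n) p p, (y : Coord n)) :=
    ((hF.isLocalFinsler p).smooth.contDiffAt ((hF.isLocalFinsler p).mem_nhds
      ⟨h.subset_target hz.1, hz.2⟩)).differentiableAt (by simp)
  have h2 : HasFDerivAt (fun y : Coord n => (extChartAt (Mdl n) p p, y))
      ((0 : Coord n →L[ℝ] Coord n).prod (ContinuousLinearMap.id ℝ (Coord n))) (y : Coord n) :=
    (hasFDerivAt_const _ _).prodMk (hasFDerivAt_id _)
  have h3 := HasFDerivAt.comp (y : Coord n) (g := normSqInChart F p) h1.hasFDerivAt h2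
  have h4 := (hasFDerivAt_fibreNorm (p := p) hF hz.2).pow 2
  have h5 := (h3.congr_of_eventuallyEq (Eventually.of_forall fun w =>
    (normSqInChart_center hF w).symm)).unique h4
  have h6 := DFunLike.congr_fun h5 (Ξ (extChartAt (Mdl n) p p, y))
  have h7 : (0 : ℝ) = _ := (h.level _ hz).symm.trans h6
  simpa [fibreNorm_eq_one] using h7.symm

theorem mem_tangentFields (hδ : IsTransportRadius (extChartAt (Mdl n) p).target
    (normSqInChart F p) (extChartAt (Mdl n) p p) δ) (hζ : IsRestrictionAt F p ξ ζ) (s : ℕ∞) :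
    ζ ∈ tangentFields F p (holonomyGroup F s p) :=
  mem_tangentFields_of_isTangentTo hF h.tangent (Metric.mem_ball_self h.pos)
    (fun _ hσ => exists_mem_holonomyGroup hF hδ s hσ) ((h.isRestrictionAt_iff hF).1 hζ)
    (h.fderiv_fibreNorm_center hF)

/-- The bracket of vertical fields differentiates only along the fibre, so it commutes with
restriction to one indicatrix. -/
theorem isRestrictionAt_bundleBracket (hδ : IsTransportRadius (extChartAt (Mdl n) p).target
    (normSqInChart F p) (extChartAt (Mdl n) p p) δ) (h' : IsTangentRepresentation F p δ r η H)
    (hζ : IsRestrictionAt F p ξ ζ) (hζ' : IsRestrictionAt F p η ζ') :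
    IsRestrictionAt F p (bundleBracket F ξ η) (indicatrixBracket F p ζ ζ') := by
  refine ((h.lie hF hδ h').isRestrictionAt_iff hF).2 fun y => ?_
  have hz := h.center_mem hF y
  have hd : ∀ {Ξ : Coord n × Coord n → Coord n},
      ContDiffAt ℝ ∞ Ξ (extChartAt (Mdl n) p p, (y : Coord n)) →
      DifferentiableAt ℝ (fun w : Coord n => Ξ (extChartAt (Mdl n) p p, w)) y := fun {Ξ} h1 =>
    (ContDiffAt.comp (y : Coord n) (g := Ξ) h1
      (contDiff_prodMk_right _).contDiffAt).differentiableAt (by simp)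
  exact (indicatrixBracket_eq hF ((h.isRestrictionAt_iff hF).1 hζ)
    ((h'.isRestrictionAt_iff hF).1 hζ') y (hd (h.contDiffAt hz)) (hd (h'.contDiffAt hz))
    (h.fderiv_fibreNorm_center hF y) (h'.fderiv_fibreNorm_center hF y)).symm

end

end IsTangentRepresentation

theorem infHolonomyAlgebraAt_subset (hF : IsFinsler F) (s : ℕ∞) :
    infHolonomyAlgebraAt F p ⊆ holonomyAlgebra F s p := by
  rintro ζ ⟨ξ, hξ, hζ⟩
  obtain ⟨δ, hδ⟩ := exists_transportRadius (hF.isLocalFinsler p) (extChartAt_self_mem_target p)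
  obtain ⟨r, Ξ, h⟩ := infHolonomyAlgebra_subset hF hξ p δ hδ
  exact h.mem_tangentFields hF hδ hζ s

theorem isLieSubalgebraOf_infHolonomyAlgebraAt (hF : IsFinsler F)
    {K : Set (indicatrix F p → Coord n)} (hK : infHolonomyAlgebraAt F p ⊆ K) :
    IsLieSubalgebraOf (indicatrixBracket F p) K (infHolonomyAlgebraAt F p) := by
  have hLie := isLieSubalgebraOf_infHolonomyAlgebra hF
  refine ⟨hK, ⟨0, hLie.zero_mem, fun y => rfl⟩, ?_, ?_, ?_⟩
  · rintro ζ ⟨ξ, hξ, hζ⟩ ζ' ⟨η, hη, hζ'⟩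
    refine ⟨ξ + η, hLie.add_mem ξ hξ η hη, fun y => ?_⟩
    refine (congrArg₂ (· + ·) (hζ y) (hζ' y)).trans ?_
    exact Prod.ext (add_zero (0 : Coord n)) rfl
  · rintro c ζ ⟨ξ, hξ, hζ⟩
    refine ⟨c • ξ, hLie.smul_mem c ξ hξ, fun y => ?_⟩
    refine (congrArg (c • ·) (hζ y)).trans ?_
    exact Prod.ext (smul_zero c : c • (0 : Coord n) = 0) rfl
  · rintro ζ ⟨ξ, hξ, hζ⟩ ζ' ⟨η, hη, hζ'⟩
    obtain ⟨δ, hδ⟩ := exists_transportRadius (hF.isLocalFinsler p) (extChartAt_self_mem_target p)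
    obtain ⟨r, Ξ, H, h, h'⟩ := exists_common_representation hδ (infHolonomyAlgebra_subset hF hξ)
      (infHolonomyAlgebra_subset hF hη)
    exact ⟨_, hLie.lie_mem ξ hξ η hη, h.isRestrictionAt_bundleBracket hF hδ h' hζ hζ'⟩

theorem infHolonomyAlgebraAt_subset_indicatrixFields (hF : IsFinsler F) :
    infHolonomyAlgebraAt F p ⊆ indicatrixFields F p :=
  fun _ hζ => (infHolonomyAlgebraAt_subset hF 1 hζ).1

/-- A local extension is cut off by a bump function; in a Hausdorff manifold the product, extended
by zero, is smooth everywhere. -/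
theorem exists_smooth_extension [T2Space M] (a : TangentSpace (Mdl n) p) :
    ∃ X : (x : M) → TangentSpace (Mdl n) x, IsSmoothField X ∧ X p = a := by
  obtain ⟨s, hs, h⟩ := FiberBundle.exists_contMDiffOn_extend (I := Mdl n) (k := ∞) (F := Coord n)
    (V := fun x : M => TangentSpace (Mdl n) x) a
  obtain ⟨f, -, hf⟩ := (SmoothBumpFunction.nhds_basis_tsupport (I := Mdl n) p).mem_iff.1
    (interior_mem_nhds.2 hs)
  refine ⟨fun x => f x • FiberBundle.extend (Coord n) a x, ?_, ?_⟩
  · exact ContMDiffOn.smul_section_of_tsupport f.contMDiff.contMDiffOn isOpen_interior hf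
      (h.mono interior_subset)
  · simp only [f.eq_one, one_smul]
    exact FiberBundle.extend_apply_self (Coord n) a

/-- R(Xʰ, Yʰ) over p depends only on X(p) and Y(p), so global fields extending a and b restrict to
the given curvature field. -/
theorem curvatureFieldsAt_subset [T2Space M] :
    curvatureFieldsAt F p ⊆ infHolonomyAlgebraAt F p := by
  rintro ζ ⟨a, b, hζ⟩
  obtain ⟨X, hX, rfl⟩ := exists_smooth_extension a
  obtain ⟨Y, hY, rfl⟩ := exists_smooth_extension b
  exact ⟨_, curvatureFields_subset_infHolonomyAlgebra ⟨X, Y, hX, hY, fun _ => rfl⟩,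
    fun y => (hζ y).symm⟩

end AtPoint

/-! ### Generated Lie subalgebras and the conclusion. -/

section Lie

variable {V : Type*} [AddCommGroup V] [Module ℝ V] {br : V → V → V} {K L S : Set V}

/-- L is itself one of the subalgebras of K over which the intersection is taken. -/
theorem isLieSubalgebraOf_lieSpan (hL : IsLieSubalgebraOf br K L) (hS : S ⊆ L) :
    IsLieSubalgebraOf br L (lieSpan br K S) where
  subset _ hξ := hξ L hL hS
  zero_mem _ h _ := h.zero_mem
  add_mem ξ hξ η hη L' h h' := h.add_mem ξ (hξ L' h h') η (hη L' h h')
  smul_mem c ξ hξ L' h h' := h.smul_mem c ξ (hξ L' h h')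
  lie_mem ξ hξ η hη L' h h' := h.lie_mem ξ (hξ L' h h') η (hη L' h h')

end Lie

end FinslerHolonomy

end

open FinslerHolonomy in
theorem mainTheorem11 {n : ℕ} {M : Type*} [TopologicalSpace M] [T2Space M]
    [ChartedSpace (Coord n) M] [IsManifold (Mdl n) ∞ M]
    (F : TangentBundle (Mdl n) M → ℝ) (hF : IsFinsler F) (p : M) (r : ℕ∞) (hr : 1 ≤ r) :
    (∀ ξ ∈ infHolonomyAlgebraAt F p, ξ ∈ tangentFields F p (holonomyGroup F r p)) ∧
    IsLieSubalgebraOf (indicatrixBracket F p) (holonomyAlgebra F r p)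
      (infHolonomyAlgebraAt F p) ∧
    IsLieSubalgebraOf (indicatrixBracket F p) (infHolonomyAlgebraAt F p)
      (curvatureAlgebraAt F p) ∧
    IsLieSubalgebraOf (indicatrixBracket F p) (indicatrixFields F p)
      (holonomyAlgebra F r p) ∧
    IsLieSubalgebraOf (indicatrixBracket F p) (indicatrixFields F p)
      (indicatrixFields F p) :=
  ⟨fun _ hξ => infHolonomyAlgebraAt_subset hF r hξ,
    isLieSubalgebraOf_infHolonomyAlgebraAt hF (infHolonomyAlgebraAt_subset hF r),
    isLieSubalgebraOf_lieSpan (isLieSubalgebraOf_infHolonomyAlgebraAt hF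
      (infHolonomyAlgebraAt_subset_indicatrixFields hF)) curvatureFieldsAt_subset,
    isLieSubalgebraOf_tangentFields hF _, isLieSubalgebraOf_indicatrixFields hF⟩
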